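/- **Setting.** Let $m\ge 1$, let $V$ be a finite-dimensional real vector space, and let $\Gamma=(\gamma_1,\dots,\gamma_m)$ be a configuration of vectors spanning $V^*$ for which there is $v_1\in V$ with $\langle\gamma_i,v_1\rangle=1$ for all $i$. Let $W=\{w\in\mathbb R^m:\sum_i w_i\gamma_i=0\}$ and let $\mathrm A=(a_1,\dots,a_m)$ in $W^*$ be the Gale dual configuration, $\langle a_i,w\rangle=w_i$. Put $V'=V/\mathbb R v_1$, choose a linear splitting $s\colon V'\to V$ of the projection, and let $\Gamma'=(\gamma_1',\dots,\gamma_m')$, $\gamma_i'=\gamma_i\circ s\in (V')^*$. Let $\mathcal E$ be a nonempty collection of subsets $J\subset[m]=\{1,\dots,m\}$ such that for each $J\in\mathcal E$ the subconfiguration $\Gamma'_J=\{\gamma'_j:j\in J\}$ is a minimal affine generating set of $(V')^*$ (no proper subset of $J$ indexes an affine generating set). The pair $(\mathcal E,\Gamma')$ is an *LVMB datum* if (imbrication) for all $I,J\in\mathcal E$ the polytopes $\operatorname{conv}\Gamma'_I$ and $\operatorname{conv}\Gamma'_J$ have a common interior point in $(V')^*$, and (substitute existence) for all $J\in\mathcal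 E$ and $i\in[m]$ there is $j\in J$ with $(J\setminus\{j\})\cup\{i\}\in\mathcal E$. Let $\mathcal K=\{I\subset[m]: I\cap J=\varnothing\text{ for some }J\in\mathcal E\}$, and let $$P(\mathcal E)=\{[z]\in\mathbb CP^{m-1}:\ \exists J\in\mathcal E\ \forall j\in J\ z_j\ne0\},\qquad U_{\mathbb C}(\mathcal K)=\mathbb C^m\setminus\bigcup_{I\subset[m],\,I\notin\mathcal K}\{z: z_i=0\text{ for all }i\in I\},$$ $$\mathcal Z_{\mathcal K}=\bigcup_{I\in\mathcal K}\{z\in\mathbb C^m:\ |z_i|\le1\text{ for }i\in I,\ |z_i|=1\text{ for }i\notin I\}.$$ The pair $\{\mathcal K,\mathrm A\}$ is a *triangulated configuration* if $\mathcal K$ is a simplicial complex containing $\varnothing$ (ghost vertices allowed), $\mathrm A$ spans $W^*$, for every $I\in\mathcal K$ the vectors $a_i$, $i\in I$, are linearly independent, and the cones $\operatorname{cone}\mathrm A_I$, $I\in\mathcal K$, form a fan with $\operatorname{cone}\mathrm A_I\cap\operatorname{cone}\mathrm A_J=\operatorname{cone}\mathrm A_{I\cap J}$ for all $I,J\in\mathcal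 K$. **Proposition.** 1. $P(\mathcal E)$ is the projectivisation of $U_{\mathbb C}(\mathcal K)$: $0\notin U_{\mathbb C}(\mathcal K)$, and for every $z\ne0$ one has $[z]\in P(\mathcal E)$ if and only if $z\in U_{\mathbb C}(\mathcal K)$. 2. $(\mathcal E,\Gamma')$ is an LVMB datum if and only if $\{\mathcal K,\mathrm A\}$ is a triangulated configuration and the fan $\{\operatorname{cone}\mathrm A_I: I\in\mathcal K\}$ is a complete simplicial fan in $W^*$. 3. Let $(\mathcal E,\Gamma')$ be an LVMB datum and let $\mathcal J'$ be a complex structure on $V'$ (a linear map $V'\to V'$ with $\mathcal J'^2=-\mathrm{id}$; in particular $\dim V'$ is even). Write $\widetilde V'=(V',\mathcal J')$ and $\langle\gamma,v\rangle_{\mathbb C}=\langle\gamma,v\rangle-i\langle\gamma,\mathcal J'v\rangle$. Let $\widetilde V'$ act on $P(\mathcal E)$ by $v\cdot[z_1:\dots:z_m]=[e^{\langle\gamma'_1,v\rangle_{\mathbb C}}z_1:\dots:e^{\langle\gamma'_m,v\rangle_{\mathbb C}}z_m]$, let $\mathbb C^\times\times\widetilde V'$ act on $U_{\mathbb C}(\mathcal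 K)$ by $(t,v)\cdot z=(t\,e^{\langle\gamma'_1,v\rangle_{\mathbb C}}z_1,\dots,t\,e^{\langle\gamma'_m,v\rangle_{\mathbb C}}z_m)$, and let $\mathcal N=P(\mathcal E)/\widetilde V'$ with the quotient topology. Then: - the diagonal circle $S^1$ acts freely on $\mathcal Z_{\mathcal K}$, and $z\mapsto[z]$ induces a homeomorphism $\mathcal Z_{\mathcal K}/S^1\cong\mathcal N$; - $\mathcal N$ is compact and Hausdorff, and both $\mathcal N$ and $U_{\mathbb C}(\mathcal K)/(\mathbb C^\times\times\widetilde V')$ carry a quotient complex structure of dimension $m-1-\tfrac12\dim V'$, that is, a complex manifold structure for which the projection from $P(\mathcal E)$, respectively from $U_{\mathbb C}(\mathcal K)$, is a holomorphic submersion; - $z\mapsto[z]$ induces a homeomorphism $U_{\mathbb C}(\mathcal K)/(\mathbb C^\times\times\widetilde V')\cong\mathcal N$, which is biholomorphic for these complex structures. -/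

import Mathlib

open Set Module
open scoped Manifold ContDiff LinearAlgebra.Projectivization

noncomputable section

namespace LVMB

/-! ### Complex projective space as a complex manifold -/

/-- The quotient topology on `ℂPⁿ`. -/
instance projTopology (n : ℕ) : TopologicalSpace (ℙ ℂ (Fin (n + 1) → ℂ)) :=
  inferInstanceAs (TopologicalSpace
    (Quotient (projectivizationSetoid ℂ (Fin (n + 1) → ℂ))))

theorem isQuotientMap_mk' (n : ℕ) :
    Topology.IsQuotientMap (Projectivization.mk' ℂ (V := Fin (n + 1) → ℂ)) :=
  isQuotientMap_quotient_mk'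

theorem rep_mk {n : ℕ} (z : Fin (n + 1) → ℂ) (hz : z ≠ 0) :
    ∃ a : ℂˣ, ∀ i, (Projectivization.mk ℂ z hz).rep i = a * z i := by
  obtain ⟨a, ha⟩ := Projectivization.exists_smul_eq_mk_rep ℂ z hz
  exact ⟨a, fun i => by rw [← ha]; rfl⟩

theorem rep_mk_ne_zero_iff {n : ℕ} (z : Fin (n + 1) → ℂ) (hz : z ≠ 0) (i : Fin (n + 1)) :
    (Projectivization.mk ℂ z hz).rep i ≠ 0 ↔ z i ≠ 0 := by
  obtain ⟨a, ha⟩ := rep_mk z hz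
  simp [ha]

theorem insertNth_one_ne_zero {n : ℕ} (j : Fin (n + 1)) (w : Fin n → ℂ) :
    (j.insertNth (1 : ℂ) w : Fin (n + 1) → ℂ) ≠ 0 := by
  intro h
  have := congrFun h j
  simp at this

/-- The domain `{z_j ≠ 0}` of the `j`-th affine chart is open. -/
theorem isOpen_coord_ne_zero {n : ℕ} (j : Fin (n + 1)) :
    IsOpen {p : ℙ ℂ (Fin (n + 1) → ℂ) | p.rep j ≠ 0} := by
  rw [← (isQuotientMap_mk' n).isOpen_preimage]
  have : Projectivization.mk' ℂ ⁻¹' {p : ℙ ℂ (Fin (n + 1) → ℂ) | p.rep j ≠ 0}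
      = {v : {v : Fin (n + 1) → ℂ // v ≠ 0} | v.1 j ≠ 0} := by
    ext ⟨v, hv⟩
    exact rep_mk_ne_zero_iff v hv j
  rw [this]
  exact isOpen_ne_fun ((continuous_apply j).comp continuous_subtype_val) continuous_const

/-- The standard affine chart `[z] ↦ (z_i / z_j)_{i ≠ j}` on `{z_j ≠ 0}`. -/
def affineChart {n : ℕ} (j : Fin (n + 1)) :
    OpenPartialHomeomorph (ℙ ℂ (Fin (n + 1) → ℂ)) (Fin n → ℂ) where
  toFun p := fun i => p.rep (j.succAbove i) / p.rep j
  invFun w := Projectivization.mk ℂ (j.insertNth (1 : ℂ) w) (insertNth_one_ne_zero j w)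
  source := {p | p.rep j ≠ 0}
  target := univ
  map_source' _ _ := mem_univ _
  map_target' w _ := by
    simp only [mem_ofPred_eq]
    rw [rep_mk_ne_zero_iff]
    simp
  left_inv' p hp := by
    conv_rhs => rw [← p.mk_rep]
    rw [Projectivization.mk_eq_mk_iff']
    refine ⟨(p.rep j)⁻¹, ?_⟩
    ext i
    refine Fin.succAboveCases j ?_ (fun i => ?_) i
    · simpa using inv_mul_cancel₀ hp
    · simp [div_eq_inv_mul]
  right_inv' w _ := by
    obtain ⟨a, ha⟩ := rep_mk (j.insertNth (1 : ℂ) w) (insertNth_one_ne_zero j w)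
    ext i
    simp [ha]
  open_source := isOpen_coord_ne_zero j
  open_target := isOpen_univ
  continuousOn_toFun := by
    refine ((isQuotientMap_mk' n).continuousOn_isOpen_iff (isOpen_coord_ne_zero j)).2 ?_
    have : EqOn ((fun p : ℙ ℂ (Fin (n + 1) → ℂ) =>
          fun i => p.rep (j.succAbove i) / p.rep j) ∘ Projectivization.mk' ℂ)
        (fun v i => v.1 (j.succAbove i) / v.1 j)
        (Projectivization.mk' ℂ ⁻¹' {p : ℙ ℂ (Fin (n + 1) → ℂ) | p.rep j ≠ 0}) := by
      rintro ⟨v, hv⟩ _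
      obtain ⟨a, ha⟩ := rep_mk v hv
      ext i
      simp only [Function.comp, Projectivization.mk'_eq_mk, ha]
      exact mul_div_mul_left _ _ a.ne_zero
    refine ContinuousOn.congr ?_ this
    refine continuousOn_pi.2 fun i => ContinuousOn.div
      ((continuous_apply _).comp continuous_subtype_val).continuousOn
      ((continuous_apply _).comp continuous_subtype_val).continuousOn ?_
    rintro ⟨v, hv⟩ h
    exact (rep_mk_ne_zero_iff v hv j).1 h
  continuousOn_invFun := by
    refine Continuous.continuousOn ?_
    refine (isQuotientMap_mk' n).continuous.comp
      (f := fun w => (⟨j.insertNth (1 : ℂ) w, insertNth_one_ne_zero j w⟩ :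
        {v : Fin (n + 1) → ℂ // v ≠ 0})) ?_
    refine Continuous.subtype_mk ?_ _
    fun_prop

theorem exists_rep_ne_zero {n : ℕ} (p : ℙ ℂ (Fin (n + 1) → ℂ)) : ∃ j, p.rep j ≠ 0 := by
  by_contra! h
  exact p.rep_nonzero (funext h)

/-- The standard atlas of `ℂPⁿ`. -/
instance projChartedSpace (n : ℕ) : ChartedSpace (Fin n → ℂ) (ℙ ℂ (Fin (n + 1) → ℂ)) where
  atlas := range affineChart
  chartAt p := affineChart (exists_rep_ne_zero p).choose
  mem_chart_source p := (exists_rep_ne_zero p).choose_spec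
  chart_mem_atlas _ := mem_range_self _

/-- `ℂPⁿ` is a complex manifold. -/
instance projIsManifold (n : ℕ) :
    IsManifold 𝓘(ℂ, Fin n → ℂ) ω (ℙ ℂ (Fin (n + 1) → ℂ)) := by
  refine isManifold_of_contDiffOn _ _ _ ?_
  rintro _ _ ⟨j, rfl⟩ ⟨j', rfl⟩
  have hne : ∀ w ∈ ((affineChart j).symm ≫ₕ affineChart j').source,
      (j.insertNth (1 : ℂ) w : Fin (n + 1) → ℂ) j' ≠ 0 := by
    intro w hw
    rw [OpenPartialHomeomorph.trans_source] at hw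
    exact (rep_mk_ne_zero_iff (j.insertNth (1 : ℂ) w) (insertNth_one_ne_zero j w) j').1 hw.2
  have hco : ∀ i, ContDiff ℂ ω
      (fun w : Fin n → ℂ => (j.insertNth (1 : ℂ) w : Fin (n + 1) → ℂ) i) := by
    intro i
    refine Fin.succAboveCases j ?_ (fun i => ?_) i
    · simpa using contDiff_const
    · simpa using contDiff_apply ℂ ℂ i
  simp only [modelWithCornersSelf_coe, modelWithCornersSelf_coe_symm, Function.comp_def, id,
    preimage_id_eq, range_id, inter_univ]
  have : EqOn (fun w => ((affineChart j).symm ≫ₕ affineChart j') w)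
      (fun w i => (j.insertNth (1 : ℂ) w : Fin (n + 1) → ℂ) (j'.succAbove i) /
        (j.insertNth (1 : ℂ) w : Fin (n + 1) → ℂ) j')
      ((affineChart j).symm ≫ₕ affineChart j').source := by
    intro w hw
    obtain ⟨a, ha⟩ := rep_mk (j.insertNth (1 : ℂ) w) (insertNth_one_ne_zero j w)
    ext i
    change (Projectivization.mk ℂ (j.insertNth (1 : ℂ) w : Fin (n + 1) → ℂ)
        (insertNth_one_ne_zero j w)).rep (j'.succAbove i) /
      (Projectivization.mk ℂ (j.insertNth (1 : ℂ) w : Fin (n + 1) → ℂ)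
        (insertNth_one_ne_zero j w)).rep j' = _
    rw [ha, ha]
    exact mul_div_mul_left _ _ a.ne_zero
  refine ContDiffOn.congr ?_ this
  exact contDiffOn_pi.2 fun i => ((hco _).contDiffOn).div ((hco _).contDiffOn) hne

/-! ### Linear Gale duality, fans and triangulated configurations -/

section Fans

variable {ι : Type*} [Fintype ι] [DecidableEq ι]

/-- The space of linear relations between the vectors `γ i`, i.e. the kernel of
`ℝ^ι → E`, `e_i ↦ γ i`. -/
abbrev Relations {E : Type*} [AddCommGroup E] [Module ℝ E] (γ : ι → E) : Submodule ℝ (ι → ℝ) :=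
  LinearMap.ker (Fintype.linearCombination ℝ γ)

/-- The linear Gale transform of `γ`: the `i`-th vector is the functional on the space of linear
relations that takes a relation to its `i`-th coefficient. -/
def galeDual {E : Type*} [AddCommGroup E] [Module ℝ E] (γ : ι → E) (i : ι) :
    Dual ℝ (Relations γ) :=
  (LinearMap.proj i).comp (Relations γ).subtype

variable {E : Type*} [AddCommGroup E] [Module ℝ E]

/-- A simplicial complex on `ι`: it contains `∅`, and ghost vertices are allowed. -/
def IsSimplicialComplex (K : Set (Finset ι)) : Prop :=
  ∅ ∈ K ∧ ∀ I ∈ K, ∀ J ⊆ I, J ∈ K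

/-- `cone (a i : i ∈ I)`. -/
def coneOf (a : ι → E) (I : Finset ι) : PointedCone ℝ E :=
  PointedCone.hull ℝ (a '' I)

/-- A fan: a finite set of strongly convex polyhedral cones that is closed under passing to faces
and in which any two cones intersect in a common face. -/
structure IsFan (S : Set (PointedCone ℝ E)) : Prop where
  finite : S.Finite
  polyhedral : ∀ σ ∈ S, σ.FG
  stronglyConvex : ∀ σ ∈ S, (σ : ConvexCone ℝ E).Salient
  face_mem : ∀ σ ∈ S, ∀ τ : PointedCone ℝ E, τ.IsFaceOf σ → τ ∈ S
  inter_face : ∀ σ ∈ S, ∀ τ ∈ S, (σ ⊓ τ).IsFaceOf σ ∧ (σ ⊓ τ).IsFaceOf τ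

/-- The set of cones defined by the pair `(K, a)`. -/
def conesOf (K : Set (Finset ι)) (a : ι → E) : Set (PointedCone ℝ E) :=
  {σ | ∃ I ∈ K, σ = coneOf a I}

/-- Simplicial fan data (a triangulated configuration): `K` is a simplicial complex, `a` is a
spanning configuration, and the cones over the simplices of `K` form a fan in which the cone over
each simplex `I` has exactly `I` as its set of generators. -/
structure IsTriangulatedConfiguration (K : Set (Finset ι)) (a : ι → E) : Prop where
  isSimplicialComplex : IsSimplicialComplex K
  spanning : Submodule.span ℝ (range a) = ⊤
  isFan : IsFan (conesOf K a)
  linearIndependent : ∀ I ∈ K, LinearIndepOn ℝ a (I : Set ι)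
  inter_eq : ∀ I ∈ K, ∀ J ∈ K, coneOf a I ⊓ coneOf a J = coneOf a (I ∩ J)

/-- A complete simplicial fan. -/
structure IsCompleteSimplicialFan (S : Set (PointedCone ℝ E)) : Prop where
  isFan : IsFan S
  simplicial : ∀ σ ∈ S, σ.IsSimplicial
  complete : (⋃ σ ∈ S, (σ : Set E)) = univ

/-! ### LVMB data -/

/-- Interior with respect to the canonical vector space topology of a finite-dimensional real
vector space. -/
def vectorInterior (S : Set E) : Set E :=
  @interior E (moduleTopology ℝ E) S

/-- `J` indexes a minimal affine generating set of the ambient vector space. -/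
def IsMinimalAffineGenerating (γ' : ι → E) (J : Finset ι) : Prop :=
  Minimal (fun J : Finset ι => affineSpan ℝ (γ' '' J) = ⊤) J

/-- The two conditions defining an LVMB datum. -/
structure IsLVMBDatum (ℰ : Set (Finset ι)) (γ' : ι → E) : Prop where
  imbrication : ∀ I ∈ ℰ, ∀ J ∈ ℰ,
    (vectorInterior (convexHull ℝ (γ' '' (I : Set ι))) ∩
      vectorInterior (convexHull ℝ (γ' '' (J : Set ι)))).Nonempty
  substituteExistence : ∀ J ∈ ℰ, ∀ i, ∃ j ∈ J, insert i (J.erase j) ∈ ℰ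

/-- The simplicial complex whose maximal simplices are the complements of the members of `ℰ`. -/
def complexOf (ℰ : Set (Finset ι)) : Set (Finset ι) :=
  {I | ∃ J ∈ ℰ, I ⊆ Jᶜ}

end Fans

/-! ### The open sets `U_ℂ(K)` and `P(ℰ)`, and the moment-angle complex -/

section Spaces

variable {n : ℕ}

/-- `U_ℂ(K)`: the complement of the coordinate subspaces `{z_i = 0 for i ∈ I}`, `I ∉ K`. -/
def coordComplement (K : Set (Finset (Fin (n + 1)))) :
    TopologicalSpace.Opens (Fin (n + 1) → ℂ) where
  carrier := (⋃ I ∈ Kᶜ, {z | ∀ i ∈ I, z i = 0})ᶜ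
  is_open' := by
    refine (Set.Finite.isClosed_biUnion (Set.toFinite _) fun I _ => ?_).isOpen_compl
    simp only [ofPred_forall]
    exact isClosed_iInter fun i => isClosed_iInter fun _ =>
      isClosed_eq (continuous_apply i) continuous_const

/-- `P(ℰ)`: the points `[z]` of projective space such that `{j | z_j ≠ 0}` contains some
member of `ℰ`. -/
def projComplement (ℰ : Set (Finset (Fin (n + 1)))) :
    TopologicalSpace.Opens (ℙ ℂ (Fin (n + 1) → ℂ)) where
  carrier := ⋃ J ∈ ℰ, {p | ∀ j ∈ J, p.rep j ≠ 0}
  is_open' := by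
    refine isOpen_biUnion fun J _ => ?_
    have : {p : ℙ ℂ (Fin (n + 1) → ℂ) | ∀ j ∈ J, p.rep j ≠ 0}
        = ⋂ j ∈ J, {p : ℙ ℂ (Fin (n + 1) → ℂ) | p.rep j ≠ 0} := by
      ext p; simp
    rw [this]
    exact isOpen_biInter_finset fun j _ => isOpen_coord_ne_zero j

/-- The moment-angle complex `(D², S¹)^K = ⋃_{I ∈ K} ∏_{i ∈ I} D² × ∏_{i ∉ I} S¹`. -/
def momentAngle (K : Set (Finset (Fin (n + 1)))) : Set (Fin (n + 1) → ℂ) :=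
  ⋃ I ∈ K, {z | (∀ i ∈ I, ‖z i‖ ≤ 1) ∧ ∀ i ∉ I, ‖z i‖ = 1}

/-- The diagonal action of a point of the circle on the moment-angle complex. -/
def circleAct (K : Set (Finset (Fin (n + 1)))) (c : Circle) (z : momentAngle K) :
    momentAngle K :=
  ⟨fun i => (c : ℂ) * z.1 i, by
    have := z.2
    simp only [momentAngle, mem_iUnion, mem_ofPred_eq, norm_mul, Circle.norm_coe, one_mul]
      at this ⊢
    exact this⟩

/-- Orbits of the diagonal circle action on the moment-angle complex. -/
def circleSetoid (K : Set (Finset (Fin (n + 1)))) : Setoid (momentAngle K) where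
  r z w := ∃ c : Circle, circleAct K c z = w
  iseqv :=
    { refl := fun z => ⟨1, by ext i; simp [circleAct]⟩
      symm := by
        rintro z _ ⟨c, rfl⟩
        exact ⟨c⁻¹, by ext i; simp [circleAct]⟩
      trans := by
        rintro z _ _ ⟨c, rfl⟩ ⟨c', rfl⟩
        exact ⟨c' * c, by ext i; simp [circleAct, mul_assoc]⟩ }

end Spaces

/-! ### Holomorphic exponential and torus-exponential actions -/

section Actions

variable {n : ℕ} {F : Type*} [AddCommGroup F] [Module ℝ F]

/-- The complex pairing `⟨γ, v⟩_ℂ = ⟨γ, v⟩ - i ⟨γ, 𝒥 v⟩` defined by a complex structure `𝒥`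
on `F`; it is `ℂ`-linear in `v`. -/
def complexPairing (𝒥 : F →ₗ[ℝ] F) (γ : Dual ℝ F) (v : F) : ℂ :=
  (γ v : ℂ) - Complex.I * (γ (𝒥 v) : ℂ)

theorem complexPairing_zero (𝒥 : F →ₗ[ℝ] F) (γ : Dual ℝ F) : complexPairing 𝒥 γ 0 = 0 := by
  simp [complexPairing]

theorem complexPairing_add (𝒥 : F →ₗ[ℝ] F) (γ : Dual ℝ F) (v w : F) :
    complexPairing 𝒥 γ (v + w) = complexPairing 𝒥 γ v + complexPairing 𝒥 γ w := by
  simp only [complexPairing, map_add, Complex.ofReal_add]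
  ring

/-- `z ↦ (exp ⟨γ'_i, v⟩_ℂ z_i)_i` as a linear automorphism of `ℂ^{n+1}`. -/
def expLinear (γ' : Fin (n + 1) → Dual ℝ F) (𝒥 : F →ₗ[ℝ] F) (v : F) :
    (Fin (n + 1) → ℂ) →ₗ[ℂ] (Fin (n + 1) → ℂ) where
  toFun z i := Complex.exp (complexPairing 𝒥 (γ' i) v) * z i
  map_add' z w := by ext i; simp [mul_add]
  map_smul' c z := by ext i; simp [mul_left_comm]

theorem expLinear_injective (γ' : Fin (n + 1) → Dual ℝ F) (𝒥 : F →ₗ[ℝ] F) (v : F) :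
    Function.Injective (expLinear γ' 𝒥 v) := by
  intro z w h
  ext i
  exact mul_left_cancel₀ (Complex.exp_ne_zero _) (congrFun h i)

theorem expLinear_zero (γ' : Fin (n + 1) → Dual ℝ F) (𝒥 : F →ₗ[ℝ] F)
    (z : Fin (n + 1) → ℂ) : expLinear γ' 𝒥 0 z = z := by
  ext i
  simp [expLinear, complexPairing_zero]

theorem expLinear_add (γ' : Fin (n + 1) → Dual ℝ F) (𝒥 : F →ₗ[ℝ] F) (v w : F)
    (z : Fin (n + 1) → ℂ) :
    expLinear γ' 𝒥 (v + w) z = expLinear γ' 𝒥 v (expLinear γ' 𝒥 w z) := by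
  ext i
  simp [expLinear, complexPairing_add, Complex.exp_add, mul_assoc]

/-- The holomorphic exponential action
`v · [z] = [exp ⟨γ'_1, v⟩_ℂ z_1 : … : exp ⟨γ'_m, v⟩_ℂ z_m]` on projective space. -/
def expProj (γ' : Fin (n + 1) → Dual ℝ F) (𝒥 : F →ₗ[ℝ] F) (v : F) :
    ℙ ℂ (Fin (n + 1) → ℂ) → ℙ ℂ (Fin (n + 1) → ℂ) :=
  Projectivization.map (expLinear γ' 𝒥 v) (expLinear_injective γ' 𝒥 v)

theorem expProj_zero (γ' : Fin (n + 1) → Dual ℝ F) (𝒥 : F →ₗ[ℝ] F)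
    (p : ℙ ℂ (Fin (n + 1) → ℂ)) : expProj γ' 𝒥 0 p = p := by
  induction p with
  | h z hz => simp [expProj, Projectivization.map_mk, expLinear_zero]

theorem expProj_add (γ' : Fin (n + 1) → Dual ℝ F) (𝒥 : F →ₗ[ℝ] F) (v w : F)
    (p : ℙ ℂ (Fin (n + 1) → ℂ)) :
    expProj γ' 𝒥 (v + w) p = expProj γ' 𝒥 v (expProj γ' 𝒥 w p) := by
  induction p with
  | h z hz => simp [expProj, Projectivization.map_mk, expLinear_add]

theorem expProj_rep_ne_zero_iff (γ' : Fin (n + 1) → Dual ℝ F) (𝒥 : F →ₗ[ℝ] F) (v : F)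
    (p : ℙ ℂ (Fin (n + 1) → ℂ)) (i : Fin (n + 1)) :
    (expProj γ' 𝒥 v p).rep i ≠ 0 ↔ p.rep i ≠ 0 := by
  induction p with
  | h z hz =>
    rw [expProj, Projectivization.map_mk, rep_mk_ne_zero_iff, rep_mk_ne_zero_iff]
    simp [expLinear]

/-- The holomorphic exponential action restricted to `P(ℰ)`. -/
def expAct (ℰ : Set (Finset (Fin (n + 1)))) (γ' : Fin (n + 1) → Dual ℝ F)
    (𝒥 : F →ₗ[ℝ] F) (v : F) (p : projComplement ℰ) : projComplement ℰ :=
  ⟨expProj γ' 𝒥 v p.1, by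
    obtain ⟨p, hp⟩ := p
    change p ∈ (⋃ J ∈ ℰ, _ : Set _) at hp
    change _ ∈ (⋃ J ∈ ℰ, _ : Set _)
    simpa only [mem_iUnion, mem_ofPred_eq, expProj_rep_ne_zero_iff] using hp⟩

/-- Orbits of the holomorphic exponential action on `P(ℰ)`. -/
def expSetoid (ℰ : Set (Finset (Fin (n + 1)))) (γ' : Fin (n + 1) → Dual ℝ F)
    (𝒥 : F →ₗ[ℝ] F) : Setoid (projComplement ℰ) where
  r p q := ∃ v : F, expAct ℰ γ' 𝒥 v p = q
  iseqv :=
    { refl := fun p => ⟨0, Subtype.ext (expProj_zero γ' 𝒥 p.1)⟩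
      symm := by
        rintro p _ ⟨v, rfl⟩
        refine ⟨-v, Subtype.ext ?_⟩
        change expProj γ' 𝒥 (-v) (expProj γ' 𝒥 v p.1) = p.1
        rw [← expProj_add, neg_add_cancel, expProj_zero]
      trans := by
        rintro p _ _ ⟨v, rfl⟩ ⟨w, rfl⟩
        exact ⟨w + v, Subtype.ext (expProj_add γ' 𝒥 w v p.1)⟩ }

/-- The space `P(ℰ) / F` with the quotient topology. -/
abbrev LVMBQuotient (ℰ : Set (Finset (Fin (n + 1)))) (γ' : Fin (n + 1) → Dual ℝ F)
    (𝒥 : F →ₗ[ℝ] F) : Type :=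
  Quotient (expSetoid ℰ γ' 𝒥)

/-- The holomorphic torus-exponential action of `(t, v) ∈ ℂˣ × F` on `U_ℂ(K)`, in which `ℂˣ`
acts diagonally. -/
def torusExpAct (K : Set (Finset (Fin (n + 1)))) (γ' : Fin (n + 1) → Dual ℝ F)
    (𝒥 : F →ₗ[ℝ] F) (t : ℂˣ) (v : F) (z : coordComplement K) : coordComplement K :=
  ⟨(t : ℂ) • expLinear γ' 𝒥 v z.1, by
    obtain ⟨z, hz⟩ := z
    change z ∈ (⋃ I ∈ Kᶜ, _ : Set _)ᶜ at hz
    change _ ∈ (⋃ I ∈ Kᶜ, _ : Set _)ᶜ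
    simpa [expLinear] using hz⟩

/-- Orbits of the torus-exponential action on `U_ℂ(K)`. -/
def torusExpSetoid (K : Set (Finset (Fin (n + 1)))) (γ' : Fin (n + 1) → Dual ℝ F)
    (𝒥 : F →ₗ[ℝ] F) : Setoid (coordComplement K) where
  r z w := ∃ (t : ℂˣ) (v : F), torusExpAct K γ' 𝒥 t v z = w
  iseqv :=
    { refl := fun z => ⟨1, 0, Subtype.ext (by simp [torusExpAct, expLinear_zero])⟩
      symm := by
        rintro z _ ⟨t, v, rfl⟩
        refine ⟨t⁻¹, -v, Subtype.ext ?_⟩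
        simp only [torusExpAct, map_smul, smul_smul]
        rw [← expLinear_add, neg_add_cancel, expLinear_zero]
        simp
      trans := by
        rintro z _ _ ⟨t, v, rfl⟩ ⟨t', v', rfl⟩
        refine ⟨t' * t, v' + v, Subtype.ext ?_⟩
        simp [torusExpAct, smul_smul, expLinear_add] }

/-- The space `U_ℂ(K) / (ℂˣ × F)` with the quotient topology. -/
abbrev TorusExpQuotient (K : Set (Finset (Fin (n + 1)))) (γ' : Fin (n + 1) → Dual ℝ F)
    (𝒥 : F →ₗ[ℝ] F) : Type :=
  Quotient (torusExpSetoid K γ' 𝒥)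

end Actions

/-! ### Quotient complex structures -/

/-- The given charts make `Y` a complex manifold of dimension `d` whose complex structure is the
quotient one with respect to `π : X → Y`: the map `π` is a surjective holomorphic submersion, i.e.
it is holomorphic and has a local holomorphic section through every point of `X`. (There is at most
one such complex structure on the topological space `Y`.) -/
structure IsQuotientComplexManifold {N d : ℕ} {X Y : Type*} [TopologicalSpace X]
    [ChartedSpace (Fin N → ℂ) X] [TopologicalSpace Y] [ChartedSpace (Fin d → ℂ) Y]
    (π : X → Y) : Prop where
  isManifold : IsManifold 𝓘(ℂ, Fin d → ℂ) ω Y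
  surjective : Function.Surjective π
  holomorphic : ContMDiff 𝓘(ℂ, Fin N → ℂ) 𝓘(ℂ, Fin d → ℂ) ω π
  section_through : ∀ x : X, ∃ O : Set Y, IsOpen O ∧ π x ∈ O ∧ ∃ σ : Y → X,
    σ (π x) = x ∧ (∀ y ∈ O, π (σ y) = y) ∧
      ContMDiffOn 𝓘(ℂ, Fin d → ℂ) 𝓘(ℂ, Fin N → ℂ) ω σ O

end LVMB

end

open LVMB

/-! The splitting writes `V` as `V' × ℝ` with `γ_i (x, r) = γ'_i x + r`. A vector of `V` is then an
affine function on `(V')^*`, and `γ_i` reads off its value at the point `γ'_i`. For `J ∈ ℰ` affine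
functions are interpolated uniquely at the points of `Γ'_J`, i.e. `Γ_J` is a basis of `V^*`. By
Hahn–Banach, two full-dimensional polytopes fail to have a common interior point exactly when a
nonzero affine function is `≤ 0` on one and `≥ 0` on the other, so imbrication amounts to
`IsInseparable`.

By Gale duality (`sum_smul_galeDual_eq_zero_iff`) the linear relations among the `a_i` are the
vectors `(γ_i v)_i`, so `W^*` is `ℝ^m` modulo `V`. A class lies in the cone over the complement of
`J` iff it has a nonnegative representative vanishing on `J`. Interpolation on `J` makes the
generators of this cone independent, and inseparability is the condition that the cones intersect in
the cones over common simplices. Substitute existence provides a maximal cone across each wall of a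
maximal cone. It yields completeness by walking along a generic segment that crosses one wall at a
time (`eventually_isCovered`, `isCovered_of_substituteExistence`); conversely, in a complete fan,
the cone found just beyond a wall is the substitute (`substituteExistence_of_complete`).

For the quotients, logarithms turn the action into translation by a complex subspace `L` of `ℂ^m`
whose real parts are the vectors `(γ_i v)_i`. Completeness applied to `(-log |z_i|)` moves every
orbit into `Z_K`, whence compactness. Imbrication in quantitative form
(`exists_bound_of_imbrication`) bounds all real parts of an element of `L` by its upper bounds on
`I` and lower bounds on `J`. Since elements of `L` with zero real part are diagonal phases, this
makes the orbit relation closed, so the quotient is Hausdorff, and makes orbits meet `Z_K` in single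
circles. An element of `L` vanishing on `J` is zero, so some `dim L` coordinates from `J`
parametrise `L`; freezing them gives local holomorphic slices, which are the charts
(`exists_isLocalSlice`). Statements about `P(ℰ)` follow because `U(K) → P(ℰ)` is itself a quotient
of the same kind. -/

namespace LVMB

/-! ### Affine generation in `F^*` versus bases of `V^*` -/

section LiftedConfiguration

variable {ι V F : Type*} [AddCommGroup V] [Module ℝ V] [AddCommGroup F] [Module ℝ F]

/-- `J` indexes a basis of `V^*`, expressed through interpolation: the values `Γ j v`, `j ∈ J`, can
be prescribed and determine `v`. -/
def IsInterpolating (Γ : ι → Dual ℝ V) (J : Finset ι) : Prop :=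
  ∀ y : ι → ℝ, ∃! v, ∀ j ∈ J, Γ j v = y j

/-- No nonzero vector separates two members of `ℰ`. -/
def IsInseparable (Γ : ι → Dual ℝ V) (ℰ : Set (Finset ι)) : Prop :=
  ∀ I ∈ ℰ, ∀ J ∈ ℰ, ∀ v, (∀ i ∈ I, Γ i v ≤ 0) → (∀ j ∈ J, 0 ≤ Γ j v) → v = 0

theorem IsInterpolating.eq_zero {Γ : ι → Dual ℝ V} {J : Finset ι} (h : IsInterpolating Γ J) {v : V}
    (hv : ∀ j ∈ J, Γ j v = 0) : v = 0 :=
  (h 0).unique hv (by simp)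

theorem IsInterpolating.of_basis [FiniteDimensional ℝ V] {Γ : ι → Dual ℝ V} {J : Finset ι}
    (hli : LinearIndepOn ℝ Γ (J : Set ι)) (hsp : Submodule.span ℝ (Γ '' J) = ⊤) :
    IsInterpolating Γ J := by
  classical
  intro y
  let b : Basis J ℝ (Dual ℝ V) := Basis.mk (v := fun j : J => Γ j) hli (by
    rw [← hsp]; apply Submodule.span_mono
    rintro _ ⟨j, hj, rfl⟩; exact ⟨⟨j, hj⟩, rfl⟩)
  have hb : ∀ j : J, b j = Γ j := fun j => Basis.mk_apply _ _ j
  obtain ⟨v, hv⟩ := (Module.evalEquiv ℝ V).surjective (b.constr ℝ fun j : J => y j)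
  have hv' : ∀ f : Dual ℝ V, f v = b.constr ℝ (fun j : J => y j) f := fun f => by
    rw [← hv]; rfl
  refine ⟨v, fun j hj => ?_, fun w hw => ?_⟩
  · rw [hv', show Γ j = b ⟨j, hj⟩ from (hb ⟨j, hj⟩).symm, b.constr_basis]
  · apply (Module.evalEquiv ℝ V).injective
    rw [hv]
    refine b.ext fun j => ?_
    rw [b.constr_basis, hb]
    exact hw j j.2

variable (e : (F × ℝ) ≃ₗ[ℝ] V) {Γ : ι → Dual ℝ V} {Γ' : ι → Dual ℝ F}

/-- A proper span is annihilated by some nonzero `e (x, r)`. The affine function `ξ ↦ ξ x + r` then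
vanishes at the points of `Γ'_J`, hence on all of `F^*`, which forces `r = 0` and `x = 0`. -/
theorem span_eq_top_of_affineSpan_eq_top [FiniteDimensional ℝ V]
    (he : ∀ i x r, Γ i (e (x, r)) = Γ' i x + r) (J : Finset ι)
    (h : affineSpan ℝ (Γ' '' J) = ⊤) : Submodule.span ℝ (Γ '' J) = ⊤ := by
  by_contra hne
  obtain ⟨f, hf0, hf⟩ := Submodule.exists_le_ker_of_lt_top _ (lt_top_iff_ne_top.2 hne)
  obtain ⟨v, rfl⟩ := (Module.evalEquiv ℝ V).surjective f
  obtain ⟨⟨x, r⟩, rfl⟩ := e.surjective v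
  have hker : ∀ j ∈ J, Γ' j x + r = 0 := fun j hj => by
    rw [← he]
    exact hf (Submodule.subset_span ⟨j, hj, rfl⟩)
  let g : Dual ℝ F →ᵃ[ℝ] ℝ :=
    (Dual.eval ℝ F x).toAffineMap + AffineMap.const ℝ (Dual ℝ F) r
  have hg : ∀ ξ, g ξ = ξ x + r := fun ξ => by simp [g]
  have hall : ∀ ξ : Dual ℝ F, ξ x + r = 0 := by
    intro ξ
    have : ξ ∈ affineSpan ℝ (Γ' '' J) := by rw [h]; trivial
    have h2 := AffineSubspace.mem_map_of_mem g this
    rw [AffineSubspace.map_span] at h2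
    have h3 : g '' (Γ' '' J) ⊆ {0} := by
      rintro _ ⟨_, ⟨j, hj, rfl⟩, rfl⟩
      simp [hg, hker j hj]
    have h4 := affineSpan_mono ℝ h3 h2
    simpa [hg] using h4
  have hr : r = 0 := by simpa using hall 0
  have hx : x = 0 := by
    have : FiniteDimensional ℝ F := by
      have : FiniteDimensional ℝ (F × ℝ) := e.symm.finiteDimensional
      exact Module.Finite.of_surjective (LinearMap.fst ℝ F ℝ) LinearMap.fst_surjective
    rw [← Module.forall_dual_apply_eq_zero_iff ℝ]
    intro ξ; simpa [hr] using hall ξ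
  apply hf0
  rw [hr, hx, show ((0 : F), (0 : ℝ)) = 0 from rfl, map_zero, map_zero]

/-- Lift `ξ` to the functional `(x, r) ↦ ξ x + r` and expand it in `Γ_J`. Evaluation at `(0, 1)`
shows that the coefficients sum to one, so the expansion is an affine combination. -/
theorem affineSpan_eq_top_of_span_eq_top
    (he : ∀ i x r, Γ i (e (x, r)) = Γ' i x + r) (J : Finset ι)
    (h : Submodule.span ℝ (Γ '' J) = ⊤) : affineSpan ℝ (Γ' '' J) = ⊤ := by
  classical
  rw [eq_top_iff]
  intro ξ _
  let ξ' : Dual ℝ V := (ξ.coprod LinearMap.id).comp e.symm.toLinearMap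
  have hξ : ξ' ∈ Submodule.span ℝ (Γ '' J) := by rw [h]; trivial
  rw [Submodule.mem_span_image_finset_iff_exists_fun] at hξ
  obtain ⟨c, hc⟩ := hξ
  have key : ∀ x r, ∑ j : J, c j * (Γ' j x + r) = ξ x + r := by
    intro x r
    have := congrArg (fun f : Dual ℝ V => f (e (x, r))) hc
    simpa [ξ', he, LinearMap.sum_apply] using this
  have h1 : ∑ j : J, c j = 1 := by simpa using key 0 1
  have h2 : ∑ j : J, c j • Γ' j = ξ := by
    ext x; simpa [LinearMap.sum_apply] using key x 0
  rw [← h2, ← Finset.affineCombination_eq_linear_combination _ (fun j : J => Γ' j) _ h1]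
  have h3 := affineCombination_mem_affineSpan (k := ℝ) h1 fun j : J => Γ' j
  rwa [show range (fun j : J => Γ' j) = Γ' '' J by ext; simp] at h3

/-- A linear dependence would make some `j ∈ J` redundant for the span, hence for affine generation,
against minimality. -/
theorem IsMinimalAffineGenerating.isInterpolating [FiniteDimensional ℝ V]
    (he : ∀ i x r, Γ i (e (x, r)) = Γ' i x + r) {J : Finset ι}
    (h : IsMinimalAffineGenerating Γ' J) : IsInterpolating Γ J := by
  classical
  have hsp := span_eq_top_of_affineSpan_eq_top e he J h.prop
  refine IsInterpolating.of_basis ?_ hsp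
  rw [linearIndepOn_iff_notMem_span]
  intro j hj hmem
  have h1 : Submodule.span ℝ (Γ '' (J.erase j : Finset ι)) = ⊤ := by
    rw [eq_top_iff, ← hsp, Submodule.span_le]
    rintro _ ⟨i, hi, rfl⟩
    by_cases hij : i = j
    · subst hij; simpa using hmem
    · exact Submodule.subset_span ⟨i, by simpa [hij] using hi, rfl⟩
  have h2 := h.le_of_le (affineSpan_eq_top_of_span_eq_top e he _ h1) (Finset.erase_subset j J)
  exact (Finset.notMem_erase j J) (h2 hj)

/-- Equal cardinality of the members of `ℰ` is what makes a one-element exchange possible in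
`substituteExistence_of_complete`. -/
theorem IsInterpolating.card_eq [FiniteDimensional ℝ V] {J : Finset ι}
    (h : IsInterpolating Γ J) : J.card = finrank ℝ V := by
  classical
  let f : V →ₗ[ℝ] (J → ℝ) := LinearMap.pi fun j => Γ j
  have hf : Function.Bijective f := by
    constructor
    · rw [injective_iff_map_eq_zero]
      intro v hv
      exact h.eq_zero fun j hj => congrFun hv ⟨j, hj⟩
    · intro y
      obtain ⟨v, hv, -⟩ := h fun i => if hi : i ∈ J then y ⟨i, hi⟩ else 0
      refine ⟨v, funext fun j => ?_⟩
      simpa [f] using hv j j.2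
  rw [(LinearEquiv.ofBijective f hf).finrank_eq]
  simp

end LiftedConfiguration

/-! ### Imbrication as inseparability -/

section Imbrication

variable {ι V F : Type*} [AddCommGroup V] [Module ℝ V] [AddCommGroup F] [Module ℝ F]
variable (e : (F × ℝ) ≃ₗ[ℝ] V) {Γ : ι → Dual ℝ V} {Γ' : ι → Dual ℝ F}

/-- Take `x` interior to both hulls and `δ > 0` such that every `x + δ (Γ'_i - x)` is interior to
both as well. The affine function given by `v` is `≤ B` on one hull and `≥ -B` on the other, so it
lies in `[-B, B]` at all these points. Extrapolating from `x` to `Γ'_i` costs the factor `1 + 2 /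
δ`. -/
theorem exists_bound_of_imbrication [Finite ι]
    (he : ∀ i x r, Γ i (e (x, r)) = Γ' i x + r) {I J : Finset ι}
    (h : (vectorInterior (convexHull ℝ (Γ' '' (I : Set ι))) ∩
      vectorInterior (convexHull ℝ (Γ' '' (J : Set ι)))).Nonempty) :
    ∃ C : ℝ, 0 ≤ C ∧ ∀ (v : V) (B : ℝ), (∀ i ∈ I, Γ i v ≤ B) → (∀ j ∈ J, -B ≤ Γ j v) →
      ∀ i, |Γ i v| ≤ C * B := by
  classical
  let : TopologicalSpace (Dual ℝ F) := moduleTopology ℝ (Dual ℝ F)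
  have : IsModuleTopology ℝ (Dual ℝ F) := ⟨rfl⟩
  have := IsModuleTopology.topologicalAddGroup ℝ (Dual ℝ F)
  obtain ⟨x, hxI, hxJ⟩ := h
  change x ∈ interior _ at hxI hxJ
  have hev : ∀ᶠ δ : ℝ in nhds 0, ∀ i, x + δ • (Γ' i - x) ∈
      interior (convexHull ℝ (Γ' '' (I : Set ι))) ∩
        interior (convexHull ℝ (Γ' '' (J : Set ι))) := by
    rw [Filter.eventually_all]
    intro i
    have hc : Continuous fun δ : ℝ => x + δ • (Γ' i - x) := by fun_prop
    refine hc.continuousAt.eventually_mem ?_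
    simp only [zero_smul, add_zero]
    exact (isOpen_interior.inter isOpen_interior).mem_nhds ⟨hxI, hxJ⟩
  obtain ⟨δ, hδ, hδ0⟩ := (Filter.Eventually.and
    (nhdsWithin_le_nhds (s := Ioi 0) hev) self_mem_nhdsWithin).exists
  replace hδ0 : 0 < δ := hδ0
  refine ⟨1 + 2 / δ, by positivity, fun v B hI hJ i => ?_⟩
  obtain ⟨⟨y, r⟩, rfl⟩ := e.surjective v
  simp only [he] at hI hJ ⊢
  have hlin : IsLinearMap ℝ fun ξ : Dual ℝ F => ξ y := ⟨by simp, by simp⟩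
  have hle : ∀ ξ ∈ interior (convexHull ℝ (Γ' '' (I : Set ι))), ξ y + r ≤ B := by
    intro ξ hξ
    have : convexHull ℝ (Γ' '' (I : Set ι)) ⊆ {ξ : Dual ℝ F | ξ y ≤ B - r} := by
      refine convexHull_min ?_ (convex_halfSpace_le hlin _)
      rintro _ ⟨i, hi, rfl⟩
      have := hI i hi
      simp only [mem_ofPred_eq]; linarith
    have := this (interior_subset hξ)
    simp only [mem_ofPred_eq] at this; linarith
  have hge : ∀ ξ ∈ interior (convexHull ℝ (Γ' '' (J : Set ι))), -B ≤ ξ y + r := by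
    intro ξ hξ
    have : convexHull ℝ (Γ' '' (J : Set ι)) ⊆ {ξ : Dual ℝ F | -B - r ≤ ξ y} := by
      refine convexHull_min ?_ (convex_halfSpace_ge hlin _)
      rintro _ ⟨i, hi, rfl⟩
      have := hJ i hi
      simp only [mem_ofPred_eq]; linarith
    have := this (interior_subset hξ)
    simp only [mem_ofPred_eq] at this; linarith
  have h1 := hle x hxI
  have h2 := hge x hxJ
  have h3 := hle _ (hδ i).1
  have h4 := hge _ (hδ i).2
  simp only [LinearMap.add_apply, LinearMap.smul_apply, LinearMap.sub_apply, smul_eq_mul] at h3 h4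
  set t := Γ' i y - x y with ht
  have h5 : t ≤ 2 * B / δ := by rw [le_div_iff₀ hδ0]; linarith
  have h6 : -(2 * B / δ) ≤ t := by
    rw [← neg_div, div_le_iff₀ hδ0]; linarith
  have h7 : (1 + 2 / δ) * B = B + 2 * B / δ := by ring
  rw [h7, abs_le]
  constructor <;> linarith

theorem isInseparable_of_imbrication [Finite ι] [FiniteDimensional ℝ V]
    (he : ∀ i x r, Γ i (e (x, r)) = Γ' i x + r) {ℰ : Set (Finset ι)}
    (hB : ∀ J ∈ ℰ, IsInterpolating Γ J)
    (h : ∀ I ∈ ℰ, ∀ J ∈ ℰ, (vectorInterior (convexHull ℝ (Γ' '' (I : Set ι))) ∩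
      vectorInterior (convexHull ℝ (Γ' '' (J : Set ι)))).Nonempty) : IsInseparable Γ ℰ := by
  intro I hI J hJ v h1 h2
  obtain ⟨C, -, hC⟩ := exists_bound_of_imbrication e he (h I hI J hJ)
  refine (hB I hI).eq_zero fun i _ => ?_
  simpa using hC v 0 h1 (by simpa using h2) i

/-- If the interiors were disjoint, Hahn–Banach would give a separating functional, which is
evaluation at some `x ∈ F`, and a level `u`. Both hulls are closures of their interiors up to
closure, so `e (x, -u)` separates `I` from `J` and must vanish, contradicting strict separation. -/
theorem imbrication_of_isInseparable [FiniteDimensional ℝ F]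
    (he : ∀ i x r, Γ i (e (x, r)) = Γ' i x + r) {ℰ : Set (Finset ι)}
    (hsp : ∀ J ∈ ℰ, affineSpan ℝ (Γ' '' J) = ⊤) (h : IsInseparable Γ ℰ) :
    ∀ I ∈ ℰ, ∀ J ∈ ℰ, (vectorInterior (convexHull ℝ (Γ' '' (I : Set ι))) ∩
      vectorInterior (convexHull ℝ (Γ' '' (J : Set ι)))).Nonempty := by
  intro I hI J hJ
  -- An auxiliary norm is needed for convex separation; in finite dimension it induces the module
  -- topology.
  let φ := (Module.finBasis ℝ (Dual ℝ F)).equivFun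
  let : NormedAddCommGroup (Dual ℝ F) := NormedAddCommGroup.induced _ _ φ φ.injective
  let : NormedSpace ℝ (Dual ℝ F) := NormedSpace.induced ℝ (Dual ℝ F) _ φ
  have : IsModuleTopology ℝ (Dual ℝ F) := isModuleTopologyOfFiniteDimensional
  have htop := eq_moduleTopology ℝ (Dual ℝ F)
  have hvi : ∀ S : Set (Dual ℝ F), vectorInterior S = interior S := fun S => by
    rw [vectorInterior, ← htop]
  rw [hvi, hvi, ← not_disjoint_iff_nonempty_inter]
  intro hdis
  have hnI := (interior_convexHull_nonempty_iff_affineSpan_eq_top).2 (hsp I hI)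
  have hnJ := (interior_convexHull_nonempty_iff_affineSpan_eq_top).2 (hsp J hJ)
  obtain ⟨f, u, hf1, hf2⟩ := geometric_hahn_banach_open_open
    (convex_convexHull ℝ (Γ' '' (I : Set ι))).interior isOpen_interior
    (convex_convexHull ℝ (Γ' '' (J : Set ι))).interior isOpen_interior hdis
  obtain ⟨x, hx⟩ := (Module.evalEquiv ℝ F).surjective f.toLinearMap
  have hx' : ∀ ξ : Dual ℝ F, f ξ = ξ x := fun ξ => by
    change f.toLinearMap ξ = _; rw [← hx]; rfl
  have hI' : ∀ i ∈ I, Γ' i x ≤ u := by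
    intro i hi
    have : Γ' i ∈ closure (interior (convexHull ℝ (Γ' '' (I : Set ι)))) := by
      rw [(convex_convexHull ℝ _).closure_interior_eq_closure_of_nonempty_interior hnI]
      exact subset_closure (subset_convexHull ℝ _ ⟨i, hi, rfl⟩)
    rw [← hx']
    exact closure_minimal (fun y hy => (hf1 y hy).le) (isClosed_le f.continuous continuous_const) this
  have hJ' : ∀ i ∈ J, u ≤ Γ' i x := by
    intro i hi
    have : Γ' i ∈ closure (interior (convexHull ℝ (Γ' '' (J : Set ι)))) := by
      rw [(convex_convexHull ℝ _).closure_interior_eq_closure_of_nonempty_interior hnJ]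
      exact subset_closure (subset_convexHull ℝ _ ⟨i, hi, rfl⟩)
    rw [← hx']
    exact closure_minimal (fun y hy => (hf2 y hy).le) (isClosed_le continuous_const f.continuous) this
  have h0 := h I hI J hJ (e (x, -u)) (fun i hi => by rw [he]; linarith [hI' i hi])
    (fun i hi => by rw [he]; linarith [hJ' i hi])
  rw [LinearEquiv.map_eq_zero_iff, Prod.mk_eq_zero] at h0
  obtain ⟨ξ, hξ⟩ := hnI
  have := hf1 ξ hξ
  rw [hx', h0.1, map_zero] at this
  linarith [h0.2]

end Imbrication

/-! ### Normalised representatives modulo `V` -/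

section Residual

variable {ι V : Type*} [AddCommGroup V] [Module ℝ V] {Γ : ι → Dual ℝ V} {I J : Finset ι}

/-- The representative of `x` modulo `V` that vanishes on `J`. -/
noncomputable def IsInterpolating.residual (h : IsInterpolating Γ J) : (ι → ℝ) →ₗ[ℝ] (ι → ℝ) where
  toFun x i := x i + Γ i (h (-x)).choose
  map_add' x y := by
    have : (h (-(x + y))).choose = (h (-x)).choose + (h (-y)).choose := by
      refine ((h (-(x + y))).choose_spec.2 _ fun j hj => ?_).symm
      rw [map_add, (h (-x)).choose_spec.1 j hj, (h (-y)).choose_spec.1 j hj]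
      simp [add_comm]
    ext i; simp only [this, map_add, Pi.add_apply]; ring
  map_smul' c x := by
    have : (h (-(c • x))).choose = c • (h (-x)).choose := by
      refine ((h (-(c • x))).choose_spec.2 _ fun j hj => ?_).symm
      rw [map_smul, (h (-x)).choose_spec.1 j hj]
      simp
    ext i; simp [this, mul_add]

theorem IsInterpolating.exists_residual_eq (h : IsInterpolating Γ J) (x : ι → ℝ) :
    ∃ v, ∀ i, h.residual x i = x i + Γ i v :=
  ⟨_, fun _ => rfl⟩

theorem IsInterpolating.residual_eq_zero (h : IsInterpolating Γ J) (x : ι → ℝ) {j : ι}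
    (hj : j ∈ J) : h.residual x j = 0 := by
  change x j + Γ j (h (-x)).choose = 0
  rw [(h (-x)).choose_spec.1 j hj]; simp

theorem IsInterpolating.residual_eq (h : IsInterpolating Γ J) (x : ι → ℝ) {v : V}
    (hv : ∀ j ∈ J, x j + Γ j v = 0) (i : ι) : h.residual x i = x i + Γ i v := by
  obtain ⟨w, hw⟩ := h.exists_residual_eq x
  have : w = v := by
    rw [← sub_eq_zero]
    refine h.eq_zero fun j hj => ?_
    have h1 := hw j
    rw [h.residual_eq_zero x hj] at h1
    rw [map_sub]
    linarith [hv j hj]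
  rw [hw, this]

theorem IsInterpolating.residual_eq_self (h : IsInterpolating Γ J) {x : ι → ℝ}
    (hx : ∀ j ∈ J, x j = 0) : h.residual x = x := by
  ext i
  rw [h.residual_eq x (v := 0) (by simpa using hx)]; simp

end Residual

/-! ### Substitute existence implies completeness -/

section Completeness

variable {ι V : Type*} [AddCommGroup V] [Module ℝ V] {Γ : ι → Dual ℝ V} {ℰ : Set (Finset ι)}

/-- The class of `x` modulo `V` lies in the cone spanned by the complement of a member of `ℰ`. -/
def IsCovered (Γ : ι → Dual ℝ V) (ℰ : Set (Finset ι)) (x : ι → ℝ) : Prop :=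
  ∃ J ∈ ℰ, ∃ v, (∀ i, 0 ≤ x i + Γ i v) ∧ ∀ j ∈ J, x j + Γ j v = 0

theorem IsInterpolating.isCovered {J : Finset ι} (h : IsInterpolating Γ J) (hJ : J ∈ ℰ) {x : ι → ℝ}
    (hx : ∀ i, 0 ≤ h.residual x i) : IsCovered Γ ℰ x := by
  obtain ⟨v, hv⟩ := h.exists_residual_eq x
  exact ⟨J, hJ, v, fun i => hv i ▸ hx i, fun j hj => by rw [← hv, h.residual_eq_zero x hj]⟩

/-- If a maximal cone contains points `y + N • ∑_{i ∈ Z} a_i` for arbitrarily large `N`, then it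
has the simplex `Z` as a face. -/
theorem disjoint_of_frequently_residual_nonneg (hB : ∀ J ∈ ℰ, IsInterpolating Γ J)
    (hsep : IsInseparable Γ ℰ) [DecidableEq ι] {J K Z : Finset ι} (hJ : J ∈ ℰ) (hK : K ∈ ℰ) (hZ : Disjoint Z J)
    (y : ι → ℝ) (h : ∃ᶠ N : ℕ in Filter.atTop, ∀ i,
      0 ≤ (hB K hK).residual ((N : ℝ) • (fun i => if i ∈ Z then (1 : ℝ) else 0) + y) i) :
    Disjoint Z K := by
  set χ : ι → ℝ := fun i => if i ∈ Z then (1 : ℝ) else 0 with hχ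
  -- A negative coordinate of the residual of `χ` would outweigh that of `y` once `N` is large.
  have hnn : ∀ i, 0 ≤ (hB K hK).residual χ i := by
    intro i
    by_contra! hneg
    have hev : ∀ᶠ N : ℕ in Filter.atTop,
        (N : ℝ) * (hB K hK).residual χ i + (hB K hK).residual y i < 0 := by
      have h1 : Filter.Tendsto (fun N : ℕ => (N : ℝ) * (hB K hK).residual χ i
          + (hB K hK).residual y i) Filter.atTop Filter.atBot :=
        Filter.tendsto_atBot_add_const_right _ _
          (tendsto_natCast_atTop_atTop.atTop_mul_const_of_neg hneg)
      exact h1.eventually_lt_atBot 0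
    obtain ⟨N, h1, h2⟩ := (h.and_eventually hev).exists
    have := h1 i
    simp only [map_add, map_smul, Pi.add_apply, Pi.smul_apply, smul_eq_mul] at this
    linarith
  obtain ⟨u, hu⟩ := (hB K hK).exists_residual_eq χ
  have hχJ : ∀ j ∈ J, χ j = 0 := fun j hj => if_neg fun hjZ => Finset.disjoint_left.1 hZ hjZ hj
  -- Both `χ` and `χ + Γ u` are nonnegative; the first vanishes on `J`, the second on `K`. Hence `u`
  -- is `≤ 0` on `K` and `≥ 0` on `J`.
  have hu0 : u = 0 := by
    refine hsep K hK J hJ u (fun k hk => ?_) (fun j hj => ?_)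
    · have h1 := hu k
      rw [(hB K hK).residual_eq_zero χ hk] at h1
      have : 0 ≤ χ k := by rw [hχ]; positivity
      linarith
    · have := hnn j
      rwa [hu, hχJ j hj, zero_add] at this
  rw [Finset.disjoint_right]
  intro k hk hkZ
  have h1 := hu k
  rw [(hB K hK).residual_eq_zero χ hk, hu0, map_zero, hχ] at h1
  simp [hkZ] at h1

variable [Finite ι]

theorem isClosed_isCovered (hB : ∀ J ∈ ℰ, IsInterpolating Γ J) :
    IsClosed {x | IsCovered Γ ℰ x} := by
  have : {x | IsCovered Γ ℰ x} =
      ⋃ J : ℰ, {x | ∀ i, 0 ≤ (hB J J.2).residual x i} := by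
    ext x
    simp only [mem_ofPred_eq, mem_iUnion]
    constructor
    · rintro ⟨J, hJ, v, h1, h2⟩
      exact ⟨⟨J, hJ⟩, fun i => by rw [(hB J hJ).residual_eq x h2]; exact h1 i⟩
    · rintro ⟨J, h⟩
      exact (hB J J.2).isCovered J.2 h
  rw [this]
  refine isClosed_iUnion_of_finite fun J => ?_
  simp only [ofPred_forall]
  refine isClosed_iInter fun i => isClosed_le continuous_const ?_
  exact (continuous_apply i).comp (LinearMap.continuous_of_finiteDimensional _)

/-- A finite union of hyperplanes has empty interior: a point on one of them can be pushed off it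
within the open set. -/
theorem exists_mem_forall_apply_ne_zero (S : Set ((ι → ℝ) →ₗ[ℝ] ℝ)) (hS : S.Finite)
    {O : Set (ι → ℝ)} (hO : IsOpen O) (hne : O.Nonempty) :
    ∃ q ∈ O, ∀ l ∈ S, l ≠ 0 → l q ≠ 0 := by
  induction S, hS using Set.Finite.induction_on generalizing O with
  | empty => obtain ⟨q, hq⟩ := hne; exact ⟨q, hq, by simp⟩
  | @insert l S _ _ ih =>
    by_cases hl : l = 0
    · obtain ⟨q, hq, h⟩ := ih hO hne
      refine ⟨q, hq, ?_⟩
      rintro l' (rfl | hl') h0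
      · exact absurd hl h0
      · exact h l' hl' h0
    · have hlc : Continuous l := LinearMap.continuous_of_finiteDimensional _
      have hO' : IsOpen (O ∩ {q | l q ≠ 0}) := hO.inter (isOpen_ne_fun hlc continuous_const)
      obtain ⟨q, hq⟩ := hne
      have hne' : (O ∩ {q | l q ≠ 0}).Nonempty := by
        by_cases hq0 : l q = 0
        · obtain ⟨u, hu⟩ := DFunLike.ne_iff.1 hl
          have hc : Continuous fun δ : ℝ => q + δ • u := by fun_prop
          have hev : ∀ᶠ δ : ℝ in nhds 0, q + δ • u ∈ O :=
            hc.continuousAt.eventually_mem (hO.mem_nhds (by simpa using hq))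
          obtain ⟨δ, h1, h2⟩ := (Filter.Eventually.and
            (nhdsWithin_le_nhds (s := Ioi 0) hev) self_mem_nhdsWithin).exists
          exact ⟨q + δ • u, h1, by
            simpa [hq0] using ⟨ne_of_gt h2, hu⟩⟩
        · exact ⟨q, hq, hq0⟩
      obtain ⟨q', hq', h⟩ := ih hO' hne'
      refine ⟨q', hq'.1, ?_⟩
      rintro l' (rfl | hl') h0
      · exact hq'.2
      · exact h l' hl' h0

theorem exists_frequently_of_forall_exists {P : Finset ι → ℕ → Prop}
    (h : ∀ N, ∃ J ∈ ℰ, P J N) : ∃ J ∈ ℰ, ∃ᶠ N in Filter.atTop, P J N := by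
  by_contra! hcon
  have : ∀ᶠ N in Filter.atTop, ∀ J ∈ ℰ, ¬ P J N :=
    (Filter.eventually_all_finite (Set.toFinite ℰ)).2 fun J hJ =>
      by simpa [Filter.not_frequently] using hcon J hJ
  obtain ⟨N, hN⟩ := this.exists
  obtain ⟨J, hJ, hP⟩ := h N
  exact hN J hJ hP

variable [DecidableEq ι]

/-- By `hgen`, `x` is interior to its cone or on exactly one wall, that of an index `i`. In the
second case substitute existence gives a cone sharing the wall, and inseparability puts it on the
other side; a nearby `y` belongs to one or the other according to the sign of its `i`-th coordinate.
-/
theorem eventually_isCovered (hB : ∀ J ∈ ℰ, IsInterpolating Γ J) (hsep : IsInseparable Γ ℰ)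
    (hsub : ∀ J ∈ ℰ, ∀ i, ∃ j ∈ J, insert i (J.erase j) ∈ ℰ) {J : Finset ι} (hJ : J ∈ ℰ)
    {x : ι → ℝ} (hx : ∀ i, 0 ≤ (hB J hJ).residual x i)
    (hgen : ∀ i ∉ J, ∀ i' ∉ J, (hB J hJ).residual x i = 0 → (hB J hJ).residual x i' = 0 → i = i') :
    ∀ᶠ y in nhds x, IsCovered Γ ℰ y := by
  have hcont : ∀ (K : Finset ι) (hK : K ∈ ℰ) (i : ι),
      Continuous fun y => (hB K hK).residual y i := fun K hK i =>
    (continuous_apply i).comp (LinearMap.continuous_of_finiteDimensional _)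
  have hpos : ∀ (K : Finset ι) (hK : K ∈ ℰ), ∀ᶠ y in nhds x, ∀ i,
      0 < (hB K hK).residual x i → 0 < (hB K hK).residual y i := by
    intro K hK
    rw [Filter.eventually_all]
    intro i
    by_cases h : 0 < (hB K hK).residual x i
    · filter_upwards [(hcont K hK i).continuousAt.eventually (lt_mem_nhds h)] with y hy _ using hy
    · exact Filter.Eventually.of_forall fun y h' => absurd h' h
  by_cases hz : ∃ i ∉ J, (hB J hJ).residual x i = 0
  · obtain ⟨i, hiJ, hi⟩ := hz
    have hother : ∀ l ∉ J, l ≠ i → 0 < (hB J hJ).residual x l := fun l hl hli =>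
      lt_of_le_of_ne (hx l) fun h => hli (hgen l hl i hiJ h.symm hi)
    obtain ⟨j, hj, hJ'⟩ := hsub J hJ i
    have hij : i ≠ j := fun h => hiJ (h ▸ hj)
    obtain ⟨w, hw, -⟩ := hB _ hJ' (Pi.single i 1)
    have hwi : Γ i w = 1 := by simpa using hw i (Finset.mem_insert_self _ _)
    have hwl : ∀ l ∈ J, l ≠ j → Γ l w = 0 := fun l hl hlj => by
      rw [hw l (Finset.mem_insert_of_mem (Finset.mem_erase.2 ⟨hlj, hl⟩)),
        Pi.single_eq_of_ne (ne_of_mem_of_not_mem hl hiJ)]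
    -- Otherwise `w` would be `≤ 0` on `J` and `≥ 0` on the substitute, although it is nonzero. This
    -- sign puts the two cones on opposite sides of the wall.
    have hwj : 0 < Γ j w := by
      by_contra! hle
      have hw0 := hsep J hJ _ hJ' w (fun l hl => ?_) (fun l hl => ?_)
      · rw [hw0, map_zero] at hwi; exact zero_ne_one hwi
      · by_cases hlj : l = j
        · rwa [hlj]
        · rw [hwl l hl hlj]
      · rw [hw l hl]
        by_cases hli : l = i
        · subst hli; simp
        · simp [hli]
    have hrel : ∀ y l, (hB _ hJ').residual y l =
        (hB J hJ).residual y l - (hB J hJ).residual y i * Γ l w := by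
      intro y l
      obtain ⟨v, hv⟩ := (hB J hJ).exists_residual_eq y
      rw [(hB _ hJ').residual_eq y (v := v - (hB J hJ).residual y i • w), map_sub, map_smul, hv l,
        smul_eq_mul]
      · ring
      · intro l hl
        rw [map_sub, map_smul, smul_eq_mul, hw l hl]
        rcases Finset.mem_insert.1 hl with rfl | hl
        · simp [hv l]
        · rw [Pi.single_eq_of_ne (ne_of_mem_of_not_mem (Finset.mem_erase.1 hl).2 hiJ), mul_zero, sub_zero,
            ← hv, (hB J hJ).residual_eq_zero y (Finset.mem_erase.1 hl).2]
    filter_upwards [hpos J hJ, hpos _ hJ'] with y h1 h2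
    by_cases hyi : 0 ≤ (hB J hJ).residual y i
    · refine (hB J hJ).isCovered hJ fun l => ?_
      by_cases hl : l ∈ J
      · rw [(hB J hJ).residual_eq_zero y hl]
      · by_cases hli : l = i
        · rwa [hli]
        · exact (h1 l (hother l hl hli)).le
    · refine (hB _ hJ').isCovered hJ' fun l => ?_
      by_cases hl : l ∈ insert i (J.erase j)
      · rw [(hB _ hJ').residual_eq_zero y hl]
      · by_cases hlj : l = j
        · rw [hlj, hrel, (hB J hJ).residual_eq_zero y hj]
          nlinarith
        · refine (h2 l ?_).le
          rw [hrel, hi, zero_mul, sub_zero]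
          refine hother l (fun h => hl ?_) (fun h => hl ?_)
          · exact Finset.mem_insert_of_mem (Finset.mem_erase.2 ⟨hlj, h⟩)
          · rw [h]; exact Finset.mem_insert_self _ _
  · push Not at hz
    filter_upwards [hpos J hJ] with y h1
    refine (hB J hJ).isCovered hJ fun l => ?_
    by_cases hl : l ∈ J
    · rw [(hB J hJ).residual_eq_zero y hl]
    · exact (h1 l (lt_of_le_of_ne (hx l) (hz l hl).symm)).le

/-- A nonempty pure simplicial fan each of whose walls lies in two maximal cones is complete. -/
theorem isCovered_of_substituteExistence (hℰ : ℰ.Nonempty) (hB : ∀ J ∈ ℰ, IsInterpolating Γ J)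
    (hsep : IsInseparable Γ ℰ)
    (hsub : ∀ J ∈ ℰ, ∀ i, ∃ j ∈ J, insert i (J.erase j) ∈ ℰ) (p : ι → ℝ) : IsCovered Γ ℰ p := by
  obtain ⟨J₀, hJ₀⟩ := hℰ
  let a : ℰ → ι → (ι → ℝ) →ₗ[ℝ] ℝ := fun J i => (LinearMap.proj i).comp (hB J J.2).residual
  have ha : ∀ J i y, a J i y = (hB J.1 J.2).residual y i := fun _ _ _ => rfl
  have ha_single : ∀ (J : Finset ι) (hJ : J ∈ ℰ) (i i' : ι), i' ∉ J →
      a ⟨J, hJ⟩ i (Pi.single i' 1) = (Pi.single i' 1 : ι → ℝ) i := by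
    intro J hJ i i' hi'
    rw [ha, (hB J hJ).residual_eq_self]
    intro j hj
    exact Pi.single_eq_of_ne (ne_of_mem_of_not_mem hj hi') _
  -- The starting point `q` avoids the nonzero ones among the coordinates and the 2 × 2 minors
  -- formed with `p`. A minor vanishes at `q` when two coordinates vanish at the same point, other
  -- than `p`, of the segment from `q` to `p`.
  let S : Set ((ι → ℝ) →ₗ[ℝ] ℝ) := range (fun k : ℰ × ι => a k.1 k.2) ∪
    range fun k : ℰ × ι × ι =>
      a k.1 k.2.2 p • a k.1 k.2.1 - a k.1 k.2.1 p • a k.1 k.2.2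
  have hO : IsOpen {q : ι → ℝ | ∀ i ∉ J₀, 0 < (hB J₀ hJ₀).residual q i} := by
    simp only [ofPred_forall]
    refine isOpen_iInter_of_finite fun i => isOpen_iInter_of_finite fun _ =>
      isOpen_lt continuous_const ?_
    exact (continuous_apply i).comp (LinearMap.continuous_of_finiteDimensional _)
  obtain ⟨q, hq, hqS⟩ := exists_mem_forall_apply_ne_zero S (Set.toFinite S) hO (by
    refine ⟨fun i => if i ∈ J₀ then 0 else 1, fun i hi => ?_⟩
    rw [(hB J₀ hJ₀).residual_eq_self (fun j hj => by simp [hj])]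
    simp [hi])
  let f : ℝ → ι → ℝ := fun t => (1 - t) • q + t • p
  have hf : Continuous f := by fun_prop
  have h1 : (1 : ℝ) ∈ {t | IsCovered Γ ℰ (f t)} := by
    -- Continuity argument on `[0, 1]`: the covered parameters form a closed set containing `0`, and
    -- coverage extends a little beyond each covered `t < 1`.
    refine IsClosed.mem_of_ge_of_forall_exists_gt (a := 0) ?_ ?_ zero_le_one ?_
    · exact ((isClosed_isCovered hB).preimage hf).inter isClosed_Icc
    · refine (hB J₀ hJ₀).isCovered hJ₀ fun i => ?_
      by_cases hi : i ∈ J₀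
      · rw [(hB J₀ hJ₀).residual_eq_zero _ hi]
      · simpa [f] using (hq i hi).le
    · rintro t ⟨⟨J, hJ, v, hv0, hvJ⟩, ht0, ht1⟩
      have hres : ∀ i, (hB J hJ).residual (f t) i = f t i + Γ i v := (hB J hJ).residual_eq _ hvJ
      have hlin : ∀ i, (hB J hJ).residual (f t) i =
          (1 - t) * a ⟨J, hJ⟩ i q + t * a ⟨J, hJ⟩ i p := by
        intro i; simp [f, ha]
      have hev := eventually_isCovered hB hsep hsub hJ (x := f t)
        (fun i => by rw [hres]; exact hv0 i) (by
          intro i hi i' hi' hz hz'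
          by_contra hne
          rw [hlin] at hz hz'
          have hz0 : (a ⟨J, hJ⟩ i' p • a ⟨J, hJ⟩ i - a ⟨J, hJ⟩ i p • a ⟨J, hJ⟩ i') q = 0 := by
            have : (1 - t) * (a ⟨J, hJ⟩ i' p * a ⟨J, hJ⟩ i q - a ⟨J, hJ⟩ i p * a ⟨J, hJ⟩ i' q) = 0 := by
              linear_combination a ⟨J, hJ⟩ i' p * hz - a ⟨J, hJ⟩ i p * hz'
            simpa using (mul_eq_zero.1 this).resolve_left (by linarith)
          have hl0 : a ⟨J, hJ⟩ i' p • a ⟨J, hJ⟩ i - a ⟨J, hJ⟩ i p • a ⟨J, hJ⟩ i' = 0 := by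
            by_contra h
            exact hqS _ (Or.inr ⟨(⟨J, hJ⟩, i, i'), rfl⟩) h hz0
          -- Evaluate the vanishing minor at the `i'`-th unit vector, where the `i'`-th coordinate
          -- is `1` and the `i`-th is `0`.
          have hap : a ⟨J, hJ⟩ i p = 0 := by
            have := congrArg (fun l : (ι → ℝ) →ₗ[ℝ] ℝ => l (Pi.single i' 1)) hl0
            simpa [ha_single J hJ _ _ hi', hne] using this
          rw [hap, mul_zero, add_zero] at hz
          have haq := (mul_eq_zero.1 hz).resolve_left (by linarith)
          refine hqS _ (Or.inl ⟨(⟨J, hJ⟩, i), rfl⟩) (fun h => ?_) haq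
          have := congrArg (fun l : (ι → ℝ) →ₗ[ℝ] ℝ => l (Pi.single i 1)) h
          simp [ha_single J hJ _ _ hi] at this)
      have hev' : ∀ᶠ s in nhdsWithin t (Ioi t), IsCovered Γ ℰ (f s) :=
        nhdsWithin_le_nhds (hf.continuousAt.eventually hev)
      obtain ⟨s, hs1, hs2⟩ := (hev'.and (Ioc_mem_nhdsGT ht1)).exists
      exact ⟨s, hs1, hs2⟩
  simpa [f] using h1

/-- Completeness of the star of `Z`. Add `N` times the indicator of `Z` to `x`; a cone covering this
for arbitrarily large `N` has `Z` as a face. The coordinates in `Z` are left without a sign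
condition, as vanishing coordinates of `z` will require. -/
theorem exists_covering_of_disjoint (hℰ : ℰ.Nonempty) (hB : ∀ J ∈ ℰ, IsInterpolating Γ J)
    (hsep : IsInseparable Γ ℰ)
    (hsub : ∀ J ∈ ℰ, ∀ i, ∃ j ∈ J, insert i (J.erase j) ∈ ℰ) {Z J : Finset ι} (hJ : J ∈ ℰ)
    (hZ : Disjoint Z J) (x : ι → ℝ) :
    ∃ K ∈ ℰ, ∃ v, Disjoint Z K ∧ (∀ k ∈ K, x k + Γ k v = 0) ∧ ∀ i ∉ Z, 0 ≤ x i + Γ i v := by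
  set χ : ι → ℝ := fun i => if i ∈ Z then (1 : ℝ) else 0 with hχ
  have hall := fun N : ℕ =>
    isCovered_of_substituteExistence hℰ hB hsep hsub ((N : ℝ) • χ + x)
  obtain ⟨K, hK, hfr⟩ := exists_frequently_of_forall_exists hall
  have hd : Disjoint Z K := by
    refine disjoint_of_frequently_residual_nonneg hB hsep hJ hK hZ x (hfr.mono ?_)
    rintro N ⟨v, hv, hvK⟩ i
    rw [(hB K hK).residual_eq _ hvK]
    exact hv i
  obtain ⟨N, v, h1, h2⟩ := hfr.exists
  refine ⟨K, hK, v, hd, fun k hk => ?_, fun i hi => ?_⟩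
  · have := h2 k hk
    simpa [hχ, Finset.disjoint_right.1 hd hk] using this
  · simpa [hχ, hi] using h1 i

end Completeness

/-! ### Simplicial cones and their faces -/

section Cones

variable {ι : Type*} {E : Type*} [AddCommGroup E] [Module ℝ E] {a : ι → E}

theorem coneOf_mono {I J : Finset ι} (h : I ⊆ J) : coneOf a I ≤ coneOf a J :=
  Submodule.span_mono (image_mono (by exact_mod_cast h))

variable [Fintype ι]

theorem sum_sub_smul (c d : ι → ℝ) :
    ∑ i, (c - d) i • a i = ∑ i, c i • a i - ∑ i, d i • a i := by
  simp [sub_smul]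

theorem mem_coneOf_iff {I : Finset ι} {ξ : E} :
    ξ ∈ coneOf a I ↔ ∃ c : ι → ℝ, (∀ i, 0 ≤ c i) ∧ (∀ i ∉ I, c i = 0) ∧ ξ = ∑ i, c i • a i := by
  classical
  constructor
  · intro h
    induction h using Submodule.span_induction with
    | mem x hx =>
      obtain ⟨i, hi, rfl⟩ := hx
      refine ⟨Pi.single i 1, fun j => ?_, fun j hj => ?_, ?_⟩
      · by_cases h : j = i
        · subst h; simp
        · simp [h]
      · exact Pi.single_eq_of_ne (ne_of_mem_of_not_mem hi hj).symm _
      · simp [Pi.single_apply]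
    | zero => exact ⟨0, by simp, by simp, by simp⟩
    | add x y _ _ hx hy =>
      obtain ⟨c, h1, h2, rfl⟩ := hx
      obtain ⟨d, h3, h4, rfl⟩ := hy
      refine ⟨c + d, fun i => add_nonneg (h1 i) (h3 i), fun i hi => ?_, ?_⟩
      · simp [h2 i hi, h4 i hi]
      · simp [add_smul, Finset.sum_add_distrib]
    | smul r x _ hx =>
      obtain ⟨c, h1, h2, rfl⟩ := hx
      refine ⟨fun i => r * c i, fun i => mul_nonneg r.2 (h1 i), fun i hi => ?_, ?_⟩
      · simp [h2 i hi]
      · rw [Finset.smul_sum]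
        exact Finset.sum_congr rfl fun i _ => (mul_smul (r : ℝ) (c i) (a i)).symm
  · rintro ⟨c, h1, h2, rfl⟩
    refine Submodule.sum_mem _ fun i _ => ?_
    by_cases hi : i ∈ I
    · exact PointedCone.smul_mem _ (h1 i) (Submodule.subset_span ⟨i, hi, rfl⟩)
    · rw [h2 i hi, zero_smul]; exact zero_mem _

theorem linearIndepOn_iff_forall_sum_eq_zero {I : Finset ι} :
    LinearIndepOn ℝ a (I : Set ι) ↔
      ∀ c : ι → ℝ, (∀ i ∉ I, c i = 0) → ∑ i, c i • a i = 0 → c = 0 := by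
  classical
  rw [linearIndepOn_finset_iff]
  constructor
  · intro h c hc hsum
    have h1 : ∑ i ∈ I, c i • a i = 0 := by
      rw [← hsum]
      exact Finset.sum_subset (Finset.subset_univ _) fun i _ hi => by simp [hc i hi]
    ext i
    by_cases hi : i ∈ I
    · exact h c h1 i hi
    · exact hc i hi
  · intro h c hc i hi
    have h1 := h (fun i => if i ∈ I then c i else 0) (by simp +contextual) (by
      rw [← hc]
      symm
      refine (Finset.sum_congr rfl fun i hi => ?_).trans
        (Finset.sum_subset (Finset.subset_univ I) fun i _ hi => ?_)
      · simp [hi]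
      · simp [hi])
    simpa [hi] using congrFun h1 i

theorem eq_of_sum_smul_eq {I : Finset ι} (h : LinearIndepOn ℝ a (I : Set ι)) {c d : ι → ℝ}
    (hc : ∀ i ∉ I, c i = 0) (hd : ∀ i ∉ I, d i = 0) (hcd : ∑ i, c i • a i = ∑ i, d i • a i) :
    c = d := by
  rw [← sub_eq_zero]
  refine linearIndepOn_iff_forall_sum_eq_zero.1 h _ (fun i hi => ?_) ?_
  · simp [hc i hi, hd i hi]
  · simp [sub_smul, hcd]

/-- Coefficients over `J` are unique, and a sum of nonnegative coefficients vanishes off `I` only if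
each summand does. -/
theorem isFaceOf_coneOf {I J : Finset ι} (h : LinearIndepOn ℝ a (J : Set ι)) (hIJ : I ⊆ J) :
    (coneOf a I).IsFaceOf (coneOf a J) := by
  refine ⟨coneOf_mono hIJ, ?_⟩
  intro x y r hx hy hr hxy
  obtain ⟨c, hc0, hcJ, rfl⟩ := mem_coneOf_iff.1 hx
  obtain ⟨d, hd0, hdJ, rfl⟩ := mem_coneOf_iff.1 hy
  obtain ⟨u, hu0, huI, hu⟩ := mem_coneOf_iff.1 hxy
  have : r • c + d = u := by
    refine eq_of_sum_smul_eq h (fun i hi => by simp [hcJ i hi, hdJ i hi])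
      (fun i hi => huI i fun h' => hi (hIJ h')) ?_
    rw [← hu]
    simp [add_smul, Finset.sum_add_distrib, Finset.smul_sum, smul_smul]
  refine mem_coneOf_iff.2 ⟨c, hc0, fun i hi => ?_, rfl⟩
  have h1 := congrFun this i
  rw [huI i hi] at h1
  simp only [Pi.add_apply, Pi.smul_apply, smul_eq_mul] at h1
  have h2 := hc0 i
  have h3 := hd0 i
  have h4 : r * c i = 0 := le_antisymm (by linarith) (by positivity)
  exact (mul_eq_zero.1 h4).resolve_left hr.ne'

/-- A face contains every generator that occurs with positive coefficient in one of its elements, so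
it is generated by the `a_i` lying in it. -/
theorem exists_eq_coneOf_of_isFaceOf {I : Finset ι} {τ : PointedCone ℝ E}
    (h : τ.IsFaceOf (coneOf a I)) : ∃ J ⊆ I, τ = coneOf a J := by
  classical
  refine ⟨I.filter fun i => a i ∈ τ, Finset.filter_subset _ _, le_antisymm ?_ ?_⟩
  · intro ξ hξ
    obtain ⟨c, hc0, hcI, rfl⟩ := mem_coneOf_iff.1 (h.le hξ)
    refine mem_coneOf_iff.2 ⟨c, hc0, fun i hi => ?_, rfl⟩
    by_contra hci
    have hiI : i ∈ I := by by_contra hiI; exact hci (hcI i hiI)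
    refine hi (Finset.mem_filter.2 ⟨hiI, ?_⟩)
    rw [← Finset.add_sum_erase _ _ (Finset.mem_univ i)] at hξ
    refine h.mem_of_smul_add_mem (Submodule.subset_span ⟨i, hiI, rfl⟩) ?_
      (lt_of_le_of_ne (hc0 i) (Ne.symm hci)) hξ
    refine Submodule.sum_mem _ fun j _ => ?_
    by_cases hj : j ∈ I
    · exact PointedCone.smul_mem _ (hc0 j) (Submodule.subset_span ⟨j, hj, rfl⟩)
    · rw [hcI j hj, zero_smul]; exact zero_mem _
  · refine Submodule.span_le.2 ?_
    rintro _ ⟨i, hi, rfl⟩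
    exact (Finset.mem_filter.1 hi).2

theorem isFan_conesOf [DecidableEq ι] {K : Set (Finset ι)} (hK : IsSimplicialComplex K)
    (hli : ∀ I ∈ K, LinearIndepOn ℝ a (I : Set ι))
    (hinter : ∀ I ∈ K, ∀ J ∈ K, coneOf a I ⊓ coneOf a J = coneOf a (I ∩ J)) :
    IsFan (conesOf K a) where
  finite := by
    refine (Set.toFinite (range fun I => coneOf a I)).subset ?_
    rintro _ ⟨I, -, rfl⟩
    exact ⟨I, rfl⟩
  polyhedral := by
    rintro _ ⟨I, -, rfl⟩
    exact Submodule.fg_span (Set.toFinite _)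
  stronglyConvex := by
    rintro _ ⟨I, hI, rfl⟩ x hx hx0 hnx
    obtain ⟨c, hc0, hcI, rfl⟩ := mem_coneOf_iff.1 (show x ∈ coneOf a I from hx)
    obtain ⟨d, hd0, hdI, hd⟩ := mem_coneOf_iff.1 (show _ ∈ coneOf a I from hnx)
    have h1 : c = -d := by
      refine eq_of_sum_smul_eq (hli I hI) hcI (fun i hi => by simp [hdI i hi]) ?_
      simp only [Pi.neg_apply, neg_smul, Finset.sum_neg_distrib, ← hd, neg_neg]
    apply hx0
    refine Finset.sum_eq_zero fun i _ => ?_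
    have h2 := congrFun h1 i
    have h3 := hc0 i
    have h4 := hd0 i
    rw [Pi.neg_apply] at h2
    rw [show c i = 0 by linarith, zero_smul]
  face_mem := by
    rintro _ ⟨I, hI, rfl⟩ τ hτ
    obtain ⟨J, hJ, rfl⟩ := exists_eq_coneOf_of_isFaceOf hτ
    exact ⟨J, hK.2 I hI J hJ, rfl⟩
  inter_face := by
    rintro _ ⟨I, hI, rfl⟩ _ ⟨J, hJ, rfl⟩
    rw [hinter I hI J hJ]
    exact ⟨isFaceOf_coneOf (hli I hI) Finset.inter_subset_left,
      isFaceOf_coneOf (hli J hJ) Finset.inter_subset_right⟩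

end Cones

/-! ### Gale duality between `ℰ` and the fan -/

section Gale

variable {ι : Type*} [Fintype ι] {V : Type*} [AddCommGroup V] [Module ℝ V] {Γ : ι → Dual ℝ V}

theorem sum_smul_galeDual_apply (x : ι → ℝ) (w : Relations Γ) :
    (∑ i, x i • galeDual Γ i) w = ∑ i, x i * (w : ι → ℝ) i := by
  simp [LinearMap.sum_apply, galeDual]

/-- Gale duality: the linear relations between the `a_i` are the vectors `(⟨γ_i, v⟩)_i`. -/
theorem sum_smul_galeDual_eq_zero_iff [FiniteDimensional ℝ V] {x : ι → ℝ} :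
    ∑ i, x i • galeDual Γ i = 0 ↔ ∃ v, ∀ i, x i = Γ i v := by
  constructor
  · intro h
    let f : (ι → ℝ) →ₗ[ℝ] ℝ := Fintype.linearCombination ℝ x
    have hf : ∀ y : ι → ℝ, f y = ∑ i, x i * y i := fun y => by
      simp [f, Fintype.linearCombination_apply, mul_comm]
    -- Vanishing of `∑ x_i a_i` says that pairing with `x` kills the relations, so it factors
    -- through `V^*`; a functional on `V^*` is evaluation at some `v`.
    have hmem : f ∈ (LinearMap.ker (Fintype.linearCombination ℝ Γ)).dualAnnihilator := by
      rw [Submodule.mem_dualAnnihilator]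
      intro w hw
      rw [hf, ← sum_smul_galeDual_apply x ⟨w, hw⟩, h]; rfl
    rw [← LinearMap.range_dualMap_eq_dualAnnihilator_ker] at hmem
    obtain ⟨g, hg⟩ := hmem
    obtain ⟨v, rfl⟩ := (Module.evalEquiv ℝ V).surjective g
    refine ⟨v, fun i => ?_⟩
    classical
    have := congrArg (fun l : (ι → ℝ) →ₗ[ℝ] ℝ => l (Pi.single i 1)) hg
    simp only [hf, LinearMap.dualMap_apply, Fintype.linearCombination_apply_single, one_smul,
      evalEquiv_apply, Dual.eval_apply] at this
    simpa [Pi.single_apply] using this.symm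
  · rintro ⟨v, hv⟩
    ext w
    rw [sum_smul_galeDual_apply]
    have h1 : Fintype.linearCombination ℝ Γ (w : ι → ℝ) = 0 := w.2
    have h2 := congrArg (fun l : Dual ℝ V => l v) h1
    simp only [Fintype.linearCombination_apply, LinearMap.sum_apply, LinearMap.smul_apply,
      smul_eq_mul, LinearMap.zero_apply] at h2
    simpa [hv, mul_comm] using h2

theorem exists_eq_sum_smul_galeDual (ξ : Dual ℝ (Relations Γ)) :
    ∃ x : ι → ℝ, ξ = ∑ i, x i • galeDual Γ i := by
  classical
  obtain ⟨g, hg⟩ := LinearMap.exists_extend ξ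
  refine ⟨fun i => g (Pi.single i 1), ?_⟩
  ext w
  rw [sum_smul_galeDual_apply, ← hg]
  change g (w : ι → ℝ) = _
  conv_lhs => rw [pi_eq_sum_univ' (w : ι → ℝ)]
  simp [mul_comm, Pi.single]

theorem span_galeDual : Submodule.span ℝ (range (galeDual Γ)) = ⊤ := by
  rw [eq_top_iff]
  intro ξ _
  obtain ⟨x, rfl⟩ := exists_eq_sum_smul_galeDual ξ
  exact Submodule.sum_mem _ fun i _ => Submodule.smul_mem _ _ (Submodule.subset_span ⟨i, rfl⟩)

variable [FiniteDimensional ℝ V] {ℰ : Set (Finset ι)} [DecidableEq ι]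

theorem isSimplicialComplex_complexOf (hℰ : ℰ.Nonempty) : IsSimplicialComplex (complexOf ℰ) := by
  refine ⟨?_, ?_⟩
  · obtain ⟨J, hJ⟩ := hℰ
    exact ⟨J, hJ, Finset.empty_subset _⟩
  · rintro I ⟨J, hJ, hI⟩ I' hI'
    exact ⟨J, hJ, hI'.trans hI⟩

theorem linearIndepOn_galeDual (hB : ∀ J ∈ ℰ, IsInterpolating Γ J) {I : Finset ι}
    (hI : I ∈ complexOf ℰ) : LinearIndepOn ℝ (galeDual Γ) (I : Set ι) := by
  obtain ⟨J, hJ, hIJ⟩ := hI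
  rw [linearIndepOn_iff_forall_sum_eq_zero]
  intro c hc hsum
  obtain ⟨v, hv⟩ := sum_smul_galeDual_eq_zero_iff.1 hsum
  have : v = 0 := (hB J hJ).eq_zero fun j hj => by
    rw [← hv, hc j fun h => Finset.mem_compl.1 (hIJ h) hj]
  ext i; simp [hv, this]

/-- Two nonnegative expansions `c`, `d` of one vector differ by some `(Γ_i v)_i`. As `c` vanishes on
`J` and `d` on `J'`, this `v` is `≤ 0` on `J` and `≥ 0` on `J'`, so `c = d`. -/
theorem coneOf_inf_coneOf (hsep : IsInseparable Γ ℰ) {I I' : Finset ι} (hI : I ∈ complexOf ℰ)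
    (hI' : I' ∈ complexOf ℰ) :
    coneOf (galeDual Γ) I ⊓ coneOf (galeDual Γ) I' = coneOf (galeDual Γ) (I ∩ I') := by
  refine le_antisymm ?_ (le_inf (coneOf_mono Finset.inter_subset_left)
    (coneOf_mono Finset.inter_subset_right))
  rintro ξ ⟨h1, h2⟩
  obtain ⟨c, hc0, hcI, rfl⟩ := mem_coneOf_iff.1 h1
  obtain ⟨d, hd0, hdI, hd⟩ := mem_coneOf_iff.1 h2
  obtain ⟨J, hJ, hIJ⟩ := hI
  obtain ⟨J', hJ', hIJ'⟩ := hI'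
  have h3 : ∑ i, (c - d) i • galeDual Γ i = 0 := 
    (sum_sub_smul c d).trans (sub_eq_zero.2 hd)
  obtain ⟨v, hv⟩ := sum_smul_galeDual_eq_zero_iff.1 h3
  have hv0 : v = 0 := by
    refine hsep J hJ J' hJ' v (fun j hj => ?_) (fun j hj => ?_)
    · rw [← hv, Pi.sub_apply, hcI j fun h => Finset.mem_compl.1 (hIJ h) hj]
      linarith [hd0 j]
    · rw [← hv, Pi.sub_apply, hdI j fun h => Finset.mem_compl.1 (hIJ' h) hj]
      linarith [hc0 j]
  have hcd : ∀ i, c i = d i := fun i => by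
    have := hv i
    rw [hv0, map_zero, Pi.sub_apply] at this; linarith
  refine mem_coneOf_iff.2 ⟨c, hc0, fun i hi => ?_, rfl⟩
  by_cases h : i ∈ I
  · rw [hcd]; exact hdI i fun h' => hi (Finset.mem_inter.2 ⟨h, h'⟩)
  · exact hcI i h

theorem isTriangulatedConfiguration_complexOf (hℰ : ℰ.Nonempty)
    (hB : ∀ J ∈ ℰ, IsInterpolating Γ J) (hsep : IsInseparable Γ ℰ) :
    IsTriangulatedConfiguration (complexOf ℰ) (galeDual Γ) where
  isSimplicialComplex := isSimplicialComplex_complexOf hℰ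
  spanning := span_galeDual
  isFan := isFan_conesOf (isSimplicialComplex_complexOf hℰ) (fun _ => linearIndepOn_galeDual hB)
    fun _ hI _ hI' => coneOf_inf_coneOf hsep hI hI'
  linearIndependent _ := linearIndepOn_galeDual hB
  inter_eq _ hI _ hI' := coneOf_inf_coneOf hsep hI hI'

theorem sum_smul_galeDual_mem_coneOf_compl {J : Finset ι} {x : ι → ℝ} :
    ∑ i, x i • galeDual Γ i ∈ coneOf (galeDual Γ) Jᶜ ↔
      ∃ v, (∀ i, 0 ≤ x i + Γ i v) ∧ ∀ j ∈ J, x j + Γ j v = 0 := by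
  rw [mem_coneOf_iff]
  constructor
  · rintro ⟨c, hc0, hcJ, hc⟩
    have h3 : ∑ i, (c - x) i • galeDual Γ i = 0 := 
      (sum_sub_smul c x).trans (sub_eq_zero.2 hc.symm)
    obtain ⟨v, hv⟩ := sum_smul_galeDual_eq_zero_iff.1 h3
    have : ∀ i, x i + Γ i v = c i := fun i => by rw [← hv]; simp
    exact ⟨v, fun i => this i ▸ hc0 i, fun j hj => by rw [this, hcJ j (by simpa using hj)]⟩
  · rintro ⟨v, h0, hJ⟩
    refine ⟨fun i => x i + Γ i v, h0, fun i hi => hJ i (by simpa using hi), ?_⟩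
    simp only [add_smul, Finset.sum_add_distrib]
    rw [sum_smul_galeDual_eq_zero_iff.2 ⟨v, fun _ => rfl⟩, add_zero]

theorem isCompleteSimplicialFan_complexOf (hℰ : ℰ.Nonempty)
    (hB : ∀ J ∈ ℰ, IsInterpolating Γ J) (hsep : IsInseparable Γ ℰ)
    (hsub : ∀ J ∈ ℰ, ∀ i, ∃ j ∈ J, insert i (J.erase j) ∈ ℰ) :
    IsCompleteSimplicialFan (conesOf (complexOf ℰ) (galeDual Γ)) where
  isFan := (isTriangulatedConfiguration_complexOf hℰ hB hsep).isFan
  simplicial := by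
    rintro _ ⟨I, hI, rfl⟩
    exact PointedCone.IsSimplicial.hull (Set.toFinite _) (linearIndepOn_galeDual hB hI).id_image
  complete := by
    rw [eq_univ_iff_forall]
    intro ξ
    obtain ⟨x, rfl⟩ := exists_eq_sum_smul_galeDual ξ
    obtain ⟨J, hJ, h⟩ := isCovered_of_substituteExistence hℰ hB hsep hsub x
    refine mem_biUnion (x := coneOf (galeDual Γ) Jᶜ) ⟨Jᶜ, ⟨J, hJ, le_rfl⟩, rfl⟩ ?_
    exact sum_smul_galeDual_mem_coneOf_compl.2 h

/-- The positive and negative parts of `(Γ_i v)_i` represent the same vector, one supported off `I`,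
the other off `J`. The intersection axiom and uniqueness of coefficients make the two parts equal,
so every `Γ_i v` is zero. -/
theorem isInseparable_of_isTriangulatedConfiguration (hB : ∀ J ∈ ℰ, IsInterpolating Γ J)
    (h : IsTriangulatedConfiguration (complexOf ℰ) (galeDual Γ)) : IsInseparable Γ ℰ := by
  intro I hI J hJ v hvI hvJ
  have hI' : Iᶜ ∈ complexOf ℰ := ⟨I, hI, le_rfl⟩
  have hJ' : Jᶜ ∈ complexOf ℰ := ⟨J, hJ, le_rfl⟩
  set c : ι → ℝ := fun i => max (Γ i v) 0
  set d : ι → ℝ := fun i => max (-Γ i v) 0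
  have hcI : ∀ i ∉ Iᶜ, c i = 0 := fun i hi => max_eq_right (hvI i (by simpa using hi))
  have hdJ : ∀ i ∉ Jᶜ, d i = 0 := fun i hi =>
    max_eq_right (by linarith [hvJ i (by simpa using hi)])
  have hcd : ∑ i, c i • galeDual Γ i = ∑ i, d i • galeDual Γ i := by
    refine sub_eq_zero.1 ((sum_sub_smul c d).symm.trans ?_)
    refine sum_smul_galeDual_eq_zero_iff.2 ⟨v, fun i => ?_⟩
    rcases le_total 0 (Γ i v) with h | h
    · simp [c, d, max_eq_left h, max_eq_right (neg_nonpos.2 h)]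
    · simp [c, d, max_eq_right h, max_eq_left (neg_nonneg.2 h)]
  have hmem : ∑ i, c i • galeDual Γ i ∈ coneOf (galeDual Γ) (Iᶜ ∩ Jᶜ) := by
    rw [← h.inter_eq _ hI' _ hJ']
    exact ⟨mem_coneOf_iff.2 ⟨c, fun i => le_max_right _ _, hcI, rfl⟩,
      mem_coneOf_iff.2 ⟨d, fun i => le_max_right _ _, hdJ, hcd⟩⟩
  obtain ⟨u, -, hu, hcu⟩ := mem_coneOf_iff.1 hmem
  have h1 : c = u := eq_of_sum_smul_eq (h.linearIndependent _ hI') hcI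
    (fun i hi => hu i fun h => hi (Finset.mem_inter.1 h).1) hcu
  have h2 : d = u := eq_of_sum_smul_eq (h.linearIndependent _ hJ') hdJ
    (fun i hi => hu i fun h => hi (Finset.mem_inter.1 h).2) (hcd ▸ hcu)
  refine (hB I hI).eq_zero fun i _ => ?_
  have h3 : max (Γ i v) 0 = max (-Γ i v) 0 := congrFun (h1.trans h2.symm) i
  rcases le_total 0 (Γ i v) with h | h
  · rw [max_eq_left h, max_eq_right (neg_nonpos.2 h)] at h3; exact h3
  · rw [max_eq_right h, max_eq_left (neg_nonneg.2 h)] at h3; linarith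

/-- For `i ∉ J`, the wall opposite to `a_i` in the cone of `J` is spanned by the remaining
generators, indexed by `Z`. The points `N ∑_Z a_k - a_i` lie beyond this wall, and a cone containing
them for arbitrarily large `N` is the one across it. -/
theorem substituteExistence_of_complete (hB : ∀ J ∈ ℰ, IsInterpolating Γ J)
    (hsep : IsInseparable Γ ℰ)
    (h : (⋃ σ ∈ conesOf (complexOf ℰ) (galeDual Γ), (σ : Set (Dual ℝ (Relations Γ)))) = univ) :
    ∀ J ∈ ℰ, ∀ i, ∃ j ∈ J, insert i (J.erase j) ∈ ℰ := by
  intro J hJ i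
  by_cases hi : i ∈ J
  · exact ⟨i, hi, by rwa [Finset.insert_erase hi]⟩
  set Z : Finset ι := Jᶜ.erase i with hZ
  have hcov : ∀ x, IsCovered Γ ℰ x := by
    intro x
    have hx : ∑ i, x i • galeDual Γ i ∈
      ⋃ σ ∈ conesOf (complexOf ℰ) (galeDual Γ), (σ : Set (Dual ℝ (Relations Γ))) := by
      rw [h]; trivial
    obtain ⟨_, ⟨I, ⟨K, hK, hIK⟩, rfl⟩, hmem⟩ := mem_iUnion₂.1 hx
    exact ⟨K, hK, sum_smul_galeDual_mem_coneOf_compl.1 (coneOf_mono hIK hmem)⟩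
  have hZJ : Disjoint Z J := by
    rw [Finset.disjoint_left]
    intro k hk hkJ
    simp [hZ, hkJ] at hk
  obtain ⟨K, hK, hfr⟩ := exists_frequently_of_forall_exists fun N : ℕ =>
    hcov ((N : ℝ) • (fun k => if k ∈ Z then (1 : ℝ) else 0) + Pi.single i (-1))
  have hZK := disjoint_of_frequently_residual_nonneg hB hsep hJ hK hZJ _ (hfr.mono (by
    rintro N ⟨v, hv, hvK⟩ k
    rw [(hB K hK).residual_eq _ hvK]
    exact hv k))
  have hKsub : K ⊆ insert i J := by
    intro k hk
    by_contra hcon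
    rw [Finset.mem_insert, not_or] at hcon
    exact Finset.disjoint_right.1 hZK hk (by simp [hZ, hcon])
  have hcard : K.card = J.card := (hB K hK).card_eq.trans (hB J hJ).card_eq.symm
  -- Otherwise `K = J`; the chosen representative already vanishes on `J`, hence is the normalised
  -- one, and its coordinate `-1` at `i` is negative.
  have hiK : i ∈ K := by
    by_contra hiK
    have hKJ : K = J := Finset.eq_of_subset_of_card_le
      (fun k hk => (Finset.mem_insert.1 (hKsub hk)).resolve_left (fun h => hiK (h ▸ hk))) hcard.ge
    subst hKJ
    obtain ⟨N, v, hv, hvK⟩ := hfr.exists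
    have hv0 : v = 0 := (hB K hK).eq_zero fun k hk => by
      have := hvK k hk
      simpa [Finset.disjoint_right.1 hZK hk, ne_of_mem_of_not_mem hk hi] using this
    have := hv i
    simp [hv0, hZ] at this
    linarith
  -- `insert i J` has one element more than `K`; the missing one is the index exchanged for `i`.
  obtain ⟨j, hj⟩ : ∃ j, insert i J \ K = {j} := by
    rw [← Finset.card_eq_one, Finset.card_sdiff_of_subset hKsub, Finset.card_insert_of_notMem hi,
      hcard]
    omega
  have hjmem : j ∈ insert i J ∧ j ∉ K := by
    rw [← Finset.mem_sdiff, hj]; exact Finset.mem_singleton_self _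
  have hji : j ≠ i := fun h => hjmem.2 (h ▸ hiK)
  refine ⟨j, (Finset.mem_insert.1 hjmem.1).resolve_left hji, ?_⟩
  convert hK
  rw [← Finset.erase_insert_of_ne hji.symm, ← Finset.sdiff_singleton_eq_erase, ← hj,
    Finset.sdiff_sdiff_eq_self hKsub]

end Gale

/-! ### Membership in `U(K)`, `P(ℰ)` and `Z_K` -/

section CoordComplement

variable {n : ℕ} {ℰ : Set (Finset (Fin (n + 1)))}

theorem mem_coordComplement_complexOf {z : Fin (n + 1) → ℂ} :
    z ∈ coordComplement (complexOf ℰ) ↔ ∃ J ∈ ℰ, ∀ j ∈ J, z j ≠ 0 := by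
  change z ∈ (⋃ I ∈ (complexOf ℰ)ᶜ, {z : Fin (n + 1) → ℂ | ∀ i ∈ I, z i = 0})ᶜ ↔ _
  simp only [mem_compl_iff, mem_iUnion, mem_ofPred_eq, not_exists]
  constructor
  · intro h
    by_contra hcon
    refine h (Finset.univ.filter fun i => z i = 0) (fun hmem => hcon ?_) (by simp)
    obtain ⟨J, hJ, hsub⟩ := hmem
    refine ⟨J, hJ, fun j hj hz => ?_⟩
    exact Finset.mem_compl.1 (hsub (Finset.mem_filter.2 ⟨Finset.mem_univ j, hz⟩)) hj
  · rintro ⟨J, hJ, hz⟩ I hI hI0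
    refine hI ⟨J, hJ, fun i hi => Finset.mem_compl.2 fun hiJ => hz i hiJ (hI0 i hi)⟩

theorem mk_mem_projComplement {z : Fin (n + 1) → ℂ} (hz : z ≠ 0) :
    Projectivization.mk ℂ z hz ∈ projComplement ℰ ↔ z ∈ coordComplement (complexOf ℰ) := by
  rw [mem_coordComplement_complexOf]
  change Projectivization.mk ℂ z hz ∈ (⋃ J ∈ ℰ, _ : Set _) ↔ _
  simp only [mem_iUnion, mem_ofPred_eq, rep_mk_ne_zero_iff, exists_prop]

theorem mem_momentAngle_complexOf {z : Fin (n + 1) → ℂ} :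
    z ∈ momentAngle (complexOf ℰ) ↔ ∃ J ∈ ℰ, (∀ i, ‖z i‖ ≤ 1) ∧ ∀ j ∈ J, ‖z j‖ = 1 := by
  simp only [momentAngle, mem_iUnion, mem_ofPred_eq]
  constructor
  · rintro ⟨I, ⟨J, hJ, hIJ⟩, h1, h2⟩
    refine ⟨J, hJ, fun i => ?_, fun j hj => h2 j fun h => Finset.mem_compl.1 (hIJ h) hj⟩
    by_cases hi : i ∈ I
    · exact h1 i hi
    · exact (h2 i hi).le
  · rintro ⟨J, hJ, h1, h2⟩
    exact ⟨Jᶜ, ⟨J, hJ, le_rfl⟩, fun i _ => h1 i, fun i hi => h2 i (by simpa using hi)⟩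

theorem momentAngle_subset_coordComplement :
    momentAngle (complexOf ℰ) ⊆ coordComplement (complexOf ℰ) := by
  intro z hz
  obtain ⟨J, hJ, -, h⟩ := mem_momentAngle_complexOf.1 hz
  exact mem_coordComplement_complexOf.2 ⟨J, hJ, fun j hj h0 => by simpa [h0] using h j hj⟩

theorem isCompact_momentAngle : IsCompact (momentAngle (complexOf ℰ)) := by
  have h : momentAngle (complexOf ℰ) = ⋃ J ∈ ℰ,
      ({z | ∀ j ∈ J, ‖z j‖ = 1} ∩ Set.pi univ fun _ => Metric.closedBall (0 : ℂ) 1) := by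
    ext z
    rw [mem_momentAngle_complexOf]
    simp only [mem_iUnion, mem_inter_iff, mem_ofPred_eq, mem_univ_pi, mem_closedBall_zero_iff,
      exists_prop]
    exact exists_congr fun J => and_congr_right fun _ => and_comm
  rw [h]
  refine (Set.toFinite ℰ).isCompact_biUnion fun J _ => ?_
  refine (isCompact_univ_pi fun _ => isCompact_closedBall _ _).inter_left ?_
  simp only [ofPred_forall]
  exact isClosed_iInter fun j => isClosed_iInter fun _ =>
    isClosed_eq (continuous_apply j).norm continuous_const

end CoordComplement

/-! ### The subspace of logarithms of the action -/

section ActionSubmodule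

variable {n : ℕ} {F : Type*} [AddCommGroup F] [Module ℝ F]

theorem complexPairing_smul (𝒥 : F →ₗ[ℝ] F) (γ : Dual ℝ F) (r : ℝ) (v : F) :
    complexPairing 𝒥 γ (r • v) = r * complexPairing 𝒥 γ v := by
  simp only [complexPairing, map_smul, smul_eq_mul, Complex.ofReal_mul]
  ring

theorem complexPairing_complexStructure {𝒥 : F →ₗ[ℝ] F} (h𝒥 : ∀ x, 𝒥 (𝒥 x) = -x) (γ : Dual ℝ F)
    (v : F) : complexPairing 𝒥 γ (𝒥 v) = Complex.I * complexPairing 𝒥 γ v := by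
  simp only [complexPairing, h𝒥, map_neg, Complex.ofReal_neg]
  linear_combination (γ (𝒥 v) : ℂ) * Complex.I_sq

theorem complexPairing_re (𝒥 : F →ₗ[ℝ] F) (γ : Dual ℝ F) (v : F) :
    (complexPairing 𝒥 γ v).re = γ v := by
  simp [complexPairing]

/-- The logarithms of the elements of the torus `(ℂˣ)^{n+1}` through which `ℂˣ × F` acts. -/
def actionSubmodule (γ' : Fin (n + 1) → Dual ℝ F) (𝒥 : F →ₗ[ℝ] F) (h𝒥 : ∀ x, 𝒥 (𝒥 x) = -x) :
    Submodule ℂ (Fin (n + 1) → ℂ) where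
  carrier := {l | ∃ (τ : ℂ) (v : F), ∀ i, l i = τ + complexPairing 𝒥 (γ' i) v}
  add_mem' := by
    rintro l l' ⟨τ, v, h⟩ ⟨τ', v', h'⟩
    refine ⟨τ + τ', v + v', fun i => ?_⟩
    rw [Pi.add_apply, h, h', complexPairing_add]; ring
  zero_mem' := ⟨0, 0, fun i => by simp [complexPairing_zero]⟩
  smul_mem' := by
    rintro c l ⟨τ, v, h⟩
    refine ⟨c * τ, c.re • v + c.im • 𝒥 v, fun i => ?_⟩
    rw [Pi.smul_apply, h, complexPairing_add, complexPairing_smul, complexPairing_smul,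
      complexPairing_complexStructure h𝒥, smul_eq_mul]
    linear_combination -complexPairing 𝒥 (γ' i) v * Complex.re_add_im c

theorem mem_actionSubmodule {γ' : Fin (n + 1) → Dual ℝ F} {𝒥 : F →ₗ[ℝ] F}
    {h𝒥 : ∀ x, 𝒥 (𝒥 x) = -x} {l : Fin (n + 1) → ℂ} : l ∈ actionSubmodule γ' 𝒥 h𝒥 ↔
      ∃ (τ : ℂ) (v : F), ∀ i, l i = τ + complexPairing 𝒥 (γ' i) v :=
  Iff.rfl

theorem const_mem_actionSubmodule (γ' : Fin (n + 1) → Dual ℝ F) (𝒥 : F →ₗ[ℝ] F)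
    (h𝒥 : ∀ x, 𝒥 (𝒥 x) = -x) (c : ℂ) : (fun _ => c) ∈ actionSubmodule γ' 𝒥 h𝒥 :=
  ⟨c, 0, fun i => by simp [complexPairing_zero]⟩

/-- Every `t ∈ ℂˣ` is an exponential, so the orbits are those of `exp L`; from here on only the
linear subspace `L` matters. -/
theorem torusExpSetoid_iff {K : Set (Finset (Fin (n + 1)))} {γ' : Fin (n + 1) → Dual ℝ F}
    {𝒥 : F →ₗ[ℝ] F} (h𝒥 : ∀ x, 𝒥 (𝒥 x) = -x) {z w : coordComplement K} :
    torusExpSetoid K γ' 𝒥 z w ↔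
      ∃ l ∈ actionSubmodule γ' 𝒥 h𝒥, ∀ i, w.1 i = Complex.exp (l i) * z.1 i := by
  constructor
  · rintro ⟨t, v, rfl⟩
    refine ⟨fun i => Complex.log t + complexPairing 𝒥 (γ' i) v, ⟨_, _, fun _ => rfl⟩, fun i => ?_⟩
    simp [torusExpAct, expLinear, Complex.exp_add, Complex.exp_log t.ne_zero, mul_assoc]
  · rintro ⟨l, ⟨τ, v, hl⟩, h⟩
    refine ⟨Units.mk0 (Complex.exp τ) (Complex.exp_ne_zero _), v, Subtype.ext (funext fun i => ?_)⟩
    simp [torusExpAct, expLinear, h, hl, Complex.exp_add, mul_assoc]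

variable {V : Type*} [AddCommGroup V] [Module ℝ V] (e : (F × ℝ) ≃ₗ[ℝ] V)
  {Γ : Fin (n + 1) → Dual ℝ V} {Γ' : Fin (n + 1) → Dual ℝ F} {ℰ : Set (Finset (Fin (n + 1)))}
  {𝒥 : F →ₗ[ℝ] F} {h𝒥 : ∀ x, 𝒥 (𝒥 x) = -x}

/-- The real parts of elements of `L` on two members of `ℰ` bound all real parts. -/
def HasSeparationBounds (L : Submodule ℂ (Fin (n + 1) → ℂ)) (ℰ : Set (Finset (Fin (n + 1)))) :
    Prop :=
  ∀ I ∈ ℰ, ∀ J ∈ ℰ, ∃ C : ℝ, 0 ≤ C ∧ ∀ l ∈ L, ∀ B : ℝ, (∀ i ∈ I, (l i).re ≤ B) →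
    (∀ j ∈ J, -B ≤ (l j).re) → ∀ i, |(l i).re| ≤ C * B

/-- The only elements of `L` with vanishing real part are the diagonal ones. -/
def HasDiagonalPhases (L : Submodule ℂ (Fin (n + 1) → ℂ)) : Prop :=
  ∀ l ∈ L, (∀ i, (l i).re = 0) → ∃ θ : ℝ, ∀ i, l i = θ * Complex.I

theorem re_apply_of_eq (he : ∀ i x r, Γ i (e (x, r)) = Γ' i x + r) {l : Fin (n + 1) → ℂ} {τ : ℂ}
    {v : F} (h : ∀ i, l i = τ + complexPairing 𝒥 (Γ' i) v) (i : Fin (n + 1)) :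
    (l i).re = Γ i (e (v, τ.re)) := by
  rw [h, Complex.add_re, complexPairing_re, he, add_comm]

theorem hasSeparationBounds_actionSubmodule (he : ∀ i x r, Γ i (e (x, r)) = Γ' i x + r)
    (h : ∀ I ∈ ℰ, ∀ J ∈ ℰ, (vectorInterior (convexHull ℝ (Γ' '' (I : Set (Fin (n + 1))))) ∩
      vectorInterior (convexHull ℝ (Γ' '' (J : Set (Fin (n + 1)))))).Nonempty) :
    HasSeparationBounds (actionSubmodule Γ' 𝒥 h𝒥) ℰ := by
  intro I hI J hJ
  obtain ⟨C, hC0, hC⟩ := exists_bound_of_imbrication e he (h I hI J hJ)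
  refine ⟨C, hC0, ?_⟩
  rintro l ⟨τ, v, hl⟩ B h1 h2 i
  have hre := re_apply_of_eq e he hl
  simp only [hre] at h1 h2 ⊢
  exact hC _ B h1 h2 i

theorem eq_zero_of_forall_re_eq_zero (he : ∀ i x r, Γ i (e (x, r)) = Γ' i x + r)
    (hℰ : ℰ.Nonempty) (hB : ∀ J ∈ ℰ, IsInterpolating Γ J) {l : Fin (n + 1) → ℂ} {τ : ℂ}
    {v : F} (h : ∀ i, l i = τ + complexPairing 𝒥 (Γ' i) v) (hre : ∀ i, (l i).re = 0) :
    v = 0 ∧ τ.re = 0 := by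
  obtain ⟨J, hJ⟩ := hℰ
  have h0 : e (v, τ.re) = 0 := (hB J hJ).eq_zero fun j _ => by rw [← re_apply_of_eq e he h, hre]
  rw [LinearEquiv.map_eq_zero_iff, Prod.mk_eq_zero] at h0
  exact h0

theorem hasDiagonalPhases_actionSubmodule (he : ∀ i x r, Γ i (e (x, r)) = Γ' i x + r)
    (hℰ : ℰ.Nonempty) (hB : ∀ J ∈ ℰ, IsInterpolating Γ J) :
    HasDiagonalPhases (actionSubmodule Γ' 𝒥 h𝒥) := by
  rintro l ⟨τ, v, hl⟩ hre
  obtain ⟨h1, h2⟩ := eq_zero_of_forall_re_eq_zero e he hℰ hB hl hre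
  refine ⟨τ.im, fun i => ?_⟩
  rw [hl, h1, complexPairing_zero, add_zero]
  apply Complex.ext <;> simp [h2]

/-- The real parametrisation of `L` by `ℂ × F` is injective: real parts determine `v` and the real
part of `τ`, after which `τ` is the common value of the coordinates. -/
theorem finrank_actionSubmodule [FiniteDimensional ℝ F]
    (he : ∀ i x r, Γ i (e (x, r)) = Γ' i x + r) (hℰ : ℰ.Nonempty)
    (hB : ∀ J ∈ ℰ, IsInterpolating Γ J) :
    2 * finrank ℂ (actionSubmodule Γ' 𝒥 h𝒥) = finrank ℝ F + 2 := by
  let f : (ℂ × F) →ₗ[ℝ] (Fin (n + 1) → ℂ) :=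
    { toFun := fun p i => p.1 + complexPairing 𝒥 (Γ' i) p.2
      map_add' := fun p q => by
        ext i; simp only [Prod.fst_add, Prod.snd_add, complexPairing_add, Pi.add_apply]; ring
      map_smul' := fun r p => by
        ext i
        simp only [Prod.smul_fst, Prod.smul_snd, complexPairing_smul, Complex.real_smul,
          RingHom.id_apply, Pi.smul_apply]; ring }
  have hf : Function.Injective f := by
    rw [injective_iff_map_eq_zero]
    rintro ⟨τ, v⟩ h
    have hfi : ∀ i, f (τ, v) i = τ + complexPairing 𝒥 (Γ' i) v := fun _ => rfl
    obtain ⟨h1, h2⟩ := eq_zero_of_forall_re_eq_zero e he hℰ hB hfi (fun i => by simp [h])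
    have h3 := hfi 0
    rw [h, h1, complexPairing_zero, add_zero] at h3
    rw [h1, ← h3]; rfl
  have hrange : LinearMap.range f = (actionSubmodule Γ' 𝒥 h𝒥).restrictScalars ℝ := by
    ext l
    rw [LinearMap.mem_range, Submodule.restrictScalars_mem, mem_actionSubmodule]
    constructor
    · rintro ⟨⟨τ, v⟩, rfl⟩; exact ⟨τ, v, fun _ => rfl⟩
    · rintro ⟨τ, v, h⟩; exact ⟨(τ, v), funext fun i => (h i).symm⟩
  have h1 : finrank ℝ (LinearMap.range f) = 2 + finrank ℝ F := by
    rw [LinearMap.finrank_range_of_inj hf, finrank_prod, Complex.finrank_real_complex]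
  rw [hrange] at h1
  rw [← finrank_real_of_complex]
  exact h1.trans (add_comm _ _)

/-- Acting by the negative of the element of `L` attached to `v` replaces `-log |z_i|` by `-log
|z_i| + Γ_i v`. Completeness makes this nonnegative wherever `z_i ≠ 0` and zero on a member of `ℰ`,
which is membership in `Z_K`. -/
theorem exists_exp_mul_mem_momentAngle (he : ∀ i x r, Γ i (e (x, r)) = Γ' i x + r)
    (hℰ : ℰ.Nonempty) (hB : ∀ J ∈ ℰ, IsInterpolating Γ J) (hsep : IsInseparable Γ ℰ)
    (hsub : ∀ J ∈ ℰ, ∀ i, ∃ j ∈ J, insert i (J.erase j) ∈ ℰ)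
    {z : Fin (n + 1) → ℂ} (hz : z ∈ coordComplement (complexOf ℰ)) :
    ∃ l ∈ actionSubmodule Γ' 𝒥 h𝒥,
      (fun i => Complex.exp (l i) * z i) ∈ momentAngle (complexOf ℰ) := by
  obtain ⟨J, hJ, hzJ⟩ := mem_coordComplement_complexOf.1 hz
  -- At zero coordinates the logarithm has a default value; these indices form `Z`, where no
  -- inequality is used, and `K` avoids them.
  obtain ⟨K, hK, v, hdis, hvK, hv⟩ := exists_covering_of_disjoint hℰ hB hsep hsub
    (Z := Finset.univ.filter fun i => z i = 0) hJ
    (Finset.disjoint_left.2 fun j hj hjJ => hzJ j hjJ (Finset.mem_filter.1 hj).2)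
    fun i => -Real.log ‖z i‖
  obtain ⟨⟨y, r⟩, rfl⟩ := e.surjective v
  have hmem : (fun i => ((r : ℂ) + complexPairing 𝒥 (Γ' i) y)) ∈ actionSubmodule Γ' 𝒥 h𝒥 :=
    ⟨r, y, fun _ => rfl⟩
  refine ⟨_, neg_mem hmem, ?_⟩
  have hnorm : ∀ i, z i ≠ 0 → ‖Complex.exp (-((r : ℂ) + complexPairing 𝒥 (Γ' i) y)) * z i‖ =
      Real.exp (-(-Real.log ‖z i‖ + Γ i (e (y, r)))) := by
    intro i hi
    rw [norm_mul, Complex.norm_exp, he, Complex.neg_re, Complex.add_re, complexPairing_re,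
      Complex.ofReal_re]
    conv_lhs => rw [← Real.exp_log (norm_pos_iff.2 hi)]
    rw [← Real.exp_add]
    congr 1; ring
  refine mem_momentAngle_complexOf.2 ⟨K, hK, fun i => ?_, fun k hk => ?_⟩
  · by_cases hi : z i = 0
    · simp [hi]
    · change ‖Complex.exp (-((r : ℂ) + complexPairing 𝒥 (Γ' i) y)) * z i‖ ≤ 1
      rw [hnorm i hi, Real.exp_le_one_iff]
      have := hv i (by simp [hi])
      linarith
  · have hk0 : z k ≠ 0 := fun h => Finset.disjoint_left.1 hdis (by simp [h]) hk
    change ‖Complex.exp (-((r : ℂ) + complexPairing 𝒥 (Γ' k) y)) * z k‖ = 1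
    rw [hnorm k hk0, hvK k hk, neg_zero, Real.exp_zero]

end ActionSubmodule

/-! ### Closedness of the orbit relation -/

section ClosedOrbitRelation

variable {n : ℕ} {ℰ : Set (Finset (Fin (n + 1)))} {L : Submodule ℂ (Fin (n + 1) → ℂ)}

/-- The real parts of an element of `L`, together with one imaginary part. -/
noncomputable def reIm (L : Submodule ℂ (Fin (n + 1) → ℂ)) : L →ₗ[ℝ] (Fin (n + 1) → ℝ) × ℝ where
  toFun l := (fun i => (l.1 i).re, (l.1 0).im)
  map_add' a b := by ext <;> simp
  map_smul' r a := by ext <;> simp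

theorem ker_reIm (hph : HasDiagonalPhases L) : LinearMap.ker (reIm L) = ⊥ := by
  rw [LinearMap.ker_eq_bot']
  intro a ha
  have h1 : ∀ i, (a.1 i).re = 0 := fun i => congrFun (congrArg Prod.fst ha) i
  have h2 : (a.1 0).im = 0 := congrArg Prod.snd ha
  obtain ⟨θ, hθ⟩ := hph a.1 a.2 h1
  have : θ = 0 := by simpa [hθ] using h2
  ext i
  simp [hθ, this]

/-- Diagonal multiples of `2πi` lie in `L` and act trivially. Normalising the imaginary part of one
coordinate suffices, because `reIm` is injective. -/
theorem exists_exp_eq_abs_im_le (hconst : ∀ c : ℂ, (fun _ => c) ∈ L) {l : Fin (n + 1) → ℂ}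
    (hl : l ∈ L) : ∃ l' ∈ L, |(l' 0).im| ≤ 2 * Real.pi ∧
      ∀ i, Complex.exp (l' i) = Complex.exp (l i) := by
  set k : ℤ := ⌊(l 0).im / (2 * Real.pi)⌋
  refine ⟨l - fun _ => k * (2 * Real.pi * Complex.I), sub_mem hl (hconst _), ?_, fun i => ?_⟩
  · have hpi : 0 < 2 * Real.pi := by positivity
    have h1 := Int.floor_le ((l 0).im / (2 * Real.pi))
    have h2 := Int.lt_floor_add_one ((l 0).im / (2 * Real.pi))
    rw [le_div_iff₀ hpi] at h1
    rw [div_lt_iff₀ hpi] at h2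
    have h3 : ((l - fun _ => (k : ℂ) * (2 * Real.pi * Complex.I) : Fin (n + 1) → ℂ) 0).im =
        (l 0).im - k * (2 * Real.pi) := by simp
    rw [h3, abs_le]
    constructor <;> linarith
  · rw [Pi.sub_apply, Complex.exp_sub, Complex.exp_int_mul_two_pi_mul_I, div_one]

theorem exists_bound_re_of_tendsto {z w : ℕ → Fin (n + 1) → ℂ} {z₀ w₀ : Fin (n + 1) → ℂ}
    (hz : Filter.Tendsto z Filter.atTop (nhds z₀)) (hw : Filter.Tendsto w Filter.atTop (nhds w₀))
    {I : Finset (Fin (n + 1))} (hI : ∀ i ∈ I, z₀ i ≠ 0) :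
    ∃ B : ℝ, ∀ᶠ k in Filter.atTop, ∀ i ∈ I, ∀ c : ℂ,
      w k i = Complex.exp c * z k i → c.re ≤ B := by
  -- The ratios `|w_i| / |z_i|` converge and so eventually stay below the limit plus one; the extra
  -- one also keeps the logarithm's argument positive.
  let b : Fin (n + 1) → ℝ := fun i => Real.log (‖w₀ i‖ / ‖z₀ i‖ + 1)
  obtain ⟨B, hB⟩ := (Set.finite_range b).bddAbove
  refine ⟨B, (Filter.eventually_all_finset I).2 fun i hi => ?_⟩
  have hz' : Filter.Tendsto (fun k => ‖z k i‖) Filter.atTop (nhds ‖z₀ i‖) :=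
    (hz.apply_nhds i).norm
  have hw' : Filter.Tendsto (fun k => ‖w k i‖) Filter.atTop (nhds ‖w₀ i‖) :=
    (hw.apply_nhds i).norm
  have hne : ‖z₀ i‖ ≠ 0 := norm_ne_zero_iff.2 (hI i hi)
  filter_upwards [(hw'.div hz' hne).eventually_lt_const (lt_add_one _), hz'.eventually_ne hne]
    with k h1 h2 c hc
  rw [Pi.div_apply, hc, norm_mul, mul_div_cancel_right₀ _ h2, Complex.norm_exp] at h1
  refine le_trans ?_ (hB ⟨i, rfl⟩)
  rw [Real.le_log_iff_exp_le (by positivity)]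
  exact h1.le

/-- Since `z₀` is nonzero on `I`, real parts of the group elements are bounded above there;
exchanging `z` and `w`, they are bounded below on `J`. The separation bounds then control all real
parts, one imaginary part is normalised, and a subsequence of logarithms converges in `L`. -/
theorem exists_exp_mul_eq_of_tendsto (hconst : ∀ c : ℂ, (fun _ => c) ∈ L)
    (hbd : HasSeparationBounds L ℰ) (hph : HasDiagonalPhases L)
    {I J : Finset (Fin (n + 1))} (hI : I ∈ ℰ) (hJ : J ∈ ℰ)
    {z w : ℕ → Fin (n + 1) → ℂ} {z₀ w₀ : Fin (n + 1) → ℂ}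
    (hz : Filter.Tendsto z Filter.atTop (nhds z₀)) (hw : Filter.Tendsto w Filter.atTop (nhds w₀))
    (hzI : ∀ i ∈ I, z₀ i ≠ 0) (hwJ : ∀ j ∈ J, w₀ j ≠ 0)
    (h : ∀ k, ∃ l ∈ L, ∀ i, w k i = Complex.exp (l i) * z k i) :
    ∃ l ∈ L, ∀ i, w₀ i = Complex.exp (l i) * z₀ i := by
  have h' : ∀ k, ∃ l : L, |(l.1 0).im| ≤ 2 * Real.pi ∧
      ∀ i, w k i = Complex.exp (l.1 i) * z k i := by
    intro k
    obtain ⟨l, hl, hlw⟩ := h k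
    obtain ⟨l', hl', h1, h2⟩ := exists_exp_eq_abs_im_le hconst hl
    exact ⟨⟨l', hl'⟩, h1, fun i => by rw [h2, hlw]⟩
  choose l hlim hl using h'
  obtain ⟨B₁, hB₁⟩ := exists_bound_re_of_tendsto hz hw hzI
  obtain ⟨B₂, hB₂⟩ := exists_bound_re_of_tendsto hw hz hwJ
  obtain ⟨C, -, hC⟩ := hbd I hI J hJ
  set B := max B₁ B₂
  have hre : ∀ᶠ k in Filter.atTop, ∀ i, |((l k).1 i).re| ≤ C * B := by
    filter_upwards [hB₁, hB₂] with k h1 h2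
    refine hC _ (l k).2 B (fun i hi => (h1 i hi _ (hl k i)).trans (le_max_left _ _))
      fun j hj => ?_
    have := h2 j hj (-(l k).1 j) (by rw [hl k j, ← mul_assoc, ← Complex.exp_add]; simp)
    rw [Complex.neg_re] at this
    linarith [le_max_right B₁ B₂]
  -- Injectivity in finite dimension turns bounds on `reIm` into bounds on `l`.
  obtain ⟨K, -, hK⟩ := LinearMap.exists_antilipschitzWith _ (ker_reIm hph)
  have : ProperSpace L := FiniteDimensional.proper ℂ L
  have hbdd := hK.isBounded_preimage
    ((Metric.isBounded_closedBall (x := (0 : Fin (n + 1) → ℝ)) (r := |C * B|)).prod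
      (Metric.isBounded_closedBall (x := (0 : ℝ)) (r := 2 * Real.pi)))
  have hmem : ∀ᶠ k in Filter.atTop, l k ∈ reIm L ⁻¹'
      (Metric.closedBall (0 : Fin (n + 1) → ℝ) |C * B| ×ˢ Metric.closedBall (0 : ℝ)
        (2 * Real.pi)) := by
    filter_upwards [hre] with k hk
    refine ⟨?_, ?_⟩
    · rw [mem_closedBall_zero_iff, pi_norm_le_iff_of_nonneg (abs_nonneg _)]
      exact fun i => (hk i).trans (le_abs_self _)
    · rw [mem_closedBall_zero_iff]
      exact hlim k
  obtain ⟨l₀, -, φ, hφ, hlim₀⟩ := tendsto_subseq_of_frequently_bounded hbdd hmem.frequently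
  refine ⟨l₀.1, l₀.2, fun i => ?_⟩
  have hcoord : Filter.Tendsto (fun k => (l (φ k)).1 i) Filter.atTop (nhds (l₀.1 i)) :=
    (((continuous_apply i).comp continuous_subtype_val).tendsto l₀).comp hlim₀
  have hzi : Filter.Tendsto (fun k => z (φ k) i) Filter.atTop (nhds (z₀ i)) :=
    ((continuous_apply i).tendsto z₀).comp (hz.comp hφ.tendsto_atTop)
  have hwi : Filter.Tendsto (fun k => w (φ k) i) Filter.atTop (nhds (w₀ i)) :=
    ((continuous_apply i).tendsto w₀).comp (hw.comp hφ.tendsto_atTop)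
  refine tendsto_nhds_unique hwi ?_
  simp only [hl]
  exact ((Complex.continuous_exp.tendsto _).comp hcoord).mul hzi

end ClosedOrbitRelation

/-! ### Topology of the quotient of `U(K)`; comparison with `Z_K` modulo the circle -/

section TorusExpQuotient

variable {n : ℕ} {F : Type*} [AddCommGroup F] [Module ℝ F] {K : Set (Finset (Fin (n + 1)))}
  {Γ' : Fin (n + 1) → Dual ℝ F} {𝒥 : F →ₗ[ℝ] F} {ℰ : Set (Finset (Fin (n + 1)))}

theorem continuous_torusExpAct (t : ℂˣ) (v : F) : Continuous (torusExpAct K Γ' 𝒥 t v) := by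
  refine Continuous.subtype_mk (continuous_pi fun i => ?_) _
  exact continuous_const.mul (continuous_const.mul
    ((continuous_apply i).comp continuous_subtype_val))

theorem isOpenQuotientMap_torusExpQuotient_mk :
    IsOpenQuotientMap (Quotient.mk (torusExpSetoid K Γ' 𝒥)) where
  surjective := Quotient.mk_surjective
  continuous := continuous_quotient_mk'
  isOpenMap O hO := by
    refine (isQuotientMap_quotient_mk' (s := torusExpSetoid K Γ' 𝒥)).isOpen_preimage.1 ?_
    have : Quotient.mk (torusExpSetoid K Γ' 𝒥) ⁻¹' (Quotient.mk (torusExpSetoid K Γ' 𝒥) '' O) =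
        ⋃ (t : ℂˣ) (v : F), torusExpAct K Γ' 𝒥 t v ⁻¹' O := by
      ext z
      simp only [mem_preimage, mem_image, mem_iUnion]
      constructor
      · rintro ⟨w, hw, hwz⟩
        obtain ⟨t, v, rfl⟩ := Quotient.exact hwz.symm
        exact ⟨t, v, hw⟩
      · rintro ⟨t, v, hz⟩
        exact ⟨_, hz, (Quotient.sound (s := torusExpSetoid K Γ' 𝒥) ⟨t, v, rfl⟩).symm⟩
    refine this ▸ isOpen_iUnion fun t => isOpen_iUnion fun v => hO.preimage (continuous_torusExpAct t v)

variable {h𝒥 : ∀ x, 𝒥 (𝒥 x) = -x}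

theorem t2Space_torusExpQuotient (hbd : HasSeparationBounds (actionSubmodule Γ' 𝒥 h𝒥) ℰ)
    (hph : HasDiagonalPhases (actionSubmodule Γ' 𝒥 h𝒥)) :
    T2Space (TorusExpQuotient (complexOf ℰ) Γ' 𝒥) := by
  rw [t2Space_iff_of_isOpenQuotientMap isOpenQuotientMap_torusExpQuotient_mk]
  refine IsSeqClosed.isClosed fun p p₀ hp hlim => ?_
  obtain ⟨I, hI, hzI⟩ := mem_coordComplement_complexOf.1 p₀.1.2
  obtain ⟨J, hJ, hwJ⟩ := mem_coordComplement_complexOf.1 p₀.2.2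
  refine Quotient.sound ((torusExpSetoid_iff h𝒥).2 ?_)
  refine exists_exp_mul_eq_of_tendsto (const_mem_actionSubmodule Γ' 𝒥 h𝒥) hbd hph hI hJ
    (z := fun k => (p k).1.1) (w := fun k => (p k).2.1) ?_ ?_ hzI hwJ fun k => ?_
  · exact ((continuous_subtype_val.comp continuous_fst).tendsto p₀).comp hlim
  · exact ((continuous_subtype_val.comp continuous_snd).tendsto p₀).comp hlim
  · exact (torusExpSetoid_iff h𝒥).1 (Quotient.exact (hp k))

theorem compactSpace_torusExpQuotient
    (h : ∀ z ∈ coordComplement (complexOf ℰ), ∃ l ∈ actionSubmodule Γ' 𝒥 h𝒥,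
      (fun i => Complex.exp (l i) * z i) ∈ momentAngle (complexOf ℰ)) :
    CompactSpace (TorusExpQuotient (complexOf ℰ) Γ' 𝒥) := by
  have : CompactSpace (momentAngle (complexOf ℰ)) :=
    isCompact_iff_compactSpace.1 isCompact_momentAngle
  let f : momentAngle (complexOf ℰ) → TorusExpQuotient (complexOf ℰ) Γ' 𝒥 :=
    fun z => Quotient.mk _ ⟨z.1, momentAngle_subset_coordComplement z.2⟩
  have hf : Continuous f :=
    continuous_quotient_mk'.comp (continuous_subtype_val.subtype_mk _)
  have hsurj : Function.Surjective f := by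
    rintro ⟨z⟩
    obtain ⟨l, hl, hz⟩ := h z.1 z.2
    refine ⟨⟨_, hz⟩, (Quotient.sound ((torusExpSetoid_iff h𝒥).2 ⟨l, hl, fun i => rfl⟩) : _).symm⟩
  exact hsurj.compactSpace hf

theorem eq_one_of_circleAct_eq (hne : ∀ J ∈ ℰ, J.Nonempty) (c : Circle)
    (z : momentAngle (complexOf ℰ)) (h : circleAct (complexOf ℰ) c z = z) : c = 1 := by
  obtain ⟨J, hJ, hz⟩ := mem_coordComplement_complexOf.1 (momentAngle_subset_coordComplement z.2)
  obtain ⟨j, hj⟩ := hne J hJ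
  have h1 : (c : ℂ) * z.1 j = z.1 j := congrFun (congrArg Subtype.val h) j
  ext
  rw [Circle.coe_one]
  exact (mul_eq_right₀ (hz j hj)).1 h1

/-- A continuous bijection from a compact space to a Hausdorff one. Surjectivity is the covering
hypothesis; injectivity holds because an element of `L` carrying one point of `Z_K` to another has
zero real part, hence is a diagonal phase. -/
theorem exists_homeomorph_circleQuotient
    (hbd : HasSeparationBounds (actionSubmodule Γ' 𝒥 h𝒥) ℰ)
    (hph : HasDiagonalPhases (actionSubmodule Γ' 𝒥 h𝒥))
    (h : ∀ z ∈ coordComplement (complexOf ℰ), ∃ l ∈ actionSubmodule Γ' 𝒥 h𝒥,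
      (fun i => Complex.exp (l i) * z i) ∈ momentAngle (complexOf ℰ)) :
    ∃ Ψ : Quotient (circleSetoid (complexOf ℰ)) ≃ₜ TorusExpQuotient (complexOf ℰ) Γ' 𝒥,
      ∀ z : momentAngle (complexOf ℰ),
        Ψ (Quotient.mk _ z) = Quotient.mk _ ⟨z.1, momentAngle_subset_coordComplement z.2⟩ := by
  have := t2Space_torusExpQuotient hbd hph
  have : CompactSpace (momentAngle (complexOf ℰ)) :=
    isCompact_iff_compactSpace.1 isCompact_momentAngle
  let g : momentAngle (complexOf ℰ) → TorusExpQuotient (complexOf ℰ) Γ' 𝒥 :=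
    fun z => Quotient.mk _ ⟨z.1, momentAngle_subset_coordComplement z.2⟩
  have hg : ∀ z w, circleSetoid (complexOf ℰ) z w → g z = g w := by
    rintro z _ ⟨c, rfl⟩
    refine Quotient.sound ((torusExpSetoid_iff h𝒥).2
      ⟨_, const_mem_actionSubmodule Γ' 𝒥 h𝒥 (Complex.log c), fun i => ?_⟩)
    rw [Complex.exp_log (Circle.coe_ne_zero c)]; rfl
  let f : Quotient (circleSetoid (complexOf ℰ)) → TorusExpQuotient (complexOf ℰ) Γ' 𝒥 :=
    Quotient.lift g hg
  have hf : IsHomeomorph f := by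
    rw [isHomeomorph_iff_continuous_bijective]
    refine ⟨?_, ?_, ?_⟩
    · exact (continuous_quotient_mk'.comp (continuous_subtype_val.subtype_mk _)).quotient_lift _
    · rintro ⟨z⟩ ⟨w⟩ hzw
      obtain ⟨l, hl, hzw⟩ := (torusExpSetoid_iff h𝒥).1 (Quotient.exact hzw)
      obtain ⟨I, hI, hz1, hzI⟩ := mem_momentAngle_complexOf.1 z.2
      obtain ⟨J, hJ, hw1, hwJ⟩ := mem_momentAngle_complexOf.1 w.2
      have hnorm : ∀ i, ‖w.1 i‖ = Real.exp (l i).re * ‖z.1 i‖ := fun i => by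
        rw [← Complex.norm_exp, ← norm_mul]; exact congrArg norm (hzw i)
      obtain ⟨C, -, hC⟩ := hbd I hI J hJ
      -- On `I`, `|z_i| = 1` and `|w_i| ≤ 1` give real part `≤ 0`; on `J` the roles are reversed.
      -- The separation bound with `B = 0` gives the rest.
      have hre : ∀ i, (l i).re = 0 := by
        intro i
        have := hC l hl 0 (fun i hi => ?_) (fun j hj => ?_) i
        · simpa using this
        · rw [← Real.exp_le_one_iff]
          have := hnorm i
          rw [hzI i hi, mul_one] at this
          rw [← this]; exact hw1 i
        · rw [neg_zero, ← Real.one_le_exp_iff]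
          have h1 := hnorm j
          rw [hwJ j hj] at h1
          have := hz1 j
          rw [h1]
          exact mul_le_of_le_one_right (Real.exp_pos _).le this
      obtain ⟨θ, hθ⟩ := hph l hl hre
      refine Quotient.sound ⟨Circle.exp θ, Subtype.ext (funext fun i => ?_)⟩
      change (Circle.exp θ : ℂ) * z.1 i = w.1 i
      rw [Circle.coe_exp, ← hθ i]
      exact (hzw i).symm
    · rintro ⟨z⟩
      obtain ⟨l, hl, hz⟩ := h z.1 z.2
      exact ⟨Quotient.mk _ ⟨_, hz⟩,
        (Quotient.sound ((torusExpSetoid_iff h𝒥).2 ⟨l, hl, fun i => rfl⟩) : _).symm⟩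
  exact ⟨hf.homeomorph f, fun z => rfl⟩

end TorusExpQuotient

/-! ### Quotient complex structures from local slices -/

section QuotientComplexManifold

variable {N N' d d' : ℕ} {X X' Y Z : Type*} [TopologicalSpace X] [ChartedSpace (Fin N → ℂ) X]
  [TopologicalSpace X'] [ChartedSpace (Fin N' → ℂ) X']
  [TopologicalSpace Z] [ChartedSpace (Fin d' → ℂ) Z]

theorem IsQuotientComplexManifold.isOpenQuotientMap [TopologicalSpace Y] [ChartedSpace (Fin d → ℂ) Y] {π : X → Y}
    (h : IsQuotientComplexManifold (N := N) (d := d) π) : IsOpenQuotientMap π where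
  surjective := h.surjective
  continuous := h.holomorphic.continuous
  isOpenMap := by
    intro S hS
    rw [isOpen_iff_mem_nhds]
    rintro _ ⟨x, hx, rfl⟩
    obtain ⟨O, hO, hxO, σ, hσx, hσ, hσc⟩ := h.section_through x
    have h1 : ContinuousAt σ (π x) := hσc.continuousOn.continuousAt (hO.mem_nhds hxO)
    filter_upwards [h1.eventually_mem (hσx ▸ hS.mem_nhds hx), hO.mem_nhds hxO] with y hy hyO
    exact ⟨σ y, hy, hσ y hyO⟩

/-- A map out of a quotient complex manifold is holomorphic if its pullback is. -/
theorem IsQuotientComplexManifold.contMDiff_of_comp [TopologicalSpace Y] [ChartedSpace (Fin d → ℂ) Y] {π : X → Y}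
    (h : IsQuotientComplexManifold (N := N) (d := d) π) {f : Y → Z}
    (hf : ContMDiff 𝓘(ℂ, Fin N → ℂ) 𝓘(ℂ, Fin d' → ℂ) ω (f ∘ π)) :
    ContMDiff 𝓘(ℂ, Fin d → ℂ) 𝓘(ℂ, Fin d' → ℂ) ω f := by
  intro y
  obtain ⟨x, rfl⟩ := h.surjective y
  obtain ⟨O, hO, hxO, σ, -, hσ, hσc⟩ := h.section_through x
  have h1 : ContMDiffAt 𝓘(ℂ, Fin d → ℂ) 𝓘(ℂ, Fin N → ℂ) ω σ (π x) :=
    hσc.contMDiffAt (hO.mem_nhds hxO)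
  refine (hf.contMDiffAt.comp (π x) h1).congr_of_eventuallyEq ?_
  filter_upwards [hO.mem_nhds hxO] with y hy
  simp [hσ y hy]

/-- Cancellation, used to descend the structure from `U(K)` to `P(ℰ)`: sections of the composite
followed by `q` are sections of `π`. -/
theorem IsQuotientComplexManifold.of_comp [TopologicalSpace Y] [ChartedSpace (Fin d → ℂ) Y] {q : X → X'} {π : X' → Y}
    (hq : IsQuotientComplexManifold (N := N) (d := N') q)
    (hπ : IsQuotientComplexManifold (N := N) (d := d) (π ∘ q)) :
    IsQuotientComplexManifold (N := N') (d := d) π where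
  isManifold := hπ.isManifold
  surjective := hπ.surjective.of_comp
  holomorphic := hq.contMDiff_of_comp hπ.holomorphic
  section_through z := by
    obtain ⟨x, rfl⟩ := hq.surjective z
    obtain ⟨O, hO, hxO, σ, hσx, hσ, hσc⟩ := hπ.section_through x
    exact ⟨O, hO, hxO, q ∘ σ, congrArg q hσx, hσ, hq.holomorphic.comp_contMDiffOn hσc⟩

/-- `f : W → X` is a holomorphic slice for `π`: each fibre of `π` meets it in at most one point,
and there are local holomorphic retractions along the fibres onto it. -/
structure IsLocalSlice (π : X → Y) (W : Set (Fin d → ℂ)) (f : (Fin d → ℂ) → X) : Prop where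
  isOpen : IsOpen W
  contMDiffOn : ContMDiffOn 𝓘(ℂ, Fin d → ℂ) 𝓘(ℂ, Fin N → ℂ) ω f W
  injOn : InjOn (π ∘ f) W
  retraction : ∀ w ∈ W, ∀ x, π x = π (f w) → ∃ ρ : X → (Fin d → ℂ),
    ContMDiffAt 𝓘(ℂ, Fin N → ℂ) 𝓘(ℂ, Fin d → ℂ) ω ρ x ∧
      ∀ᶠ x' in nhds x, ρ x' ∈ W ∧ π (f (ρ x')) = π x'

namespace IsLocalSlice

variable {π : X → Y} {W : Set (Fin d → ℂ)} {f : (Fin d → ℂ) → X}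

theorem isOpen_preimage (h : IsLocalSlice (N := N) π W f) : IsOpen (π ⁻¹' (π ∘ f '' W)) := by
  rw [isOpen_iff_mem_nhds]
  rintro x ⟨w, hw, hwx⟩
  obtain ⟨ρ, -, hρ⟩ := h.retraction w hw x hwx.symm
  filter_upwards [hρ] with x' hx'
  exact ⟨_, hx'.1, hx'.2⟩

theorem invFunOn_eq (h : IsLocalSlice (N := N) π W f) {w : Fin d → ℂ} (hw : w ∈ W) :
    Function.invFunOn (π ∘ f) W (π (f w)) = w :=
  h.injOn.leftInvOn_invFunOn hw

/-- Since each fibre meets the slice at most once, the chosen inverse agrees near `x` with any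
retraction `ρ`, which is holomorphic. This gives both holomorphy of `π` and of the transition maps.
-/
theorem contMDiffAt_invFunOn_comp (h : IsLocalSlice (N := N) π W f) {x : X}
    (hx : π x ∈ π ∘ f '' W) : ContMDiffAt 𝓘(ℂ, Fin N → ℂ) 𝓘(ℂ, Fin d → ℂ) ω
      (Function.invFunOn (π ∘ f) W ∘ π) x := by
  obtain ⟨w, hw, hwx⟩ := hx
  obtain ⟨ρ, hρc, hρ⟩ := h.retraction w hw x hwx.symm
  refine hρc.congr_of_eventuallyEq ?_
  filter_upwards [hρ] with x' hx'
  rw [Function.comp_apply, ← hx'.2, h.invFunOn_eq hx'.1]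

variable [TopologicalSpace Y]

/-- The chart of the quotient defined by a slice. -/
noncomputable def chart (h : IsLocalSlice (N := N) π W f) (hπ : IsOpenQuotientMap π) :
    OpenPartialHomeomorph Y (Fin d → ℂ) where
  toFun := Function.invFunOn (π ∘ f) W
  invFun := π ∘ f
  source := π ∘ f '' W
  target := W
  map_source' _ hy := Function.invFunOn_mem hy
  map_target' _ hw := mem_image_of_mem _ hw
  left_inv' _ hy := Function.invFunOn_eq hy
  right_inv' _ hw := h.invFunOn_eq hw
  open_source := hπ.isQuotientMap.isOpen_preimage.1 h.isOpen_preimage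
  open_target := h.isOpen
  continuousOn_toFun := by
    refine (hπ.isQuotientMap.continuousOn_isOpen_iff
      (hπ.isQuotientMap.isOpen_preimage.1 h.isOpen_preimage)).2 fun x hx => ?_
    exact (h.contMDiffAt_invFunOn_comp hx).continuousAt.continuousWithinAt
  continuousOn_invFun := hπ.continuous.comp_continuousOn h.contMDiffOn.continuousOn

end IsLocalSlice

/-- A quotient by an equivalence relation with holomorphic local slices is a complex manifold. -/
theorem exists_isQuotientComplexManifold [TopologicalSpace Y] {π : X → Y} (hπ : IsOpenQuotientMap π)
    (h : ∀ x, ∃ (W : Set (Fin d → ℂ)) (f : (Fin d → ℂ) → X) (w : Fin d → ℂ),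
      IsLocalSlice (N := N) π W f ∧ w ∈ W ∧ f w = x) :
    ∃ _ : ChartedSpace (Fin d → ℂ) Y, IsQuotientComplexManifold (N := N) (d := d) π := by
  choose W f w hs hw hf using h
  choose τ hτ using hπ.surjective
  let C : ChartedSpace (Fin d → ℂ) Y :=
    { atlas := range fun x => (hs x).chart hπ
      chartAt := fun y => (hs (τ y)).chart hπ
      mem_chart_source := fun y => ⟨w (τ y), hw _, by simp [hf, hτ]⟩
      chart_mem_atlas := fun y => mem_range_self _ }
  have hM : IsManifold 𝓘(ℂ, Fin d → ℂ) ω Y := by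
    refine isManifold_of_contDiffOn _ _ _ ?_
    rintro _ _ ⟨x, rfl⟩ ⟨x', rfl⟩
    simp only [modelWithCornersSelf_coe, modelWithCornersSelf_coe_symm, Function.comp_def, id,
      preimage_id_eq, range_id, inter_univ]
    rintro u ⟨hu, hu'⟩
    -- The transition map enters the first slice by `f x` and then retracts onto the second.
    have h1 : ContMDiffAt 𝓘(ℂ, Fin d → ℂ) 𝓘(ℂ, Fin N → ℂ) ω (f x) u :=
      (hs x).contMDiffOn.contMDiffAt ((hs x).isOpen.mem_nhds hu)
    have h2 := ((hs x').contMDiffAt_invFunOn_comp hu').comp u h1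
    exact h2.contDiffAt.contDiffWithinAt
  refine ⟨C, hM, hπ.surjective, fun x => ?_, fun x => ?_⟩
  · rw [contMDiffAt_iff_target]
    refine ⟨hπ.continuous.continuousAt, ?_⟩
    exact (hs (τ (π x))).contMDiffAt_invFunOn_comp (mem_chart_source (Fin d → ℂ) (π x))
  · refine ⟨π ∘ f x '' W x, ((hs x).chart hπ).open_source, ⟨w x, hw x, by simp [hf]⟩,
      f x ∘ Function.invFunOn (π ∘ f x) (W x), ?_, fun y hy => Function.invFunOn_eq hy, ?_⟩
    · have := (hs x).invFunOn_eq (hw x)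
      rw [hf] at this
      rw [Function.comp_apply, this, hf]
    · refine (hs x).contMDiffOn.comp (t := W x) ?_ (fun y hy => Function.invFunOn_mem hy)
      exact contMDiffOn_of_mem_maximalAtlas (e := (hs x).chart hπ)
        (IsManifold.subset_maximalAtlas (mem_range_self x))

end QuotientComplexManifold

/-! ### The projection from `U(K)` to `P(ℰ)` -/

section ProjectiveQuotient

variable {n : ℕ} {ℰ : Set (Finset (Fin (n + 1)))}

theorem ne_zero_of_mem_coordComplement (hne : ∀ J ∈ ℰ, J.Nonempty) {z : Fin (n + 1) → ℂ}
    (hz : z ∈ coordComplement (complexOf ℰ)) : z ≠ 0 := by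
  obtain ⟨J, hJ, h⟩ := mem_coordComplement_complexOf.1 hz
  obtain ⟨j, hj⟩ := hne J hJ
  exact fun h0 => h j hj (congrFun h0 j)

/-- The projection `z ↦ [z]` from `U_ℂ(K)` to `P(ℰ)`. -/
noncomputable def projectivize (hne : ∀ J ∈ ℰ, J.Nonempty) (z : coordComplement (complexOf ℰ)) :
    projComplement ℰ :=
  ⟨Projectivization.mk ℂ z.1 (ne_zero_of_mem_coordComplement hne z.2),
    (mk_mem_projComplement _).2 z.2⟩

theorem continuous_projectivize (hne : ∀ J ∈ ℰ, J.Nonempty) :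
    Continuous (projectivize hne) := by
  refine Continuous.subtype_mk ?_ _
  exact (isQuotientMap_mk' n).continuous.comp
    (f := fun z : coordComplement (complexOf ℰ) =>
      (⟨z.1, ne_zero_of_mem_coordComplement hne z.2⟩ : {v : Fin (n + 1) → ℂ // v ≠ 0}))
    (continuous_subtype_val.subtype_mk _)

theorem affineChart_mk (j : Fin (n + 1)) {z : Fin (n + 1) → ℂ} (hz : z ≠ 0) (i : Fin n) :
    affineChart j (Projectivization.mk ℂ z hz) i = z (j.succAbove i) / z j := by
  obtain ⟨a, ha⟩ := rep_mk z hz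
  change (Projectivization.mk ℂ z hz).rep _ / (Projectivization.mk ℂ z hz).rep _ = _
  rw [ha, ha]
  exact mul_div_mul_left _ _ a.ne_zero

theorem contMDiff_projectivize (hne : ∀ J ∈ ℰ, J.Nonempty) :
    ContMDiff 𝓘(ℂ, Fin (n + 1) → ℂ) 𝓘(ℂ, Fin n → ℂ) ω (projectivize hne) := by
  intro z
  refine (ChartedSpace.liftPropWithinAt_subtypeVal_comp_iff (projectivize hne) univ z).1 ?_
  change ContMDiffAt 𝓘(ℂ, Fin (n + 1) → ℂ) 𝓘(ℂ, Fin n → ℂ) ω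
    (Subtype.val ∘ projectivize hne) z
  rw [contMDiffAt_iff_target]
  refine ⟨(continuous_subtype_val.comp (continuous_projectivize hne)).continuousAt, ?_⟩
  set p := (Subtype.val ∘ projectivize hne) z with hp
  obtain ⟨j, hj, hjz⟩ : ∃ j, chartAt (Fin n → ℂ) p = affineChart j ∧ z.1 j ≠ 0 := by
    refine ⟨_, rfl, ?_⟩
    have := (exists_rep_ne_zero p).choose_spec
    rw [hp] at this
    exact (rep_mk_ne_zero_iff z.1 _ _).1 this
  have h1 : (extChartAt 𝓘(ℂ, Fin n → ℂ) p : _ → _) ∘ Subtype.val ∘ projectivize hne =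
      fun y : coordComplement (complexOf ℰ) =>
        (fun (x : Fin (n + 1) → ℂ) (i : Fin n) => x (j.succAbove i) / x j) y := by
    ext y i
    simp only [extChartAt, hj, Function.comp_apply]
    exact affineChart_mk j _ i
  rw [h1, contMDiffAt_subtype_iff (f := fun (x : Fin (n + 1) → ℂ) (i : Fin n) =>
    x (j.succAbove i) / x j)]
  refine ContDiffAt.contMDiffAt (contDiffAt_pi.2 fun i => ?_)
  exact (contDiff_apply ℂ ℂ _).contDiffAt.div (contDiff_apply ℂ ℂ _).contDiffAt hjz

theorem isQuotientComplexManifold_projectivize (hne : ∀ J ∈ ℰ, J.Nonempty) :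
    IsQuotientComplexManifold (N := n + 1) (d := n) (projectivize hne) where
  isManifold := inferInstance
  surjective := by
    rintro ⟨p, hp⟩
    induction p with
    | h z hz => exact ⟨⟨z, (mk_mem_projComplement hz).1 hp⟩, rfl⟩
  holomorphic := contMDiff_projectivize hne
  section_through z := by
    classical
    obtain ⟨j, hj⟩ : ∃ j, z.1 j ≠ 0 :=
      Function.ne_iff.1 (ne_zero_of_mem_coordComplement hne z.2)
    -- The local section `[x] ↦ (z_j / x_j) x` is scaled so as to pass through `z`, and is
    -- polynomial in the affine chart.
    have hmk : ∀ (x : Fin (n + 1) → ℂ) (hx : x ≠ 0), x j ≠ 0 →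
        z.1 j • (j.insertNth (1 : ℂ) (affineChart j (Projectivization.mk ℂ x hx)) :
          Fin (n + 1) → ℂ) = (z.1 j / x j) • x := by
      intro x hx hxj
      ext i
      refine Fin.succAboveCases j ?_ (fun i => ?_) i
      · simp [hxj]
      · simp only [Pi.smul_apply, Fin.insertNth_apply_succAbove, smul_eq_mul, affineChart_mk]
        ring
    have hmem : ∀ p : projComplement ℰ, p.1.rep j ≠ 0 →
        z.1 j • (j.insertNth (1 : ℂ) (affineChart j p.1) : Fin (n + 1) → ℂ) ∈
          coordComplement (complexOf ℰ) := by
      rintro ⟨p, hp⟩ hpj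
      induction p with
      | h x hx =>
        have hxj := (rep_mk_ne_zero_iff x hx j).1 hpj
        rw [hmk x hx hxj]
        obtain ⟨J, hJ, h⟩ := mem_coordComplement_complexOf.1 ((mk_mem_projComplement hx).1 hp)
        refine mem_coordComplement_complexOf.2 ⟨J, hJ, fun i hi => ?_⟩
        exact mul_ne_zero (div_ne_zero hj hxj) (h i hi)
    let σ : projComplement ℰ → coordComplement (complexOf ℰ) := fun p =>
      if h : p.1.rep j ≠ 0 then ⟨_, hmem p h⟩ else z
    have hσ : ∀ p : projComplement ℰ, p.1.rep j ≠ 0 → (σ p).1 =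
        z.1 j • (j.insertNth (1 : ℂ) (affineChart j p.1) : Fin (n + 1) → ℂ) := fun p hp =>
      congrArg Subtype.val (dif_pos hp)
    have hO : IsOpen {p : projComplement ℰ | p.1.rep j ≠ 0} :=
      (isOpen_coord_ne_zero j).preimage continuous_subtype_val
    refine ⟨{p | p.1.rep j ≠ 0}, hO, (rep_mk_ne_zero_iff z.1 _ j).2 hj, σ, ?_, ?_, ?_⟩
    · have h1 : (projectivize hne z).1.rep j ≠ 0 := (rep_mk_ne_zero_iff z.1 _ j).2 hj
      refine Subtype.ext ((hσ _ h1).trans <| (hmk z.1 (ne_zero_of_mem_coordComplement hne z.2) hj).trans ?_)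
      rw [div_self hj, one_smul]
    · rintro ⟨p, hp⟩ hpj
      induction p with
      | h x hx =>
        have hxj := (rep_mk_ne_zero_iff x hx j).1 hpj
        refine Subtype.ext ?_
        change Projectivization.mk ℂ (σ _).1 _ = _
        rw [Projectivization.mk_eq_mk_iff']
        refine ⟨z.1 j / x j, ?_⟩
        exact ((hσ _ hpj).trans (hmk x hx hxj)).symm
    · have h1 : ContMDiffOn 𝓘(ℂ, Fin n → ℂ) 𝓘(ℂ, Fin n → ℂ) ω
          (fun p : projComplement ℰ => affineChart j p.1) {p | p.1.rep j ≠ 0} := by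
        refine (contMDiffOn_of_mem_maximalAtlas (e := affineChart j)
          (IsManifold.subset_maximalAtlas (mem_range_self j))).comp
            contMDiff_subtype_val.contMDiffOn fun p hp => hp
      have h2 : ContDiff ℂ ω (fun w : Fin n → ℂ =>
          z.1 j • (j.insertNth (1 : ℂ) w : Fin (n + 1) → ℂ)) := by
        refine ContDiff.const_smul _ (contDiff_pi.2 fun i => ?_)
        refine Fin.succAboveCases j ?_ (fun i => ?_) i
        · simpa using contDiff_const
        · simpa using contDiff_apply ℂ ℂ i
      intro p hp
      refine (ChartedSpace.liftPropWithinAt_subtypeVal_comp_iff σ _ p).1 ?_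
      exact ((h2.contMDiff.comp_contMDiffOn h1) p hp).congr (fun q hq => hσ q hq) (hσ p hp)

variable {F : Type*} [AddCommGroup F] [Module ℝ F] {Γ' : Fin (n + 1) → Dual ℝ F}
  {𝒥 : F →ₗ[ℝ] F}

/-- Equality of two projective points is proportionality by a unit, which is the diagonal factor `t`
of the torus-exponential action. -/
theorem expSetoid_projectivize_iff (hne : ∀ J ∈ ℰ, J.Nonempty)
    {z w : coordComplement (complexOf ℰ)} :
    expSetoid ℰ Γ' 𝒥 (projectivize hne z) (projectivize hne w) ↔
      torusExpSetoid (complexOf ℰ) Γ' 𝒥 z w := by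
  have key : ∀ v, expAct ℰ Γ' 𝒥 v (projectivize hne z) = projectivize hne w ↔
      ∃ t : ℂˣ, torusExpAct (complexOf ℰ) Γ' 𝒥 t v z = w := by
    intro v
    rw [Subtype.ext_iff]
    change Projectivization.map _ (expLinear_injective Γ' 𝒥 v) (Projectivization.mk ℂ z.1 _) = Projectivization.mk ℂ w.1 _ ↔ _
    rw [Projectivization.map_mk, eq_comm, Projectivization.mk_eq_mk_iff]
    exact exists_congr fun t => ⟨fun h => Subtype.ext h, fun h => congrArg Subtype.val h⟩
  constructor
  · rintro ⟨v, hv⟩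
    obtain ⟨t, ht⟩ := (key v).1 hv
    exact ⟨t, v, ht⟩
  · rintro ⟨t, v, h⟩
    exact ⟨v, (key v).2 ⟨t, h⟩⟩

theorem exists_homeomorph_LVMBQuotient (hne : ∀ J ∈ ℰ, J.Nonempty) :
    ∃ Φ : TorusExpQuotient (complexOf ℰ) Γ' 𝒥 ≃ₜ LVMBQuotient ℰ Γ' 𝒥,
      ∀ z, Φ (Quotient.mk _ z) = Quotient.mk _ (projectivize hne z) := by
  let g : coordComplement (complexOf ℰ) → LVMBQuotient ℰ Γ' 𝒥 :=
    fun z => Quotient.mk _ (projectivize hne z)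
  have hg : Topology.IsQuotientMap g := by
    have h1 : Topology.IsQuotientMap (Quotient.mk (expSetoid ℰ Γ' 𝒥)) := isQuotientMap_quotient_mk'
    exact h1.comp
      (isQuotientComplexManifold_projectivize hne).isOpenQuotientMap.isQuotientMap
  let f : TorusExpQuotient (complexOf ℰ) Γ' 𝒥 → LVMBQuotient ℰ Γ' 𝒥 :=
    Quotient.lift g fun z w h => Quotient.sound ((expSetoid_projectivize_iff hne).2 h)
  have hf : IsHomeomorph f := by
    rw [isHomeomorph_iff_isQuotientMap_injective]
    refine ⟨?_, ?_⟩
    · exact Topology.IsQuotientMap.of_comp (f := Quotient.mk _) continuous_quotient_mk'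
        (hg.continuous.quotient_lift _) hg
    · rintro ⟨z⟩ ⟨w⟩ h
      exact Quotient.sound ((expSetoid_projectivize_iff hne).1 (Quotient.exact h))
  exact ⟨hf.homeomorph f, fun z => rfl⟩

end ProjectiveQuotient

/-! ### Coordinates and phases on `L` -/

section LinearAlgebra

variable {n : ℕ} {ℰ : Set (Finset (Fin (n + 1)))} {L : Submodule ℂ (Fin (n + 1) → ℂ)}

theorem eq_zero_of_forall_mem_eq_zero (hbd : HasSeparationBounds L ℰ) (hph : HasDiagonalPhases L)
    (hne : ∀ J ∈ ℰ, J.Nonempty) {J : Finset (Fin (n + 1))} (hJ : J ∈ ℰ) {l : Fin (n + 1) → ℂ}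
    (hl : l ∈ L) (h : ∀ j ∈ J, l j = 0) : l = 0 := by
  obtain ⟨C, -, hC⟩ := hbd J hJ J hJ
  have hre : ∀ i, (l i).re = 0 := fun i => by
    simpa using hC l hl 0 (fun j hj => by simp [h j hj]) (fun j hj => by simp [h j hj]) i
  obtain ⟨θ, hθ⟩ := hph l hl hre
  obtain ⟨j, hj⟩ := hne J hJ
  have h1 := hθ j
  rw [h j hj] at h1
  ext i
  rw [hθ i, ← h1]; rfl

/-- Elements of `L` with small real parts on a member of `ℰ` have almost constant phases. -/
theorem exists_phase_near (hconst : ∀ c : ℂ, (fun _ => c) ∈ L) (hbd : HasSeparationBounds L ℰ)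
    (hph : HasDiagonalPhases L) {J : Finset (Fin (n + 1))} (hJ : J ∈ ℰ) :
    ∃ δ > 0, ∀ l ∈ L, (∀ j ∈ J, |(l j).re| ≤ δ) →
      ∃ θ : ℝ, ∀ i, ‖l i - θ * Complex.I‖ < Real.pi := by
  obtain ⟨C, hC0, hC⟩ := hbd J hJ J hJ
  obtain ⟨K, hK0, hK⟩ := LinearMap.exists_antilipschitzWith _ (ker_reIm hph)
  -- `C` controls all real parts by those on `J`, `K` controls an element of `L` by its image under
  -- `reIm`, and this `δ` gives `K C δ ≤ 1 < π`.
  refine ⟨1 / (K * C + 1), by positivity, fun l hl hre => ?_⟩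
  set δ : ℝ := 1 / (K * C + 1) with hδ
  have hδ0 : 0 < δ := by positivity
  refine ⟨(l 0).im, fun i => ?_⟩
  -- Removing the diagonal phase keeps the real parts and kills the imaginary part seen by `reIm`.
  let a : L := ⟨l - fun _ => ((l 0).im : ℂ) * Complex.I, sub_mem hl (hconst _)⟩
  have h1 : ‖a‖ ≤ K * ‖reIm L a‖ := by
    have := hK.le_mul_dist a 0
    simpa using this
  have h2 : ‖reIm L a‖ ≤ C * δ := by
    have h3 := hC l hl δ (fun j hj => (abs_le.1 (hre j hj)).2) (fun j hj => (abs_le.1 (hre j hj)).1)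
    refine max_le ?_ ?_
    · rw [pi_norm_le_iff_of_nonneg (by positivity)]
      intro i
      simpa [reIm, a] using h3 i
    · simp only [reIm, a, LinearMap.coe_mk, AddHom.coe_mk]
      simp; positivity
  have h3 : ‖a.1 i‖ ≤ ‖a‖ := norm_le_pi_norm a.1 i
  refine lt_of_le_of_lt (h3.trans (h1.trans (mul_le_mul_of_nonneg_left h2 K.2))) ?_
  have h4 : (K : ℝ) * (C * δ) ≤ 1 := by
    rw [hδ, ← mul_assoc, mul_one_div, div_le_one (by positivity)]
    linarith
  change (K : ℝ) * (C * δ) < Real.pi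
  linarith [Real.pi_gt_three]

/-- Some coordinates in a member of `ℰ` form a linear coordinate system on `L`; the remaining
coordinates of the ambient space are enumerated by `q`. -/
theorem exists_coordinates (hbd : HasSeparationBounds L ℰ) (hph : HasDiagonalPhases L)
    (hne : ∀ J ∈ ℰ, J.Nonempty) {J : Finset (Fin (n + 1))} (hJ : J ∈ ℰ) {d : ℕ}
    (hd : d + finrank ℂ L = n + 1) :
    ∃ (S : Finset (Fin (n + 1))) (E : L ≃ₗ[ℂ] (S → ℂ)) (q : Fin d → Fin (n + 1)),
      S ⊆ J ∧ (∀ l k, E l k = l.1 k) ∧ Function.Injective q ∧ ∀ i, i ∈ S ↔ ∀ j, q j ≠ i := by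
  classical
  let ev : J → Dual ℂ L := fun j => (LinearMap.proj (j : Fin (n + 1))).comp L.subtype
  obtain ⟨κ, a, ha, hspan, hli⟩ := exists_linearIndependent' ℂ ev
  -- An element of `L` vanishing on `J` is zero, so the coordinates in `J` span the dual of `L` and
  -- contain a basis of it.
  have htop : Submodule.span ℂ (range (ev ∘ a)) = ⊤ := by
    rw [hspan]
    by_contra hcon
    obtain ⟨f, hf0, hf⟩ := Submodule.exists_le_ker_of_lt_top _ (lt_top_iff_ne_top.2 hcon)
    obtain ⟨l, rfl⟩ := (Module.evalEquiv ℂ L).surjective f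
    apply hf0
    have : l = 0 := Subtype.ext (eq_zero_of_forall_mem_eq_zero hbd hph hne hJ l.2 fun j hj =>
      hf (Submodule.subset_span ⟨⟨j, hj⟩, rfl⟩))
    rw [this, map_zero]
  have hκ : Finite κ := Finite.of_injective a ha
  let S : Finset (Fin (n + 1)) := (Set.toFinite (range fun k => (a k : Fin (n + 1)))).toFinset
  have hS : ∀ i, i ∈ S ↔ ∃ k, (a k : Fin (n + 1)) = i := fun i => by simp [S]
  let g : L →ₗ[ℂ] (S → ℂ) := LinearMap.pi fun k => (LinearMap.proj (k : Fin (n + 1))).comp L.subtype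
  have hg : ∀ l k, g l k = l.1 k := fun _ _ => rfl
  have hinj : Function.Injective g := by
    rw [injective_iff_map_eq_zero]
    intro l hl
    apply (Module.evalEquiv ℂ L).injective
    rw [map_zero]
    refine LinearMap.ext_on htop ?_
    rintro _ ⟨k, rfl⟩
    exact congrFun hl ⟨a k, (hS _).2 ⟨k, rfl⟩⟩
  have hcard : S.card = finrank ℂ L := by
    have h1 : Nat.card κ = finrank ℂ L := by
      rw [← Subspace.dual_finrank_eq]
      have := Fintype.ofFinite κ
      rw [Nat.card_eq_fintype_card]
      exact (finrank_eq_card_basis (Basis.mk hli htop.ge)).symm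
    rw [← h1, Set.Finite.card_toFinset, ← Nat.card_eq_fintype_card,
      Nat.card_range_of_injective fun k k' h => ha (Subtype.ext h)]
  have hsurj : Function.Surjective g := by
    refine (LinearMap.injective_iff_surjective_of_finrank_eq_finrank ?_).1 hinj
    rw [finrank_fintype_fun_eq_card, Fintype.card_coe, hcard]
  have hcard' : Sᶜ.card = d := by
    rw [Finset.card_compl, Fintype.card_fin, hcard]; omega
  refine ⟨S, LinearEquiv.ofBijective g ⟨hinj, hsurj⟩, Sᶜ.orderEmbOfFin hcard', ?_, hg,
    (Sᶜ.orderEmbOfFin hcard').injective, fun i => ?_⟩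
  · intro i hi
    obtain ⟨k, rfl⟩ := (hS i).1 hi
    exact (a k).2
  · have h1 : (∃ j, Sᶜ.orderEmbOfFin hcard' j = i) ↔ i ∈ Sᶜ := by
      rw [← Finset.mem_coe, ← Finset.range_orderEmbOfFin Sᶜ hcard']; rfl
    rw [Finset.mem_compl] at h1
    rw [← not_iff_not, ← h1]
    simp

end LinearAlgebra

/-! ### Holomorphic slices for the action on `U(K)` -/

section Slice

variable {n d : ℕ} {ℰ : Set (Finset (Fin (n + 1)))} {L : Submodule ℂ (Fin (n + 1) → ℂ)}

/-- An element of `exp L` with almost constant phase that is trivial on a coordinate system of `L`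
is trivial. -/
theorem exp_eq_one_of_phase (hconst : ∀ c : ℂ, (fun _ => c) ∈ L) {S : Finset (Fin (n + 1))}
    (E : L ≃ₗ[ℂ] (S → ℂ)) (hE : ∀ l k, E l k = l.1 k) {l : Fin (n + 1) → ℂ} (hl : l ∈ L)
    {θ : ℝ} (hθ : ∀ i, ‖l i - θ * Complex.I‖ < Real.pi) (hS : ∀ k ∈ S, Complex.exp (l k) = 1)
    (i : Fin (n + 1)) : Complex.exp (l i) = 1 := by
  obtain ⟨k₀, hk₀⟩ : S.Nonempty := by
    by_contra hcon
    have : IsEmpty S := ⟨fun k => hcon ⟨k, k.2⟩⟩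
    have h1 : (⟨fun _ => 1, hconst 1⟩ : L) = 0 := E.injective (Subsingleton.elim _ _)
    have h2 : (1 : ℂ) = 0 := congrFun (congrArg Subtype.val h1) 0
    exact one_ne_zero h2
  have hm : ∀ k ∈ S, ∃ m : ℤ, l k = m * (2 * Real.pi * Complex.I) := fun k hk =>
    Complex.exp_eq_one_iff.1 (hS k hk)
  obtain ⟨m₀, hm₀⟩ := hm k₀ hk₀
  -- On `S` the values are multiples of `2πi` within `2π` of each other, hence equal; then `l` minus
  -- a constant vanishes on the coordinate system `S`.
  have hconstS : ∀ k ∈ S, l k = l k₀ := by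
    intro k hk
    obtain ⟨m, hm⟩ := hm k hk
    have h1 : ‖l k - l k₀‖ < 2 * Real.pi := by
      calc ‖l k - l k₀‖ = ‖(l k - θ * Complex.I) - (l k₀ - θ * Complex.I)‖ := by ring_nf
        _ ≤ ‖l k - θ * Complex.I‖ + ‖l k₀ - θ * Complex.I‖ := norm_sub_le _ _
        _ < 2 * Real.pi := by linarith [hθ k, hθ k₀]
    have h2 : l k - l k₀ = ((m - m₀ : ℤ) : ℂ) * (2 * Real.pi * Complex.I) := by
      rw [hm, hm₀]; push_cast; ring
    rw [h2, norm_mul] at h1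
    have h3 : ‖(2 * Real.pi * Complex.I : ℂ)‖ = 2 * Real.pi := by
      simp [abs_of_pos Real.pi_pos]
    rw [h3, mul_lt_iff_lt_one_left (by positivity), Complex.norm_intCast] at h1
    have h4 : m - m₀ = 0 := by
      rw [← Int.abs_lt_one_iff]; exact_mod_cast h1
    rw [← sub_eq_zero, h2, h4]; simp
  have h0 : (⟨l - fun _ => l k₀, sub_mem hl (hconst _)⟩ : L) = 0 := by
    apply E.injective
    ext k
    rw [hE, map_zero]
    simp [hconstS k k.2]
  have h1 : l i - l k₀ = 0 := congrFun (congrArg Subtype.val h0) i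
  rw [sub_eq_zero.1 h1]
  exact hS k₀ hk₀

theorem contDiff_extend {q : Fin d → Fin (n + 1)} (hq : Function.Injective q)
    (z₀ : Fin (n + 1) → ℂ) : ContDiff ℂ ω fun w : Fin d → ℂ => Function.extend q w z₀ := by
  refine contDiff_pi.2 fun i => ?_
  by_cases h : ∃ j, q j = i
  · obtain ⟨j, rfl⟩ := h
    simp only [hq.extend_apply]
    exact contDiff_apply ℂ ℂ j
  · simp only [Function.extend_apply' _ _ _ h]
    exact contDiff_const

/-- The slice keeps the coordinates in `S` equal to those of `z₀` and lets the other `d` vary. As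
`L` is isomorphic to `ℂ^S`, logarithms of the `S`-coordinates determine the element of `L` that
moves a nearby point onto the slice. -/
theorem exists_isLocalSlice {Y : Type*} {π : coordComplement (complexOf ℰ) → Y}
    (hπ : ∀ z w, π z = π w ↔ ∃ l ∈ L, ∀ i, w.1 i = Complex.exp (l i) * z.1 i)
    (hconst : ∀ c : ℂ, (fun _ => c) ∈ L) (hbd : HasSeparationBounds L ℰ)
    (hph : HasDiagonalPhases L) (hne : ∀ J ∈ ℰ, J.Nonempty)
    (hd : d + finrank ℂ L = n + 1) (z₀ : coordComplement (complexOf ℰ)) :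
    ∃ (W : Set (Fin d → ℂ)) (f : (Fin d → ℂ) → coordComplement (complexOf ℰ)) (w : Fin d → ℂ),
      IsLocalSlice (N := n + 1) π W f ∧ w ∈ W ∧ f w = z₀ := by
  classical
  obtain ⟨J, hJ, hz₀⟩ := mem_coordComplement_complexOf.1 z₀.2
  obtain ⟨S, E, q, hSJ, hE, hq, hSq⟩ := exists_coordinates hbd hph hne hJ hd
  obtain ⟨δ, hδ, hphase⟩ := exists_phase_near hconst hbd hph hJ
  set g : (Fin d → ℂ) → Fin (n + 1) → ℂ := fun w => Function.extend q w z₀.1 with hg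
  have hgq : ∀ w j, g w (q j) = w j := fun w j => hq.extend_apply _ _ _
  have hgS : ∀ w, ∀ k ∈ S, g w k = z₀.1 k := fun w k hk =>
    Function.extend_apply' _ _ _ fun ⟨j, hj⟩ => (hSq k).1 hk j hj
  have hgd : ContDiff ℂ ω g := contDiff_extend hq z₀.1
  have hext : ∀ {x y : Fin (n + 1) → ℂ}, (∀ k ∈ S, x k = y k) → (∀ j, x (q j) = y (q j)) →
      x = y := by
    intro x y h1 h2
    ext i
    by_cases hi : i ∈ S
    · exact h1 i hi
    · rw [hSq] at hi
      push Not at hi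
      obtain ⟨j, rfl⟩ := hi
      exact h2 j
  set w₀ : Fin d → ℂ := fun j => z₀.1 (q j) with hw₀
  have hgw₀ : g w₀ = z₀.1 := hext (hgS w₀) (hgq w₀)
  -- Within `δ / 2` of `z₀` in log-modulus on `J`: an element of `L` joining two slice points then
  -- has real parts at most `δ` there, as `exists_phase_near` requires.
  have hnhds : ∀ᶠ w in nhds w₀, ∀ j ∈ J, g w j ≠ 0 ∧
      |Real.log ‖g w j‖ - Real.log ‖z₀.1 j‖| < δ / 2 := by
    rw [Filter.eventually_all_finset]
    intro j hj
    have hc : ContinuousAt (fun w => g w j) w₀ :=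
      ((continuous_apply j).comp hgd.continuous).continuousAt
    have h0 : g w₀ j ≠ 0 := by rw [hgw₀]; exact hz₀ j hj
    refine (hc.eventually_ne h0).and ?_
    have hc2 : ContinuousAt (fun w => |Real.log ‖g w j‖ - Real.log ‖z₀.1 j‖|) w₀ :=
      ((hc.norm.log (norm_ne_zero_iff.2 h0)).sub continuousAt_const).abs
    refine hc2.eventually_lt_const ?_
    simp only [hgw₀, sub_self, abs_zero]
    positivity
  obtain ⟨W, hWsub, hW, hw₀W⟩ := mem_nhds_iff.1 hnhds
  have hgU : ∀ w ∈ W, g w ∈ coordComplement (complexOf ℰ) := fun w hw =>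
    mem_coordComplement_complexOf.2 ⟨J, hJ, fun j hj => (hWsub hw j hj).1⟩
  let f : (Fin d → ℂ) → coordComplement (complexOf ℰ) := fun w =>
    if h : g w ∈ coordComplement (complexOf ℰ) then ⟨g w, h⟩ else z₀
  have hf : ∀ w ∈ W, (f w).1 = g w := fun w hw => congrArg Subtype.val (dif_pos (hgU w hw))
  -- the retraction onto the slice near a point of the slice
  let μ : (Fin (n + 1) → ℂ) → L := fun x =>
    E.symm fun k => -Complex.log (x k / z₀.1 k)
  let r : (Fin (n + 1) → ℂ) → (Fin d → ℂ) := fun x j =>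
    Complex.exp ((μ x).1 (q j)) * x (q j)
  have hgr : ∀ x, (∀ k ∈ S, x k ≠ 0) → ∀ i, g (r x) i = Complex.exp ((μ x).1 i) * x i := by
    intro x hx i
    refine congrFun (hext (x := g (r x)) (y := fun i => Complex.exp ((μ x).1 i) * x i) ?_ ?_) i
    · intro k hk
      have h1 : (μ x).1 k = -Complex.log (x k / z₀.1 k) := by
        rw [← hE (μ x) ⟨k, hk⟩]; simp [μ]
      have hz0 := hz₀ k (hSJ hk)
      rw [hgS _ k hk, h1, Complex.exp_neg, Complex.exp_log (div_ne_zero (hx k hk) hz0), inv_div,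
        div_mul_cancel₀ _ (hx k hk)]
    · intro j
      rw [hgq]
  have hrg : ∀ w, r (g w) = w := by
    intro w
    have h1 : μ (g w) = 0 := by
      have : (fun k : S => -Complex.log (g w k / z₀.1 k)) = 0 := by
        ext k
        rw [hgS w k k.2, div_self (hz₀ k (hSJ k.2))]; simp
      simp only [μ, this, map_zero]
    ext j
    simp only [r, h1]
    simp [hgq]
  have hrd : ∀ w, ContDiffAt ℂ ω r (g w) := by
    intro w
    have h1 : ContDiffAt ℂ ω (fun x : Fin (n + 1) → ℂ =>
        (fun k : S => -Complex.log (x k / z₀.1 k))) (g w) := by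
      refine contDiffAt_pi.2 fun k => ContDiffAt.neg ?_
      have h2 : ContDiffAt ℂ ω (fun x : Fin (n + 1) → ℂ => x k / z₀.1 k) (g w) :=
        (contDiff_apply ℂ ℂ _).contDiffAt.div_const _
      refine ContDiffAt.comp (g w) (Complex.contDiffAt_log ?_) h2
      rw [hgS w k k.2, div_self (hz₀ k (hSJ k.2))]
      exact Complex.one_mem_slitPlane
    have h2 : ContDiffAt ℂ ω (fun x => (μ x).1) (g w) :=
      ((L.subtype.comp E.symm.toLinearMap).toContinuousLinearMap.contDiff.contDiffAt).comp
        (g w) h1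
    refine contDiffAt_pi.2 fun j => ?_
    exact (Complex.contDiff_exp.contDiffAt.comp (g w) (contDiffAt_pi.1 h2 (q j))).mul
      (contDiff_apply ℂ ℂ _).contDiffAt
  refine ⟨W, f, w₀, ⟨hW, ?_, ?_, ?_⟩, hw₀W, Subtype.ext ((hf w₀ hw₀W).trans hgw₀)⟩
  · intro w hw
    refine (ChartedSpace.liftPropWithinAt_subtypeVal_comp_iff f W w).1 ?_
    exact (hgd.contMDiff.contMDiffAt.contMDiffWithinAt (s := W)).congr
      (fun y hy => hf y hy) (hf w hw)
  · intro w hw w' hw' hww'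
    obtain ⟨l, hl, hlw⟩ := (hπ _ _).1 hww'
    rw [hf w hw, hf w' hw'] at hlw
    have hre : ∀ j ∈ J, |(l j).re| ≤ δ := by
      intro j hj
      obtain ⟨h1, h2⟩ := hWsub hw j hj
      obtain ⟨h3, h4⟩ := hWsub hw' j hj
      have h5 : Real.log ‖g w' j‖ = (l j).re + Real.log ‖g w j‖ := by
        rw [hlw j, norm_mul, Complex.norm_exp, Real.log_mul (Real.exp_pos _).ne'
          (norm_ne_zero_iff.2 h1), Real.log_exp]
      rw [abs_lt] at h2 h4
      rw [abs_le]
      constructor <;> linarith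
    obtain ⟨θ, hθ⟩ := hphase l hl hre
    have hS : ∀ k ∈ S, Complex.exp (l k) = 1 := by
      intro k hk
      have := hlw k
      rw [hgS _ k hk, hgS _ k hk] at this
      exact (mul_eq_right₀ (hz₀ k (hSJ hk))).1 this.symm
    have h1 := exp_eq_one_of_phase hconst E hE hl hθ hS
    ext j
    have := hlw (q j)
    rw [h1, one_mul, hgq, hgq] at this
    exact this.symm
  · intro w hw x hx
    obtain ⟨l, hl, hlx⟩ := (hπ _ _).1 hx
    rw [hf w hw] at hlx
    -- A point elsewhere on the fibre is first carried to the slice by the fixed group element `exp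
    -- l`, after which the retraction near the slice applies.
    let m : (Fin (n + 1) → ℂ) → (Fin (n + 1) → ℂ) := fun y i => Complex.exp (l i) * y i
    have hmx : m x.1 = g w := funext fun i => (hlx i).symm
    have hmd : ContDiff ℂ ω m :=
      contDiff_pi.2 fun i => contDiff_const.mul (contDiff_apply ℂ ℂ i)
    have hρ : ContDiffAt ℂ ω (r ∘ m) x.1 :=
      ContDiffAt.comp x.1 (by rw [hmx]; exact hrd w) hmd.contDiffAt
    have hρ' : ContMDiffAt 𝓘(ℂ, Fin (n + 1) → ℂ) 𝓘(ℂ, Fin d → ℂ) ω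
        (fun y : coordComplement (complexOf ℰ) => (r ∘ m) y) x :=
      contMDiffAt_subtype_iff.2 hρ.contMDiffAt
    refine ⟨_, hρ', ?_⟩
    have hW' : ∀ᶠ y : coordComplement (complexOf ℰ) in nhds x, (r ∘ m) y ∈ W := by
      refine hρ'.continuousAt.eventually_mem (hW.mem_nhds ?_)
      rwa [Function.comp_apply, hmx, hrg]
    have hne' : ∀ᶠ y : coordComplement (complexOf ℰ) in nhds x, ∀ k ∈ S, m y.1 k ≠ 0 := by
      rw [Filter.eventually_all_finset]
      intro k hk
      have hc : Continuous fun y : coordComplement (complexOf ℰ) => m y.1 k :=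
        (continuous_apply k).comp (hmd.continuous.comp continuous_subtype_val)
      refine hc.continuousAt.eventually_ne ?_
      rw [hmx, hgS w k hk]
      exact hz₀ k (hSJ hk)
    filter_upwards [hW', hne'] with y hyW hy0
    refine ⟨hyW, ((hπ _ _).2 ⟨(μ (m y.1)).1 + l, add_mem (μ (m y.1)).2 hl, fun i => ?_⟩).symm⟩
    rw [hf _ hyW, Function.comp_apply, hgr _ hy0, Pi.add_apply, Complex.exp_add, mul_assoc]

end Slice

/-! ### Splitting off the direction `v₁` -/

section Splitting

variable {ι V : Type*} [AddCommGroup V] [Module ℝ V]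

/-- A splitting of `V → V ⧸ ℝ v₁` identifies `V` with `(V ⧸ ℝ v₁) × ℝ`. -/
theorem exists_splitting_equiv {Γ : ι → Dual ℝ V} [Nonempty ι] {v₁ : V} (hv₁ : ∀ i, Γ i v₁ = 1)
    {s : (V ⧸ Submodule.span ℝ {v₁}) →ₗ[ℝ] V}
    (hs : ∀ x, (Submodule.span ℝ {v₁}).mkQ (s x) = x)
    {Γ' : ι → Dual ℝ (V ⧸ Submodule.span ℝ {v₁})} (hΓ' : ∀ i, Γ' i = (Γ i).comp s) :
    ∃ e : ((V ⧸ Submodule.span ℝ {v₁}) × ℝ) ≃ₗ[ℝ] V, ∀ i x r, Γ i (e (x, r)) = Γ' i x + r := by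
  let f := s.coprod (LinearMap.toSpanSingleton ℝ V v₁)
  have hf : ∀ x r, f (x, r) = s x + r • v₁ := fun x r => by simp [f]
  have hmk : (Submodule.span ℝ {v₁}).mkQ v₁ = 0 := by simp
  have hbij : Function.Bijective f := by
    constructor
    · rw [injective_iff_map_eq_zero]
      rintro ⟨x, r⟩ h
      rw [hf] at h
      have hx : x = 0 := by
        have := congrArg (Submodule.span ℝ {v₁}).mkQ h
        rwa [map_add, hs, map_smul, hmk, smul_zero, add_zero, map_zero] at this
      have hr : r = 0 := by
        have := congrArg (Γ (Classical.arbitrary ι)) h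
        simpa [hx, hv₁] using this
      rw [hx, hr]; rfl
    · intro v
      have : v - s ((Submodule.span ℝ {v₁}).mkQ v) ∈ Submodule.span ℝ {v₁} := by
        refine (Submodule.Quotient.mk_eq_zero _).1 ?_
        rw [← Submodule.mkQ_apply, map_sub, hs, sub_self]
      obtain ⟨r, hr⟩ := Submodule.mem_span_singleton.1 this
      exact ⟨((Submodule.span ℝ {v₁}).mkQ v, r), by rw [hf, hr]; abel⟩
  refine ⟨LinearEquiv.ofBijective f hbij, fun i x r => ?_⟩
  rw [LinearEquiv.ofBijective_apply, hf, map_add, map_smul, hv₁, hΓ']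
  simp

end Splitting

/-! ### Complex structures on the two quotients -/

section Manifold

variable {n d : ℕ} {F : Type*} [AddCommGroup F] [Module ℝ F] {Γ' : Fin (n + 1) → Dual ℝ F}
  {𝒥 : F →ₗ[ℝ] F} {ℰ : Set (Finset (Fin (n + 1)))} {h𝒥 : ∀ x, 𝒥 (𝒥 x) = -x}

theorem exists_isQuotientComplexManifold_torusExpQuotient
    (hbd : HasSeparationBounds (actionSubmodule Γ' 𝒥 h𝒥) ℰ)
    (hph : HasDiagonalPhases (actionSubmodule Γ' 𝒥 h𝒥)) (hne : ∀ J ∈ ℰ, J.Nonempty)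
    (hd : d + finrank ℂ (actionSubmodule Γ' 𝒥 h𝒥) = n + 1) :
    ∃ _ : ChartedSpace (Fin d → ℂ) (TorusExpQuotient (complexOf ℰ) Γ' 𝒥),
      IsQuotientComplexManifold (N := n + 1) (d := d)
        (Quotient.mk _ :
          coordComplement (complexOf ℰ) → TorusExpQuotient (complexOf ℰ) Γ' 𝒥) :=
  exists_isQuotientComplexManifold isOpenQuotientMap_torusExpQuotient_mk
    (exists_isLocalSlice (fun _ _ => Quotient.eq.trans (torusExpSetoid_iff h𝒥))
      (const_mem_actionSubmodule Γ' 𝒥 h𝒥) hbd hph hne hd)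

/-- Slices are built for the composite `U(K) → P(ℰ) → N`, whose fibres are again orbits of `exp L`,
and the first projection is cancelled. -/
theorem exists_isQuotientComplexManifold_LVMBQuotient
    (hbd : HasSeparationBounds (actionSubmodule Γ' 𝒥 h𝒥) ℰ)
    (hph : HasDiagonalPhases (actionSubmodule Γ' 𝒥 h𝒥)) (hne : ∀ J ∈ ℰ, J.Nonempty)
    (hd : d + finrank ℂ (actionSubmodule Γ' 𝒥 h𝒥) = n + 1) :
    ∃ _ : ChartedSpace (Fin d → ℂ) (LVMBQuotient ℰ Γ' 𝒥),
      IsQuotientComplexManifold (N := n) (d := d)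
        (Quotient.mk _ : projComplement ℰ → LVMBQuotient ℰ Γ' 𝒥) := by
  obtain ⟨Φ, hΦ⟩ := exists_homeomorph_LVMBQuotient (Γ' := Γ') (𝒥 := 𝒥) hne
  have hopen : IsOpenQuotientMap
      ((Quotient.mk _ : projComplement ℰ → LVMBQuotient ℰ Γ' 𝒥) ∘ projectivize hne) := by
    have h := Φ.isOpenQuotientMap.comp
      (isOpenQuotientMap_torusExpQuotient_mk (K := complexOf ℰ) (Γ' := Γ') (𝒥 := 𝒥))
    rwa [show Φ ∘ Quotient.mk _ = _ from funext hΦ] at h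
  obtain ⟨C, hC⟩ := exists_isQuotientComplexManifold hopen
    (exists_isLocalSlice (fun z w => Quotient.eq.trans
      ((expSetoid_projectivize_iff hne).trans (torusExpSetoid_iff h𝒥)))
      (const_mem_actionSubmodule Γ' 𝒥 h𝒥) hbd hph hne hd)
  exact ⟨C, (isQuotientComplexManifold_projectivize hne).of_comp hC⟩

/-- Holomorphy on a quotient is tested after pulling back along the projection, so both directions
reduce to the projections from `U(K)`. -/
theorem contMDiff_homeomorph_LVMBQuotient (hne : ∀ J ∈ ℰ, J.Nonempty)
    {Φ : TorusExpQuotient (complexOf ℰ) Γ' 𝒥 ≃ₜ LVMBQuotient ℰ Γ' 𝒥}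
    (hΦ : ∀ z, Φ (Quotient.mk _ z) = Quotient.mk _ (projectivize hne z))
    [ChartedSpace (Fin d → ℂ) (LVMBQuotient ℰ Γ' 𝒥)]
    [ChartedSpace (Fin d → ℂ) (TorusExpQuotient (complexOf ℰ) Γ' 𝒥)]
    (hN : IsQuotientComplexManifold (N := n) (d := d)
      (Quotient.mk _ : projComplement ℰ → LVMBQuotient ℰ Γ' 𝒥))
    (hT : IsQuotientComplexManifold (N := n + 1) (d := d)
      (Quotient.mk _ : coordComplement (complexOf ℰ) → TorusExpQuotient (complexOf ℰ) Γ' 𝒥)) :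
    ContMDiff 𝓘(ℂ, Fin d → ℂ) 𝓘(ℂ, Fin d → ℂ) ω Φ ∧
      ContMDiff 𝓘(ℂ, Fin d → ℂ) 𝓘(ℂ, Fin d → ℂ) ω Φ.symm := by
  have hp := isQuotientComplexManifold_projectivize hne
  refine ⟨hT.contMDiff_of_comp ?_, hN.contMDiff_of_comp (hp.contMDiff_of_comp ?_)⟩
  · rw [show Φ ∘ Quotient.mk _ = _ from funext hΦ]
    exact hN.holomorphic.comp hp.holomorphic
  · convert hT.holomorphic
    ext z
    simp only [Function.comp_apply, ← hΦ, Φ.symm_apply_apply]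

end Manifold

end LVMB

/-! ### The proposition -/

theorem proposition13p1 {n : ℕ} {V : Type*} [AddCommGroup V] [Module ℝ V] [FiniteDimensional ℝ V]
    (Γ : Fin (n + 1) → Dual ℝ V) (hΓ : Submodule.span ℝ (range Γ) = ⊤)
    (v₁ : V) (hv₁ : ∀ i, Γ i v₁ = 1)
    (s : (V ⧸ Submodule.span ℝ {v₁}) →ₗ[ℝ] V)
    (hs : ∀ x, (Submodule.span ℝ {v₁}).mkQ (s x) = x)
    (ℰ : Set (Finset (Fin (n + 1)))) (hℰ : ℰ.Nonempty)
    (Γ' : Fin (n + 1) → Dual ℝ (V ⧸ Submodule.span ℝ {v₁}))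
    (hΓ' : ∀ i, Γ' i = (Γ i).comp s)
    (hmin : ∀ J ∈ ℰ, IsMinimalAffineGenerating Γ' J) :
    -- `P(ℰ)` is the projectivisation of `U_ℂ(K)`
    ((0 : Fin (n + 1) → ℂ) ∉ coordComplement (complexOf ℰ) ∧
      ∀ (z : Fin (n + 1) → ℂ) (hz : z ≠ 0),
        Projectivization.mk ℂ z hz ∈ projComplement ℰ ↔ z ∈ coordComplement (complexOf ℰ)) ∧
    -- LVMB data correspond to complete simplicial fans
    (IsLVMBDatum ℰ Γ' ↔
      IsTriangulatedConfiguration (complexOf ℰ) (galeDual Γ) ∧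
        IsCompleteSimplicialFan (conesOf (complexOf ℰ) (galeDual Γ))) ∧
    -- the LVMB manifold as a quotient
    (∀ 𝒥 : (V ⧸ Submodule.span ℝ {v₁}) →ₗ[ℝ] (V ⧸ Submodule.span ℝ {v₁}),
      (∀ x, 𝒥 (𝒥 x) = -x) → IsLVMBDatum ℰ Γ' →
      -- the diagonal circle acts freely on the moment-angle manifold, and the quotient is `𝒩`
      (∀ (c : Circle) (z : momentAngle (complexOf ℰ)),
        circleAct (complexOf ℰ) c z = z → c = 1) ∧
      (∃ Ψ : Quotient (circleSetoid (complexOf ℰ)) ≃ₜ LVMBQuotient ℰ Γ' 𝒥,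
        ∀ z : momentAngle (complexOf ℰ), ∃ (hz : z.1 ≠ 0)
          (hp : Projectivization.mk ℂ z.1 hz ∈ projComplement ℰ),
          Ψ (Quotient.mk _ z) = Quotient.mk _ ⟨Projectivization.mk ℂ z.1 hz, hp⟩) ∧
      -- `𝒩` is a compact complex manifold with the complex structure induced from `P(ℰ)`, and it
      -- is biholomorphic to the quotient of `U_ℂ(K)` by the torus-exponential action
      CompactSpace (LVMBQuotient ℰ Γ' 𝒥) ∧ T2Space (LVMBQuotient ℰ Γ' 𝒥) ∧
      ∃ d : ℕ, 2 * d + finrank ℝ (V ⧸ Submodule.span ℝ {v₁}) = 2 * n ∧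
        (∃ _ : ChartedSpace (Fin d → ℂ) (LVMBQuotient ℰ Γ' 𝒥),
          IsQuotientComplexManifold (N := n) (d := d)
            (Quotient.mk _ : projComplement ℰ → LVMBQuotient ℰ Γ' 𝒥)) ∧
        (∃ _ : ChartedSpace (Fin d → ℂ) (TorusExpQuotient (complexOf ℰ) Γ' 𝒥),
          IsQuotientComplexManifold (N := n + 1) (d := d)
            (Quotient.mk _ :
              coordComplement (complexOf ℰ) → TorusExpQuotient (complexOf ℰ) Γ' 𝒥)) ∧
        ∃ Φ : TorusExpQuotient (complexOf ℰ) Γ' 𝒥 ≃ₜ LVMBQuotient ℰ Γ' 𝒥,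
          (∀ z : coordComplement (complexOf ℰ), ∃ (hz : z.1 ≠ 0)
            (hp : Projectivization.mk ℂ z.1 hz ∈ projComplement ℰ),
            Φ (Quotient.mk _ z) = Quotient.mk _ ⟨Projectivization.mk ℂ z.1 hz, hp⟩) ∧
          ∀ (_ : ChartedSpace (Fin d → ℂ) (LVMBQuotient ℰ Γ' 𝒥))
            (_ : ChartedSpace (Fin d → ℂ) (TorusExpQuotient (complexOf ℰ) Γ' 𝒥)),
            IsQuotientComplexManifold (N := n) (d := d)
              (Quotient.mk _ : projComplement ℰ → LVMBQuotient ℰ Γ' 𝒥) →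
            IsQuotientComplexManifold (N := n + 1) (d := d)
              (Quotient.mk _ :
                coordComplement (complexOf ℰ) → TorusExpQuotient (complexOf ℰ) Γ' 𝒥) →
            ContMDiff 𝓘(ℂ, Fin d → ℂ) 𝓘(ℂ, Fin d → ℂ) ω Φ ∧
            ContMDiff 𝓘(ℂ, Fin d → ℂ) 𝓘(ℂ, Fin d → ℂ) ω Φ.symm) := by
  obtain ⟨e, he⟩ := exists_splitting_equiv hv₁ hs hΓ'
  have hB : ∀ J ∈ ℰ, IsInterpolating Γ J := fun J hJ => (hmin J hJ).isInterpolating e he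
  have hne : ∀ J ∈ ℰ, J.Nonempty := by
    intro J hJ
    have h := (hmin J hJ).prop
    by_contra hcon
    rw [Finset.not_nonempty_iff_eq_empty] at hcon
    subst hcon
    simp at h
  refine ⟨⟨fun h0 => ne_zero_of_mem_coordComplement hne h0 rfl, fun z hz => mk_mem_projComplement hz⟩,
    ⟨fun h => ?_, fun h => ?_⟩, ?_⟩
  · have hsep := isInseparable_of_imbrication e he hB h.imbrication
    exact ⟨isTriangulatedConfiguration_complexOf hℰ hB hsep,
      isCompleteSimplicialFan_complexOf hℰ hB hsep h.substituteExistence⟩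
  · have hsep := isInseparable_of_isTriangulatedConfiguration hB h.1
    exact ⟨imbrication_of_isInseparable e he (fun J hJ => (hmin J hJ).prop) hsep,
      substituteExistence_of_complete hB hsep h.2.complete⟩
  · intro 𝒥 h𝒥 h
    have hsep := isInseparable_of_imbrication e he hB h.imbrication
    have hbd : HasSeparationBounds (actionSubmodule Γ' 𝒥 h𝒥) ℰ :=
      hasSeparationBounds_actionSubmodule e he h.imbrication
    have hph : HasDiagonalPhases (actionSubmodule Γ' 𝒥 h𝒥) :=
      hasDiagonalPhases_actionSubmodule e he hℰ hB
    have hcover : ∀ z ∈ coordComplement (complexOf ℰ), ∃ l ∈ actionSubmodule Γ' 𝒥 h𝒥,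
        (fun i => Complex.exp (l i) * z i) ∈ momentAngle (complexOf ℰ) := fun z hz =>
      exists_exp_mul_mem_momentAngle e he hℰ hB hsep h.substituteExistence hz
    -- Twice `dim L` is `dim V' + 2`, so `d = n + 1 - dim L` satisfies `2 d + dim V' = 2 n`.
    have hrank := finrank_actionSubmodule (h𝒥 := h𝒥) e he hℰ hB
    have hle := (actionSubmodule Γ' 𝒥 h𝒥).finrank_le
    rw [finrank_fintype_fun_eq_card, Fintype.card_fin] at hle
    have hd : (n + 1 - finrank ℂ (actionSubmodule Γ' 𝒥 h𝒥)) +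
        finrank ℂ (actionSubmodule Γ' 𝒥 h𝒥) = n + 1 := Nat.sub_add_cancel hle
    obtain ⟨Φ, hΦ⟩ := exists_homeomorph_LVMBQuotient (Γ' := Γ') (𝒥 := 𝒥) hne
    obtain ⟨Ψ, hΨ⟩ := exists_homeomorph_circleQuotient hbd hph hcover
    have := t2Space_torusExpQuotient hbd hph
    have := compactSpace_torusExpQuotient hcover
    refine ⟨eq_one_of_circleAct_eq hne, ⟨Ψ.trans Φ, fun z => ?_⟩, Φ.compactSpace, Φ.t2Space,
      n + 1 - finrank ℂ (actionSubmodule Γ' 𝒥 h𝒥), by omega,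
      exists_isQuotientComplexManifold_LVMBQuotient hbd hph hne hd,
      exists_isQuotientComplexManifold_torusExpQuotient hbd hph hne hd, Φ, fun z => ?_,
      fun _ _ hN hT => contMDiff_homeomorph_LVMBQuotient hne hΦ hN hT⟩
    · refine ⟨ne_zero_of_mem_coordComplement hne (momentAngle_subset_coordComplement z.2),
        (mk_mem_projComplement _).2 (momentAngle_subset_coordComplement z.2), ?_⟩
      rw [Homeomorph.trans_apply, hΨ, hΦ]; rfl
    · exact ⟨ne_zero_of_mem_coordComplement hne z.2, (mk_mem_projComplement _).2 z.2, hΦ z⟩
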